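/- Let $0<\vartheta<\pi$, let $k\in C_0^\infty(-1,1)$ be real-valued with $\int_{\mathbb R}k(s)\,ds=1$, and for $\delta>0$ put $k_\delta(s)=\frac{\vartheta}{\delta}k\!\left(\frac{s}{\delta}\right)$. Let $\Gamma_\vartheta\subset\mathbb R^2$ be the graph with one vertex, at the origin, and two half-line edges such that, moving along one edge to the vertex and then along the other edge, the direction turns by the angle $\vartheta$. Let $\Gamma_{\vartheta,\delta}$ be the smooth curve with arc length parametrization $\zeta_\delta$ and curvature $k_\delta$, placed in the plane so that its straight parts $s\le-\delta$ and $s\ge\delta$ lie on the lines that contain the two edges, so that it coincides with $\Gamma_\vartheta$ outside a neighbourhood of the vertex of size $O(\delta)$; assume that these curves have no self-intersections. Let $d_\delta(q)=\mathrm{dist}(q,\Gamma_{\vartheta,\delta})$, let $n_\delta(s)$ be the unit normal, and let $(s_\delta,u_\delta)$ be the tubular coordinates, $q=\zeta_\delta(s_\delta)+u_\delta\,n_\delta(s_\delta)$, where $\zeta_\delta(s_\delta)$ is the point of $\Gamma_{\vartheta,\delta}$ nearest to $q$ (so $|u_\delta|=d_\delta(q)$; this determines them for almost every $q$). Let $\widehat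 H_D(\varepsilon,\delta)=-\frac12\Delta+\frac{1}{2\varepsilon^2}d_\delta^2$ on $L^2(\{d_\delta<\delta\})$ with Dirichlet boundary conditions, and let $\widehat K(\delta)=-\frac12\frac{d^2}{ds^2}-\frac{k_\delta(s)^2}{8}$ on $L^2(\mathbb R)$, with domain $H^2(\mathbb R)$. For $n\in\mathbb N_0$ let $\Phi_n^\varepsilon$ be the normalized eigenfunction of $-\frac12\frac{d^2}{dy^2}+\frac{y^2}{2\varepsilon^2}$ with eigenvalue $E_n/\varepsilon$, $E_n=n+\frac12$. Fix one of the two edges and let $(x,y)$ be the Cartesian coordinates in which this edge lies on the $x$-axis with the vertex at $x=0$, $x$ increasing and $y$ oriented as $s_\delta$ and $u_\delta$ are along this edge (so the edge is $\{x\le 0\}$ or $\{x\ge0\}$ on the axis $y=0$). Let $f\in C_0^\infty(\mathbb R)$ be complex-valued with support in $(-\infty,0)$, respectively $(0,\infty)$, and let $\psi_0(x,y)=f(x)\,\Phi_n^\varepsilon(y)$. Let $\delta(\varepsilon)>0$ satisfy $\delta(\varepsilon)\to0$ and $\varepsilon^{1/10}/\delta(\varepsilon)\to0$ as $\varepsilon\to0^+$.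 Then for every $T$, $$\sup_{t\in[0,T]}\Big\| e^{-it\widehat H_D(\varepsilon,\delta(\varepsilon))}F_{d_{\delta(\varepsilon)}<\delta(\varepsilon)}\psi_0-\big(e^{-it\widehat K(\delta(\varepsilon))-itE_n/\varepsilon}f\big)(s_{\delta(\varepsilon)})\;F_{d_{\delta(\varepsilon)}<\delta(\varepsilon)}\,\Phi_n^\varepsilon(u_{\delta(\varepsilon)})\Big\|\longrightarrow0\qquad(\varepsilon\to0^+),$$ where $F_{d_\delta<\delta}$ is the characteristic function of the tube $\{d_\delta<\delta\}$ and the norm is that of $L^2(\{d_{\delta(\varepsilon)}<\delta(\varepsilon)\},dx\,dy)$. -/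

import Mathlib

open Set Filter Topology MeasureTheory

open scoped ContDiff

noncomputable section

/-- The Euclidean plane. -/
abbrev Plane := EuclideanSpace ℝ (Fin 2)

/-! ### Unitary groups generated by (unbounded) operators -/

/-- `U` is the strongly continuous one-parameter unitary group `t ↦ exp(-itA)`, where the unbounded
operator `A` on the Hilbert space `E` is given by its graph. The last clause says that the
infinitesimal generator of `U` is exactly `-iA`: the orbit of `ψ` is differentiable at `0` with
derivative `-i h` if and only if `ψ` is in the domain of `A` and `A ψ = h`.
Such a `U` is unique, and by Stone's theorem it exists exactly when `A` is self-adjoint. -/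
structure IsUnitaryGroup {E : Type*} [NormedAddCommGroup E] [InnerProductSpace ℂ E]
    (A : Set (E × E)) (U : ℝ → (E ≃ₗᵢ[ℂ] E)) : Prop where
  map_zero : U 0 = 1
  map_add : ∀ s t : ℝ, U (s + t) = U s * U t
  continuous : ∀ ψ : E, Continuous fun t : ℝ => U t ψ
  generator : ∀ ψ h : E,
    HasDerivAt (fun t : ℝ => U t ψ) (-(Complex.I • h)) 0 ↔ (ψ, h) ∈ A

open scoped Classical in
/-- The unitary group `exp(-itA)` of a self-adjoint operator `A` given by its graph (the trivial
group if `A` is not self-adjoint). -/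
def unitaryGroup {E : Type*} [NormedAddCommGroup E] [InnerProductSpace ℂ E]
    (A : Set (E × E)) : ℝ → (E ≃ₗᵢ[ℂ] E) :=
  if h : ∃ U, IsUnitaryGroup A U then h.choose else fun _ => 1

open scoped Classical in
/-- The class in `L²(Ω)` of a square-integrable function (`0` if the function is not
square-integrable on `Ω`). -/
def toL2 {X : Type*} [MeasureSpace X] (Ω : Set X) (g : X → ℂ) :
    Lp ℂ 2 ((volume : Measure X).restrict Ω) :=
  if h : MemLp g 2 ((volume : Measure X).restrict Ω) then h.toLp g else 0

/-! ### Schrödinger operators with Dirichlet boundary conditions -/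

section Schrodinger

variable {X : Type*} [NormedAddCommGroup X] [InnerProductSpace ℝ X] [FiniteDimensional ℝ X]
  [MeasureSpace X]

/-- Test functions `φ ∈ C_c^∞(Ω)`. -/
structure IsTestFunction (Ω : Set X) (φ : X → ℂ) : Prop where
  smooth : ContDiff ℝ ∞ φ
  compact : HasCompactSupport φ
  support : tsupport φ ⊆ Ω

/-- Membership in `H¹₀(Ω)`, the closure of `C_c^∞(Ω)` in the Sobolev space `H¹(Ω)`: there are test
functions `φ m` that converge to `ψ` in `L²(Ω)` and whose differentials converge in `L²(Ω)`
(to `G`, which then is the weak differential of `ψ`). -/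
def MemH10 (Ω : Set X) (ψ : X → ℂ) : Prop :=
  ∃ (φ : ℕ → X → ℂ) (G : X → (X →L[ℝ] ℂ)),
    (∀ m, IsTestFunction Ω (φ m)) ∧
    MemLp G 2 ((volume : Measure X).restrict Ω) ∧
    Tendsto (fun m => eLpNorm (fun x => φ m x - ψ x) 2 ((volume : Measure X).restrict Ω))
      atTop (𝓝 0) ∧
    Tendsto (fun m => eLpNorm (fun x => fderiv ℝ (φ m) x - G x) 2
      ((volume : Measure X).restrict Ω)) atTop (𝓝 0)

/-- (The graph of) the Schrödinger operator `-½Δ + V` on `L²(Ω)` with Dirichlet boundary conditions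
on `∂Ω`, `V` a bounded continuous potential on the open set `Ω`: its domain is the set of
`ψ ∈ H¹₀(Ω)` for which the distribution `(-½Δ + V)ψ` on `Ω` is a function `h ∈ L²(Ω)`,
and `ψ` is then mapped to `h`. For `Ω = ℝ` and bounded `V` the domain is `H²(ℝ)`. -/
def dirichletSchrodinger (Ω : Set X) (V : X → ℝ) :
    Set (Lp ℂ 2 ((volume : Measure X).restrict Ω) × Lp ℂ 2 ((volume : Measure X).restrict Ω)) :=
  {p | MemH10 Ω p.1 ∧ ∀ φ : X → ℂ, IsTestFunction Ω φ →
    ∫ x in Ω, (-(1 / 2 : ℂ) * Laplacian.laplacian φ x + (V x : ℂ) * φ x) * p.1 x =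
      ∫ x in Ω, φ x * p.2 x}

end Schrodinger

/-! ### The smoothed graph -/

/-- The curvature `k_d(s) = (ϑ/d) k(s/d)`. -/
def scaledCurvature (ϑ : ℝ) (k : ℝ → ℝ) (d s : ℝ) : ℝ := ϑ / d * k (s / d)

/-- The angle by which the curve has turned at arc length `s`. -/
def turningAngle (ϑ : ℝ) (k : ℝ → ℝ) (d s : ℝ) : ℝ := ∫ r in (-d)..s, scaledCurvature ϑ k d r

/-- The unit tangent after turning (clockwise) by the angle `θ`, starting from `(1, 0)`. -/
def tangentVec (θ : ℝ) : Plane := !₂[Real.cos θ, -Real.sin θ]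

/-- The unit normal; `(tangentVec θ, normalVec θ)` is a positively oriented orthonormal frame. -/
def normalVec (θ : ℝ) : Plane := !₂[Real.sin θ, Real.cos θ]

/-- The curve with arc length parameter `s` and curvature `k_d`, placed in the plane so that it
coincides, outside a neighbourhood of the origin of size `O(d)`, with the graph that consists of
the two half-lines `{x • tangentVec 0 : x ≤ 0}` and `{x • tangentVec ϑ : 0 ≤ x}`.
With `D = ∫_{-d}^{d} (tangent) ds = a • tangentVec 0 + b • tangentVec ϑ`, the bend begins at
`-a • tangentVec 0` (at `s = -d`) and ends at `b • tangentVec ϑ` (at `s = d`). -/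
def smoothedCurve (ϑ : ℝ) (k : ℝ → ℝ) (d s : ℝ) : Plane :=
  (-((∫ r in (-d)..d, Real.cos (turningAngle ϑ k d r)) -
      (∫ r in (-d)..d, Real.sin (turningAngle ϑ k d r)) * (Real.cos ϑ / Real.sin ϑ))) •
      tangentVec 0 +
    !₂[∫ r in (-d)..s, Real.cos (turningAngle ϑ k d r),
       -∫ r in (-d)..s, Real.sin (turningAngle ϑ k d r)]

/-- The distance of a point of the plane from the smoothed curve. -/
def curveDist (ϑ : ℝ) (k : ℝ → ℝ) (d : ℝ) (q : Plane) : ℝ :=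
  Metric.infDist q (range (smoothedCurve ϑ k d))

/-- The tube of radius `d` around the smoothed curve. -/
def curveTube (ϑ : ℝ) (k : ℝ → ℝ) (d : ℝ) : Set Plane := {q | curveDist ϑ k d q < d}

/-- The map `(s, u) ↦ ζ(s) + u n(s)`. -/
def tubularMap (ϑ : ℝ) (k : ℝ → ℝ) (d : ℝ) (p : ℝ × ℝ) : Plane :=
  smoothedCurve ϑ k d p.1 + p.2 • normalVec (turningAngle ϑ k d p.1)

/-- The tubular coordinates `(s, u)` of the point `q`: `ζ(s)` is a point of the curve nearest to
`q`, and `q = ζ(s) + u n(s)`, so that `|u|` is the distance of `q` from the curve. Where the tubular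
map is injective, this is its inverse. (On the Lebesgue null set of points that have
several nearest points on the curve, one of them is chosen.) -/
def tubularCoord (ϑ : ℝ) (k : ℝ → ℝ) (d : ℝ) (q : Plane) : ℝ × ℝ :=
  Classical.epsilon fun p : ℝ × ℝ => tubularMap ϑ k d p = q ∧ |p.2| = curveDist ϑ k d q

/-! ### The states and the Hamiltonians -/

/-- The normalized eigenfunction `Φ_n^ε` of `-½ d²/dy² + y²/(2ε²)` for the eigenvalue `E_n/ε`,
`E_n = n + 1/2`. (`Polynomial.hermite n` is the probabilists' Hermite polynomial.) -/
def oscillatorMode (n : ℕ) (ε y : ℝ) : ℝ :=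
  (Real.sqrt n.factorial)⁻¹ * (Real.pi * ε) ^ (-(1 / 4) : ℝ) *
    Polynomial.aeval (Real.sqrt (2 / ε) * y) (Polynomial.hermite n) *
    Real.exp (-(y ^ 2) / (2 * ε))

/-- The product state `f(x) Φ_n^ε(y)`, where `(x, y)` are the Cartesian coordinates along the
frame `(tangentVec θ, normalVec θ)`. -/
def productState (θ : ℝ) (f : ℝ → ℂ) (n : ℕ) (ε : ℝ) (q : Plane) : ℂ :=
  f (inner ℝ (tangentVec θ) q) * (oscillatorMode n ε (inner ℝ (normalVec θ) q) : ℂ)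

/-- The Hamiltonian `-½Δ + dist(·, curve)²/(2ε²)` in the tube of radius `d` around the curve, with
Dirichlet boundary conditions on the boundary of the tube. -/
def tubeHamiltonian (ϑ : ℝ) (k : ℝ → ℝ) (ε d : ℝ) :
    Set (Lp ℂ 2 ((volume : Measure Plane).restrict (curveTube ϑ k d)) ×
      Lp ℂ 2 ((volume : Measure Plane).restrict (curveTube ϑ k d))) :=
  dirichletSchrodinger (curveTube ϑ k d) fun q => 1 / ε ^ 2 * (1 / 2 * curveDist ϑ k d q ^ 2)

/-- The effective Hamiltonian `-½ d²/ds² - k_d(s)²/8` on `L²(ℝ)`. -/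
def effectiveHamiltonian (ϑ : ℝ) (k : ℝ → ℝ) (d : ℝ) :
    Set (Lp ℂ 2 ((volume : Measure ℝ).restrict univ) ×
      Lp ℂ 2 ((volume : Measure ℝ).restrict univ)) :=
  dirichletSchrodinger (univ : Set ℝ) fun s => -(scaledCurvature ϑ k d s ^ 2 / 8)

/-- The evolution in the tube of the restriction to the tube of the state `ψ₀`, at time `t`. -/
def tubeEvolution (ϑ : ℝ) (k : ℝ → ℝ) (ε d t : ℝ) (ψ₀ : Plane → ℂ) : Plane → ℂ :=
  unitaryGroup (tubeHamiltonian ϑ k ε d) t (toL2 (curveTube ϑ k d) ψ₀)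

/-- The effective evolution on the line of the state `f`, at time `t`. -/
def effectiveEvolution (ϑ : ℝ) (k : ℝ → ℝ) (d t : ℝ) (f : ℝ → ℂ) : ℝ → ℂ :=
  unitaryGroup (effectiveHamiltonian ϑ k d) t (toL2 univ f)

/-- The function `(exp(-it K(d) - it E_n/ε) f)(s) · Φ_n^ε(u)` in tubular coordinates. -/
def effectiveState (ϑ : ℝ) (k : ℝ → ℝ) (ε d t : ℝ) (f : ℝ → ℂ) (n : ℕ) (q : Plane) : ℂ :=
  Complex.exp (-(Complex.I * t * (((n : ℂ) + 1 / 2) / ε))) *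
    effectiveEvolution ϑ k d t f (tubularCoord ϑ k d q).1 *
    (oscillatorMode n ε (tubularCoord ϑ k d q).2 : ℂ)

end

/-! In tubular coordinates the Laplacian acquires the Jacobian a = 1 + uκ(s). The weight a^(-1/2)
removes the first-order term in the normal direction and leaves the potential -κ²/8 on the curve. So
for g on the line the quasimode Jg = g(s) a^(-1/2) χ(u/r) Φ_n(u), with r = cδ, satisfies H Jg = J K
g + (E_n/ε) Jg + error (`IsTubeWidth.schrodinger_quasimode`).

Every term of the error is dominated by |u Φ_n| or |u² Φ_n'|. This includes the terms from the
cutoff, whose derivatives vanish near 0 and hence are bounded by powers of |u|/r, so no Gaussian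
tail estimate is needed. Both weights have L² norm O(√ε). Curvature and its derivatives cost r^(-3)
(`exists_quasimodeError_bound`), and bounding g' and g'' by the graph norm of K costs another
r^(-2). The relative error is thus √ε/δ^5, the fifth power of ε^(1/10)/δ up to a constant
(`exists_intertwining_bound`).

Duhamel's formula turns approximate intertwining of generators into approximate intertwining of
groups (`norm_unitaryGroup_sub_le`). The graph norm of f is conserved by exp(-itK). It does not blow
up as δ → 0, because the support of f misses the bend once δ is small, where K f = -f''/2. It
remains to compare J f with the product state, the difference being a shift of size O(δ) along the
edge and a cutoff error O(√ε/δ) (`exists_initialState_bound`), and J exp(-itK) f with the unweighted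
product in tubular coordinates, at a cost O(√ε/δ) (`exists_effectiveState_bound`).

On the operator side, the resolvent of a Dirichlet Schrödinger operator is written as ιι*, where ι
embeds the form space into L² (`exists_resolvent_dirichletSchrodinger`). For a bounded injective
self-adjoint R the group exp(-itR⁻¹) comes from the continuous functional calculus of z exp(-it/z),
followed by extension from the dense range of R (`isUnitaryGroup_shiftedInverseGroup`). The
intertwining is computed on test functions and extended to the domain of K because they form a core
(`exists_testFunction_core`).

On the geometric side, the tubular map is injective only up to width cδ, where c depends on the
curve at unit scale (`exists_tube_width`). In the rest of the tube only upper bounds on L² norms are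
needed; these follow from the existence of tubular coordinates and a bounded Jacobian, without
injectivity (`lintegral_tubularCoord_le`). -/

noncomputable section

set_option linter.unusedSectionVars false

/-! ### The unitary group generated by the inverse of a bounded self-adjoint operator -/

section StoneGroup

/-- The function `z ↦ z exp(-it/z)`, which is continuous on the real axis. -/
def phaseMul (t : ℝ) (z : ℂ) : ℂ := z * Complex.exp (-(Complex.I * t / z))

lemma norm_exp_phase {t : ℝ} {z : ℂ} (hz : z.im = 0) :
    ‖Complex.exp (-(Complex.I * t / z))‖ = 1 := by
  obtain ⟨x, rfl⟩ : ∃ x : ℝ, z = x := ⟨z.re, by apply Complex.ext <;> simp [hz]⟩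
  have : -(Complex.I * t / x) = ((-(t / x) : ℝ) : ℂ) * Complex.I := by push_cast; ring
  rw [this, Complex.norm_exp_ofReal_mul_I]

lemma norm_phaseMul {t : ℝ} {z : ℂ} (hz : z.im = 0) : ‖phaseMul t z‖ = ‖z‖ := by
  rw [phaseMul, norm_mul, norm_exp_phase hz, mul_one]

/-- At the origin the exponential oscillates without limit, but its modulus is 1 on the real axis,
so the factor `z` forces the limit 0. Off the real axis this fails, hence the restriction. -/
lemma continuousOn_phaseMul (t : ℝ) : ContinuousOn (phaseMul t) {z : ℂ | z.im = 0} := by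
  intro z hz
  by_cases h0 : z = 0
  · subst h0
    have h : Tendsto (fun z : ℂ => ‖z‖) (𝓝[{z : ℂ | z.im = 0}] 0) (𝓝 0) := by
      simpa using (continuous_norm.tendsto (0 : ℂ)).mono_left nhdsWithin_le_nhds
    unfold ContinuousWithinAt
    rw [show phaseMul t 0 = 0 by simp [phaseMul]]
    refine squeeze_zero_norm' ?_ h
    filter_upwards [self_mem_nhdsWithin] with w hw
    exact (norm_phaseMul hw).le
  · apply ContinuousAt.continuousWithinAt
    unfold phaseMul
    fun_prop (disch := exact h0)

/-- The two regularizing factors `z` are both kept; this is the origin of the extra factor `R` in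
the group law of `smoothedGroup`. -/
lemma phaseMul_mul (s t : ℝ) (z : ℂ) : phaseMul s z * phaseMul t z = phaseMul (s + t) z * z := by
  have : Complex.exp (-(Complex.I * (s + t : ℝ) / z)) =
      Complex.exp (-(Complex.I * s / z)) * Complex.exp (-(Complex.I * t / z)) := by
    rw [← Complex.exp_add]; congr 1; push_cast; ring
  rw [phaseMul, phaseMul, phaseMul, this]; ring

lemma star_phaseMul {t : ℝ} {z : ℂ} (hz : z.im = 0) : star (phaseMul t z) = phaseMul (-t) z := by
  obtain ⟨x, rfl⟩ : ∃ x : ℝ, z = x := ⟨z.re, by apply Complex.ext <;> simp [hz]⟩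
  simp only [phaseMul, star_mul', Complex.star_def, Complex.conj_ofReal, ← Complex.exp_conj]
  congr 2
  simp

lemma norm_phaseMul_sub_le {s t : ℝ} {z : ℂ} (hz : z.im = 0) :
    ‖phaseMul t z - phaseMul s z‖ ≤ |t - s| := by
  obtain ⟨x, rfl⟩ : ∃ x : ℝ, z = x := ⟨z.re, by apply Complex.ext <;> simp [hz]⟩
  by_cases h0 : x = 0
  · simp [phaseMul, h0]
  have : phaseMul t x - phaseMul s x =
      x * (Complex.exp (-(Complex.I * s / x)) *
        (Complex.exp (Complex.I * ((-((t - s) / x) : ℝ) : ℂ)) - 1)) := by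
    rw [mul_sub, ← Complex.exp_add, phaseMul, phaseMul]
    have : -(Complex.I * s / x) + Complex.I * ((-((t - s) / x) : ℝ) : ℂ) =
      -(Complex.I * t / x) := by push_cast; ring
    rw [this]; ring
  rw [this, norm_mul, norm_mul, norm_exp_phase (by simp), one_mul]
  have h := Real.norm_exp_I_mul_ofReal_sub_one_le (x := -((t - s) / x))
  calc ‖(x : ℂ)‖ * _ ≤ |x| * ‖-((t - s) / x)‖ := by
        rw [Complex.norm_real, Real.norm_eq_abs]; gcongr
    _ = |t - s| := by
        rw [norm_neg, norm_div, Real.norm_eq_abs, Real.norm_eq_abs]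
        field_simp

/-- With two factors of `z` the group is differentiable uniformly in `z`: for |t| ≤ |z| this is the
second-order Taylor remainder of exp, and for |z| < |t| the crude bound 2|t|/|z| on the exponential
terms suffices. -/
lemma norm_phaseMul_mul_sub_le {t : ℝ} {z : ℂ} (hz : z.im = 0) :
    ‖phaseMul t z * z - z * z + Complex.I * t * z‖ ≤ 2 * t ^ 2 := by
  obtain ⟨x, rfl⟩ : ∃ x : ℝ, z = x := ⟨z.re, by apply Complex.ext <;> simp [hz]⟩
  by_cases h0 : x = 0
  · simp [phaseMul, h0]; positivity
  have hx : (x : ℂ) ≠ 0 := by exact_mod_cast h0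
  have e1 : phaseMul t x * x - x * x + Complex.I * t * x = x * x *
      (Complex.exp (-(Complex.I * t / x)) - 1 - (-(Complex.I * t / x))) := by
    rw [phaseMul]; field_simp; ring
  have hn : ‖-(Complex.I * t / x)‖ = |t| / |x| := by simp
  rw [e1, norm_mul, norm_mul, Complex.norm_real, Real.norm_eq_abs]
  have hxp : 0 < |x| := abs_pos.mpr h0
  by_cases h1 : |t| / |x| ≤ 1
  · have := Complex.norm_exp_sub_one_sub_id_le (x := -(Complex.I * t / x)) (by rw [hn]; exact h1)
    rw [hn] at this
    calc |x| * |x| * _ ≤ |x| * |x| * (|t| / |x|) ^ 2 := by gcongr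
      _ = t ^ 2 := by rw [← sq_abs t]; field_simp
      _ ≤ _ := by nlinarith [sq_nonneg t]
  · push Not at h1
    have h2 : ‖Complex.exp (-(Complex.I * t / x)) - 1 - (-(Complex.I * t / x))‖ ≤
        |t| / |x| + |t| / |x| := by
      refine (norm_sub_le _ _).trans ?_
      rw [hn]
      gcongr
      have h := Real.norm_exp_I_mul_ofReal_sub_one_le (x := -(t / x))
      have e2 : Complex.I * ((-(t / x) : ℝ) : ℂ) = -(Complex.I * t / x) := by push_cast; ring
      rw [e2] at h
      simpa [abs_div] using h
    calc |x| * |x| * _ ≤ |x| * |x| * (|t| / |x| + |t| / |x|) := by gcongr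
      _ = 2 * (|x| * |t|) := by field_simp; ring
      _ ≤ 2 * t ^ 2 := by
        rw [one_lt_div hxp] at h1
        rw [← sq_abs t, sq]; gcongr

variable {E : Type*} [NormedAddCommGroup E] [InnerProductSpace ℂ E] [CompleteSpace E]
  (R : E →L[ℂ] E)

/-- The bounded operator `R exp(-itR⁻¹)`. -/
def smoothedGroup (t : ℝ) : E →L[ℂ] E := cfc (phaseMul t) R

variable {R} (hR : IsSelfAdjoint R)

include hR

lemma spectrum_subset_real : spectrum ℂ R ⊆ {z : ℂ | z.im = 0} :=
  fun _ hz => hR.im_eq_zero_of_mem_spectrum hz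

lemma continuousOn_phaseMul_spectrum (t : ℝ) : ContinuousOn (phaseMul t) (spectrum ℂ R) :=
  (continuousOn_phaseMul t).mono (spectrum_subset_real hR)

lemma smoothedGroup_zero : smoothedGroup R 0 = R := by
  have := hR.isStarNormal
  rw [smoothedGroup, show phaseMul 0 = id by ext z; simp [phaseMul]]
  exact cfc_id ℂ R

lemma smoothedGroup_mul (s t : ℝ) :
    smoothedGroup R s * smoothedGroup R t = smoothedGroup R (s + t) * R := by
  have := hR.isStarNormal
  have c := continuousOn_phaseMul_spectrum hR
  calc _ = cfc (fun z => phaseMul s z * phaseMul t z) R := (cfc_mul _ _ R (c s) (c t)).symm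
    _ = cfc (fun z => phaseMul (s + t) z * z) R := by simp_rw [phaseMul_mul]
    _ = _ := by rw [cfc_mul _ (fun z => z) R (c _) continuousOn_id, cfc_id' ℂ R, smoothedGroup]

lemma star_smoothedGroup (t : ℝ) : star (smoothedGroup R t) = smoothedGroup R (-t) := by
  have := hR.isStarNormal
  rw [smoothedGroup, ← cfc_star, smoothedGroup]
  exact cfc_congr fun z hz => star_phaseMul (spectrum_subset_real hR hz)

/-- Writing S_t for the smoothed group, S_t* S_t = S_(-t) S_t = S_0 R = R². This isometry relative
to `R` is what permits the extension to all of `E`. -/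
lemma norm_smoothedGroup_apply (t : ℝ) (ψ : E) : ‖smoothedGroup R t ψ‖ = ‖R ψ‖ := by
  have h1 : inner ℂ (smoothedGroup R t ψ) (smoothedGroup R t ψ) = inner ℂ (R ψ) (R ψ) := by
    rw [← ContinuousLinearMap.adjoint_inner_right, ← ContinuousLinearMap.star_eq_adjoint,
      star_smoothedGroup hR, ← mul_apply_eq_comp, smoothedGroup_mul hR,
      neg_add_cancel, smoothedGroup_zero hR, mul_apply_eq_comp]
    conv_lhs => rw [← ContinuousLinearMap.adjoint_inner_left, ← ContinuousLinearMap.star_eq_adjoint,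
      hR.star_eq]
  rw [inner_self_eq_norm_sq_to_K, inner_self_eq_norm_sq_to_K] at h1
  have h2 : ‖smoothedGroup R t ψ‖ ^ 2 = ‖R ψ‖ ^ 2 := by exact_mod_cast h1
  exact (sq_eq_sq₀ (norm_nonneg _) (norm_nonneg _)).mp h2

lemma norm_smoothedGroup_sub_le (s t : ℝ) :
    ‖smoothedGroup R t - smoothedGroup R s‖ ≤ |t - s| := by
  have := hR.isStarNormal
  have c := continuousOn_phaseMul_spectrum hR
  rw [smoothedGroup, smoothedGroup, ← cfc_sub _ _ R (c t) (c s)]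
  exact norm_cfc_le (abs_nonneg _) fun z hz => norm_phaseMul_sub_le (spectrum_subset_real hR hz)

lemma norm_smoothedGroup_mul_sub_le (t : ℝ) :
    ‖smoothedGroup R t * R - R * R + (Complex.I * t) • R‖ ≤ 2 * t ^ 2 := by
  have := hR.isStarNormal
  have c := continuousOn_phaseMul_spectrum hR
  have e : smoothedGroup R t * R - R * R + (Complex.I * t) • R =
      cfc (fun z => phaseMul t z * z - z * z + Complex.I * t * z) R := by
    rw [cfc_add .., cfc_sub .., cfc_mul _ (fun z => z) R (c t) continuousOn_id,
      cfc_mul (fun z => z) (fun z => z) R continuousOn_id continuousOn_id,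
      cfc_const_mul _ (fun z => z) R continuousOn_id, cfc_id' ℂ R, smoothedGroup]
  rw [e]
  exact norm_cfc_le (by positivity) fun z hz => norm_phaseMul_mul_sub_le (spectrum_subset_real hR hz)

variable (hinj : Function.Injective R)
include hinj

/-- The orthogonal complement of the range is the kernel of the adjoint, which is `R` itself. -/
lemma denseRange_of_selfAdjoint_injective : DenseRange R := by
  have h : R.range.topologicalClosure = ⊤ := by
    rw [Submodule.topologicalClosure_eq_top_iff, ContinuousLinearMap.orthogonal_range,
      ← ContinuousLinearMap.star_eq_adjoint, hR.star_eq]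
    exact LinearMap.ker_eq_bot.mpr hinj
  exact Submodule.dense_iff_topologicalClosure_eq_top.mpr h

omit hinj in
lemma smoothedGroup_comm (t : ℝ) (ψ : E) : R (smoothedGroup R t ψ) = smoothedGroup R t (R ψ) := by
  have h := smoothedGroup_mul hR 0 t
  rw [smoothedGroup_zero hR, zero_add] at h
  exact congrArg (fun A : E →L[ℂ] E => A ψ) h

variable (R) in
omit hR hinj in
/-- The unitary operator `exp(-itR⁻¹)`, as a bounded operator. -/
def inverseGroup (t : ℝ) : E →L[ℂ] E :=
  (smoothedGroup R t).toLinearMap.extendOfNorm R.toLinearMap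

lemma inverseGroup_apply (t : ℝ) (ψ : E) : inverseGroup R t (R ψ) = smoothedGroup R t ψ :=
  LinearMap.extendOfNorm_eq (f := (smoothedGroup R t).toLinearMap) (e := R.toLinearMap)
    (denseRange_of_selfAdjoint_injective hR hinj)
    ⟨1, fun x => by rw [one_mul]; exact (norm_smoothedGroup_apply hR t x).le⟩ ψ

lemma norm_inverseGroup (t : ℝ) (ψ : E) : ‖inverseGroup R t ψ‖ = ‖ψ‖ := by
  refine (denseRange_of_selfAdjoint_injective hR hinj).induction_on ψ
    (isClosed_eq (by fun_prop) (by fun_prop)) fun φ => ?_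
  rw [inverseGroup_apply hR hinj, norm_smoothedGroup_apply hR]

lemma inverseGroup_comm (t : ℝ) (ψ : E) : R (inverseGroup R t ψ) = smoothedGroup R t ψ := by
  refine (denseRange_of_selfAdjoint_injective hR hinj).induction_on ψ
    (isClosed_eq (by fun_prop) (by fun_prop)) fun φ => ?_
  rw [inverseGroup_apply hR hinj, smoothedGroup_comm hR]

lemma inverseGroup_add (s t : ℝ) (ψ : E) :
    inverseGroup R s (inverseGroup R t ψ) = inverseGroup R (s + t) ψ := by
  have hd := denseRange_of_selfAdjoint_injective hR hinj
  -- Vectors of the form R(Rφ) are dense, and two factors of `R` are needed, one for each smoothed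
  -- operator.
  refine (hd.comp hd R.continuous).induction_on ψ
    (isClosed_eq (by fun_prop) (by fun_prop)) fun φ => ?_
  rw [Function.comp_apply, inverseGroup_apply hR hinj, inverseGroup_apply hR hinj,
    ← smoothedGroup_comm hR, inverseGroup_apply hR hinj]
  exact congrArg (fun A : E →L[ℂ] E => A φ) (smoothedGroup_mul hR s t)

lemma inverseGroup_zero (ψ : E) : inverseGroup R 0 ψ = ψ := by
  refine (denseRange_of_selfAdjoint_injective hR hinj).induction_on ψ
    (isClosed_eq (by fun_prop) (by fun_prop)) fun φ => ?_
  rw [inverseGroup_apply hR hinj, smoothedGroup_zero hR]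

/-- On the range of `R` this is the quadratic estimate `norm_smoothedGroup_mul_sub_le`. A general
vector is approximated by some Rφ, and the rest is controlled by the Lipschitz bound of the smoothed
group in operator norm. -/
lemma hasDerivAt_smoothedGroup (ψ : E) :
    HasDerivAt (fun t => smoothedGroup R t ψ) (-(Complex.I • ψ)) 0 := by
  rw [hasDerivAt_iff_isLittleO, Asymptotics.isLittleO_iff]
  intro ε hε
  obtain ⟨φ, hφ⟩ := (denseRange_of_selfAdjoint_injective hR hinj).exists_dist_lt ψ
    (show 0 < ε / 4 by positivity)
  rw [dist_eq_norm] at hφ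
  filter_upwards [Metric.ball_mem_nhds (0 : ℝ)
    (show 0 < ε / (4 * (‖φ‖ + 1)) by positivity)] with t ht
  rw [Metric.mem_ball, dist_zero_right, Real.norm_eq_abs, lt_div_iff₀ (by positivity)] at ht
  simp only [sub_zero, Real.norm_eq_abs, smoothedGroup_zero hR]
  have e : smoothedGroup R t ψ - R ψ - t • -(Complex.I • ψ) =
      (smoothedGroup R t - smoothedGroup R 0) (ψ - R φ) + (Complex.I * t) • (ψ - R φ) +
      (smoothedGroup R t * R - R * R + (Complex.I * t) • R) φ := by
    simp only [smoothedGroup_zero hR, map_sub, sub_apply, add_apply, mul_apply_eq_comp,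
      smul_apply, ← Complex.coe_smul t]
    module
  have h1 : ‖(smoothedGroup R t - smoothedGroup R 0) (ψ - R φ)‖ ≤ |t| * ‖ψ - R φ‖ := by
    have := ContinuousLinearMap.le_of_opNorm_le _ (norm_smoothedGroup_sub_le hR 0 t) (ψ - R φ)
    rwa [sub_zero] at this
  have h2 : ‖(Complex.I * t) • (ψ - R φ)‖ = |t| * ‖ψ - R φ‖ := by rw [norm_smul]; simp
  have h3 := ContinuousLinearMap.le_of_opNorm_le _ (norm_smoothedGroup_mul_sub_le hR t) φ
  have h4 : 2 * t ^ 2 * ‖φ‖ ≤ ε / 2 * |t| := by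
    rw [← sq_abs]
    nlinarith [abs_nonneg t, norm_nonneg φ]
  have h5 : |t| * ‖ψ - R φ‖ ≤ |t| * (ε / 4) := by gcongr
  rw [e]
  refine (norm_add₃_le ..).trans ?_
  linarith

lemma continuous_inverseGroup (ψ : E) : Continuous fun t => inverseGroup R t ψ := by
  rw [Metric.continuous_iff]
  intro t ε hε
  obtain ⟨φ, hφ⟩ := (denseRange_of_selfAdjoint_injective hR hinj).exists_dist_lt ψ
    (show 0 < ε / 4 by positivity)
  refine ⟨ε / (4 * (‖φ‖ + 1)), by positivity, fun s hs => ?_⟩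
  rw [dist_eq_norm] at hφ ⊢
  have e : inverseGroup R s ψ - inverseGroup R t ψ = inverseGroup R s (ψ - R φ) -
      inverseGroup R t (ψ - R φ) + (smoothedGroup R s - smoothedGroup R t) φ := by
    rw [map_sub, map_sub, inverseGroup_apply hR hinj, inverseGroup_apply hR hinj,
      sub_apply]
    abel
  have h1 : ‖(smoothedGroup R s - smoothedGroup R t) φ‖ ≤ |s - t| * ‖φ‖ :=
    ContinuousLinearMap.le_of_opNorm_le _ (norm_smoothedGroup_sub_le hR t s) φ
  have h2 : |s - t| * ‖φ‖ ≤ ε / 4 := by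
    rw [Real.dist_eq, lt_div_iff₀ (by positivity)] at hs
    nlinarith [abs_nonneg (s - t), norm_nonneg φ]
  rw [e]
  calc _ ≤ ‖inverseGroup R s (ψ - R φ)‖ + ‖inverseGroup R t (ψ - R φ)‖ + _ :=
        (norm_add_le _ _).trans (add_le_add_left (norm_sub_le _ _) _)
    _ < ε := by rw [norm_inverseGroup hR hinj, norm_inverseGroup hR hinj]; linarith

/-- The unitary operator `exp(-it(R⁻¹ - c))`. -/
def shiftedInverseGroup (c t : ℝ) : E ≃ₗᵢ[ℂ] E :=
  LinearIsometryEquiv.ofSurjective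
    { toLinearMap := (Complex.exp (Complex.I * c * t) • inverseGroup R t : E →L[ℂ] E).toLinearMap
      norm_map' := fun ψ => by
        have : Complex.I * c * t = ((c * t : ℝ) : ℂ) * Complex.I := by push_cast; ring
        simp only [ContinuousLinearMap.coe_coe, smul_apply]
        rw [norm_smul, this, Complex.norm_exp_ofReal_mul_I, one_mul, norm_inverseGroup hR hinj] }
    fun ψ => ⟨Complex.exp (-(Complex.I * c * t)) • inverseGroup R (-t) ψ, by
      change Complex.exp (Complex.I * c * t) • inverseGroup R t _ = ψ
      rw [map_smul, smul_smul, ← Complex.exp_add, add_neg_cancel, Complex.exp_zero, one_smul,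
        inverseGroup_add hR hinj, add_neg_cancel, inverseGroup_zero hR hinj]⟩

lemma shiftedInverseGroup_apply (c t : ℝ) (ψ : E) :
    shiftedInverseGroup hR hinj c t ψ = Complex.exp (Complex.I * c * t) • inverseGroup R t ψ := rfl

/-- A bounded injective self-adjoint operator `R` yields the unitary group of `R⁻¹ - c`. -/
theorem isUnitaryGroup_shiftedInverseGroup (c : ℝ) :
    IsUnitaryGroup {p : E × E | R (p.2 + (c : ℂ) • p.1) = p.1} (shiftedInverseGroup hR hinj c) where
  map_zero := by
    ext ψ
    simp [shiftedInverseGroup_apply, inverseGroup_zero hR hinj]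
  map_add s t := by
    ext ψ
    rw [LinearIsometryEquiv.coe_mul, Function.comp_apply, shiftedInverseGroup_apply, shiftedInverseGroup_apply,
      shiftedInverseGroup_apply, map_smul, smul_smul, ← Complex.exp_add,
      inverseGroup_add hR hinj]
    push_cast
    ring_nf
  continuous ψ := by
    simp_rw [shiftedInverseGroup_apply]
    exact Continuous.smul (by fun_prop) (continuous_inverseGroup hR hinj ψ)
  generator ψ h := by
    simp_rw [shiftedInverseGroup_apply, mem_ofPred_eq]
    have hexp : ∀ a : ℝ, HasDerivAt (fun t : ℝ => Complex.exp (Complex.I * a * t))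
        (Complex.I * a) 0 := fun a => by
      have := ((Complex.ofRealCLM.hasDerivAt (x := (0 : ℝ))).const_mul (Complex.I * a)).cexp
      simpa using! this
    constructor
    · intro hd
      -- Removing the phase and applying `R` turns the orbit into one of the smoothed group, whose
      -- derivative is known; uniqueness of the derivative gives the equation.
      have h1 := (hexp (-c)).smul hd
      have e1 : (fun t : ℝ => Complex.exp (Complex.I * (-c : ℝ) * t)) •
          (fun t : ℝ => Complex.exp (Complex.I * c * t) • inverseGroup R t ψ) =
          fun t => inverseGroup R t ψ := by
        ext t
        simp only [Pi.smul_apply', smul_smul, ← Complex.exp_add]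
        simp
      rw [e1] at h1
      have h2 := (R.restrictScalars ℝ).hasFDerivAt.comp_hasDerivAt (0 : ℝ) h1
      have e2 : (R.restrictScalars ℝ) ∘ (fun t => inverseGroup R t ψ) =
          fun t => smoothedGroup R t ψ := funext fun t => inverseGroup_comm hR hinj t ψ
      rw [e2] at h2
      have h3 := h2.unique (hasDerivAt_smoothedGroup hR hinj ψ)
      simp [inverseGroup_zero hR hinj] at h3
      have h4 : Complex.I • R (h + (c : ℂ) • ψ) = Complex.I • ψ := by
        rw [← neg_inj, ← h3, map_add, map_smul]
        module
      exact smul_right_injective E Complex.I_ne_zero h4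
    · intro hψ
      -- Conversely ψ lies in the range of `R`, so its orbit is, up to the phase, an orbit of the
      -- smoothed group and therefore differentiable.
      have h1 := (hexp c).smul (hasDerivAt_smoothedGroup hR hinj (h + (c : ℂ) • ψ))
      simp only [← inverseGroup_apply hR hinj, hψ] at h1
      convert! h1 using 1
      simp [inverseGroup_zero hR hinj]
      module

end StoneGroup

/-! ### Square-integrable classes and multiplication operators -/

section L2

variable {X : Type*} [MeasureSpace X] {Ω : Set X}

lemma toL2_of_memLp {g : X → ℂ} (h : MemLp g 2 ((volume : Measure X).restrict Ω)) :
    toL2 Ω g = h.toLp g := dif_pos h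

lemma coeFn_toL2 {g : X → ℂ} (h : MemLp g 2 ((volume : Measure X).restrict Ω)) :
    toL2 Ω g =ᵐ[(volume : Measure X).restrict Ω] g := by
  rw [toL2_of_memLp h]; exact h.coeFn_toLp

lemma toL2_add {f g : X → ℂ} (hf : MemLp f 2 ((volume : Measure X).restrict Ω))
    (hg : MemLp g 2 ((volume : Measure X).restrict Ω)) :
    toL2 Ω (f + g) = toL2 Ω f + toL2 Ω g := by
  rw [toL2_of_memLp hf, toL2_of_memLp hg, toL2_of_memLp (hf.add hg), MemLp.toLp_add]

lemma toL2_smul {f : X → ℂ} (c : ℂ) (hf : MemLp f 2 ((volume : Measure X).restrict Ω)) :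
    toL2 Ω (c • f) = c • toL2 Ω f := by
  rw [toL2_of_memLp hf, toL2_of_memLp (hf.const_smul c), MemLp.toLp_const_smul]

lemma toL2_congr {f g : X → ℂ} (hf : MemLp f 2 ((volume : Measure X).restrict Ω))
    (h : f =ᵐ[(volume : Measure X).restrict Ω] g) : toL2 Ω f = toL2 Ω g := by
  have hg := (memLp_congr_ae h).mp hf
  rw [toL2_of_memLp hf, toL2_of_memLp hg, MemLp.toLp_eq_toLp_iff]
  exact h

lemma toL2_coeFn (f : Lp ℂ 2 ((volume : Measure X).restrict Ω)) : toL2 Ω f = f := by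
  rw [toL2_of_memLp (Lp.memLp f), Lp.toLp_coeFn]

lemma tendsto_toL2_iff {ι : Type*} {l : Filter ι} {φ : ι → X → ℂ} {g : X → ℂ}
    (hφ : ∀ i, MemLp (φ i) 2 ((volume : Measure X).restrict Ω))
    (hg : MemLp g 2 ((volume : Measure X).restrict Ω)) :
    Tendsto (fun i => toL2 Ω (φ i)) l (𝓝 (toL2 Ω g)) ↔
      Tendsto (fun i => eLpNorm (fun x => φ i x - g x) 2 ((volume : Measure X).restrict Ω)) l
        (𝓝 0) := by
  have e : (fun i => toL2 Ω (φ i)) = fun i => (hφ i).toLp (φ i) :=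
    funext fun i => toL2_of_memLp (hφ i)
  rw [e, toL2_of_memLp hg]
  exact Lp.tendsto_Lp_iff_tendsto_eLpNorm'' φ hφ g hg

lemma norm_toL2_le_of_eLpNorm_le {g : X → ℂ} {C : ℝ} (hC : 0 ≤ C)
    (h : eLpNorm g 2 ((volume : Measure X).restrict Ω) ≤ ENNReal.ofReal C) : ‖toL2 Ω g‖ ≤ C := by
  by_cases hg : MemLp g 2 ((volume : Measure X).restrict Ω)
  · rw [toL2_of_memLp hg, Lp.norm_toLp]
    exact ENNReal.toReal_le_of_le_ofReal hC h
  · rw [toL2, dif_neg hg, norm_zero]; exact hC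

/-- Translates between the bilinear pairing in the weak formulation and the sesquilinear inner
product of L². -/
lemma inner_toL2_conj {χ : X → ℂ} (hχ : MemLp χ 2 ((volume : Measure X).restrict Ω))
    (g : Lp ℂ 2 ((volume : Measure X).restrict Ω)) :
    inner ℂ (toL2 Ω fun x => star (χ x)) g = ∫ x in Ω, χ x * g x := by
  rw [L2.inner_def]
  refine integral_congr_ae ?_
  filter_upwards [coeFn_toL2 (g := fun x => star (χ x)) hχ.star] with x hx
  rw [hx, RCLike.inner_apply, Complex.star_def, Complex.conj_conj, mul_comm]

variable [TopologicalSpace X] [OpensMeasurableSpace X]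

lemma memLp_mul_of_bounded (hΩ : MeasurableSet Ω) {w : X → ℝ} (hw : Continuous w) {C : ℝ}
    (hC : ∀ x ∈ Ω, |w x| ≤ C) {f : X → ℂ} (hf : MemLp f 2 ((volume : Measure X).restrict Ω)) :
    MemLp (fun x => (w x : ℂ) * f x) 2 ((volume : Measure X).restrict Ω) :=
  hf.of_le_mul (c := C)
    ((Complex.continuous_ofReal.comp hw).measurable.aestronglyMeasurable.mul
      hf.aestronglyMeasurable)
    (by
      filter_upwards [(ae_restrict_iff' hΩ).mpr (ae_of_all _ hC)] with x hx
      rw [norm_mul, Complex.norm_real, Real.norm_eq_abs]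
      gcongr)

/-- Multiplication by a bounded continuous function, as an operator on `L²(Ω)`. -/
def mulL2 (hΩ : MeasurableSet Ω) {w : X → ℝ} (hw : Continuous w) {C : ℝ}
    (hC : ∀ x ∈ Ω, |w x| ≤ C) :
    Lp ℂ 2 ((volume : Measure X).restrict Ω) →L[ℂ] Lp ℂ 2 ((volume : Measure X).restrict Ω) :=
  have hb : ∀ᵐ x ∂(volume : Measure X).restrict Ω, |w x| ≤ C :=
    (ae_restrict_iff' hΩ).mpr (ae_of_all _ hC)
  have hm := fun f => memLp_mul_of_bounded hΩ hw hC (Lp.memLp f)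
  LinearMap.mkContinuous
    { toFun := fun f => toL2 Ω fun x => (w x : ℂ) * f x
      map_add' := fun f g => by
        rw [← toL2_add (hm f) (hm g)]
        refine toL2_congr (hm _) ?_
        filter_upwards [Lp.coeFn_add f g] with x hx
        simp only [hx, Pi.add_apply, mul_add]
      map_smul' := fun c f => by
        rw [RingHom.id_apply, ← toL2_smul c (hm f)]
        refine toL2_congr (hm _) ?_
        filter_upwards [Lp.coeFn_smul c f] with x hx
        simp [hx, mul_left_comm] } C fun f => by
    refine Lp.norm_le_mul_norm_of_ae_le_mul ?_
    filter_upwards [coeFn_toL2 (hm f), hb] with x hx hx'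
    simp only [LinearMap.coe_mk, AddHom.coe_mk]
    rw [hx, norm_mul, Complex.norm_real, Real.norm_eq_abs]
    gcongr

lemma mulL2_apply (hΩ : MeasurableSet Ω) {w : X → ℝ} (hw : Continuous w) {C : ℝ}
    (hC : ∀ x ∈ Ω, |w x| ≤ C) (f : Lp ℂ 2 ((volume : Measure X).restrict Ω)) :
    mulL2 hΩ hw hC f = toL2 Ω fun x => (w x : ℂ) * f x := rfl

lemma coeFn_mulL2 (hΩ : MeasurableSet Ω) {w : X → ℝ} (hw : Continuous w) {C : ℝ}
    (hC : ∀ x ∈ Ω, |w x| ≤ C) (f : Lp ℂ 2 ((volume : Measure X).restrict Ω)) :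
    mulL2 hΩ hw hC f =ᵐ[(volume : Measure X).restrict Ω] fun x => (w x : ℂ) * f x :=
  coeFn_toL2 (memLp_mul_of_bounded hΩ hw hC (Lp.memLp f))

end L2

/-! ### Test functions -/

section TestFunctions

variable {X : Type*} [NormedAddCommGroup X] [InnerProductSpace ℝ X] {Ω : Set X}

namespace IsTestFunction

lemma zero : IsTestFunction Ω (0 : X → ℂ) where
  smooth := contDiff_const
  compact := HasCompactSupport.zero
  support := by simp [tsupport]

lemma add {φ χ : X → ℂ} (hφ : IsTestFunction Ω φ) (hχ : IsTestFunction Ω χ) :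
    IsTestFunction Ω (φ + χ) where
  smooth := hφ.smooth.add hχ.smooth
  compact := hφ.compact.add hχ.compact
  support := (tsupport_add φ χ).trans (union_subset hφ.support hχ.support)

lemma const_smul {φ : X → ℂ} (hφ : IsTestFunction Ω φ) (c : ℂ) : IsTestFunction Ω (c • φ) where
  smooth := hφ.smooth.const_smul c
  compact := hφ.compact.mono (Function.support_const_smul_subset c φ)
  support := (closure_mono (Function.support_const_smul_subset c φ)).trans hφ.support

lemma star {φ : X → ℂ} (hφ : IsTestFunction Ω φ) : IsTestFunction Ω fun x => star (φ x) where
  smooth := Complex.conjCLE.contDiff.comp hφ.smooth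
  compact := hφ.compact.comp_left (g := Star.star) (star_zero ℂ)
  support := by
    refine (closure_mono ?_).trans hφ.support
    intro x hx
    simpa using hx

lemma fderiv_apply {φ : X → ℂ} (hφ : IsTestFunction Ω φ) (v : X) :
    IsTestFunction Ω fun x => fderiv ℝ φ x v where
  smooth := (hφ.smooth.fderiv_right (m := ∞) (by simp)).clm_apply contDiff_const
  compact := hφ.compact.fderiv_apply ℝ v
  support := (tsupport_fderiv_apply_subset ℝ v).trans hφ.support

lemma fderiv_star {φ : X → ℂ} (hφ : IsTestFunction Ω φ) (v : X) (x : X) :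
    fderiv ℝ (fun x => Star.star (φ x)) x v = Star.star (fderiv ℝ φ x v) := by
  have := (Complex.conjCLE.toContinuousLinearMap.hasFDerivAt.comp x
    (hφ.smooth.differentiable (by simp) x).hasFDerivAt).fderiv
  have e : (fun x => Star.star (φ x)) = Complex.conjCLE.toContinuousLinearMap ∘ φ := rfl
  rw [e, this]; rfl

variable [MeasureSpace X] [BorelSpace X] [IsFiniteMeasureOnCompacts (volume : Measure X)]

lemma memLp {φ : X → ℂ} (hφ : IsTestFunction Ω φ) :
    MemLp φ 2 ((volume : Measure X).restrict Ω) :=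
  (hφ.smooth.continuous.memLp_of_hasCompactSupport hφ.compact).restrict Ω

end IsTestFunction

lemma IsTestFunction.contDiff_two {φ : X → ℂ} (hφ : IsTestFunction Ω φ) : ContDiff ℝ 2 φ :=
  contDiff_infty.mp hφ.smooth 2

lemma laplacian_eq_sum_fderiv [FiniteDimensional ℝ X] {ι : Type*} [Fintype ι]
    (e : OrthonormalBasis ι ℝ X) {φ : X → ℂ} (hφ : ContDiff ℝ 2 φ) (x : X) :
    Laplacian.laplacian φ x = ∑ i, fderiv ℝ (fun y => fderiv ℝ φ y (e i)) x (e i) := by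
  rw [InnerProductSpace.laplacian_eq_iteratedFDeriv_orthonormalBasis φ e]
  refine Finset.sum_congr rfl fun i _ => ?_
  rw [iteratedFDeriv_two_apply, fderiv_clm_apply]
  · simp
  · exact ((hφ.fderiv_right (m := 1) (by norm_num)).differentiable (by norm_num)) x
  · fun_prop

lemma IsTestFunction.sum {ι : Type*} {s : Finset ι} {φ : ι → X → ℂ}
    (hφ : ∀ i ∈ s, IsTestFunction Ω (φ i)) : IsTestFunction Ω (∑ i ∈ s, φ i) :=
  Finset.sum_induction _ (IsTestFunction Ω) (fun _ _ => IsTestFunction.add) IsTestFunction.zero hφ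

lemma IsTestFunction.laplacian [FiniteDimensional ℝ X] {φ : X → ℂ} (hφ : IsTestFunction Ω φ) :
    IsTestFunction Ω (Laplacian.laplacian φ) := by
  have e : Laplacian.laplacian φ = ∑ i, fun x => fderiv ℝ
      (fun y => fderiv ℝ φ y (stdOrthonormalBasis ℝ X i)) x (stdOrthonormalBasis ℝ X i) := by
    ext x
    rw [laplacian_eq_sum_fderiv (stdOrthonormalBasis ℝ X) hφ.contDiff_two, Finset.sum_apply]
  rw [e]
  exact IsTestFunction.sum fun i _ => (hφ.fderiv_apply _).fderiv_apply _

end TestFunctions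

/-! ### Self-adjointness of Dirichlet Schrödinger operators -/

section Dirichlet

variable {X : Type*} [NormedAddCommGroup X] [InnerProductSpace ℝ X] [FiniteDimensional ℝ X]
  [MeasureSpace X] [BorelSpace X] [(volume : Measure X).IsAddHaarMeasure] {Ω : Set X}
  {ι : Type*} [Fintype ι]

omit [FiniteDimensional ℝ X] [BorelSpace X] [(volume : Measure X).IsAddHaarMeasure] in
lemma IsTestFunction.setIntegral_eq {φ : X → ℂ} (hφ : IsTestFunction Ω φ) (f : X → ℂ) :
    ∫ x in Ω, f x * φ x = ∫ x, f x * φ x :=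
  setIntegral_eq_integral_of_forall_compl_eq_zero fun x hx => by
    rw [image_eq_zero_of_notMem_tsupport fun h => hx (hφ.support h), mul_zero]

lemma IsTestFunction.integral_fderiv_mul {φ χ : X → ℂ} (hφ : IsTestFunction Ω φ)
    (hχ : IsTestFunction Ω χ) (v : X) :
    ∫ x in Ω, φ x * fderiv ℝ χ x v = -∫ x in Ω, fderiv ℝ φ x v * χ x := by
  rw [(hχ.fderiv_apply v).setIntegral_eq, hχ.setIntegral_eq]
  have hint : ∀ {α β : X → ℂ}, IsTestFunction Ω α → IsTestFunction Ω β →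
      Integrable (fun x => α x * β x) := fun ha hb =>
    (ha.smooth.continuous.mul hb.smooth.continuous).integrable_of_hasCompactSupport
      (hb.compact.mul_left)
  exact integral_mul_fderiv_eq_neg_fderiv_mul_of_integrable
    (hint (hφ.fderiv_apply v) hχ) (hint hφ (hχ.fderiv_apply v)) (hint hφ hχ)
    (fun x _ => hφ.smooth.differentiable (by simp) x)
    (fun x _ => hχ.smooth.differentiable (by simp) x)

omit [FiniteDimensional ℝ X] [MeasureSpace X] [BorelSpace X]
  [(volume : Measure X).IsAddHaarMeasure] in
lemma continuous_smulRight (c : X →L[ℝ] ℝ) : Continuous fun z : ℂ => c.smulRight z :=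
  (ContinuousLinearMap.smulRightL ℝ X ℂ c).continuous

omit [FiniteDimensional ℝ X] [BorelSpace X] [(volume : Measure X).IsAddHaarMeasure] in
lemma memLp_smulRight (c : X →L[ℝ] ℝ) {g : X → ℂ}
    (hg : MemLp g 2 ((volume : Measure X).restrict Ω)) :
    MemLp (fun x => c.smulRight (g x)) 2 ((volume : Measure X).restrict Ω) :=
  hg.of_le_mul (c := ‖c‖) ((continuous_smulRight c).comp_aestronglyMeasurable
    hg.aestronglyMeasurable) (ae_of_all _ fun x => (c.norm_smulRight_apply (g x)).le)

lemma memLp_sum_normed {α F : Type*} [MeasurableSpace α] {μ : Measure α} [NormedAddCommGroup F]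
    {f : ι → α → F} (hf : ∀ i, MemLp (f i) 2 μ) : MemLp (fun x => ∑ i, f i x) 2 μ :=
  memLp_finsetSum _ fun i _ => hf i

lemma eLpNorm_sum_le_normed {α F : Type*} [MeasurableSpace α] {μ : Measure α}
    [NormedAddCommGroup F] {f : ι → α → F} (hf : ∀ i, AEStronglyMeasurable (f i) μ) :
    eLpNorm (∑ i, f i) 2 μ ≤ ∑ i, eLpNorm (f i) 2 μ :=
  eLpNorm_sum_le (fun i _ => hf i) (by norm_num)

/-- `ψ ∈ H¹₀(Ω)`, expressed in `L²(Ω)`. -/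
lemma memH10_iff (e : OrthonormalBasis ι ℝ X) (ψ : Lp ℂ 2 ((volume : Measure X).restrict Ω)) :
    MemH10 Ω ψ ↔ ∃ φ : ℕ → X → ℂ, (∀ m, IsTestFunction Ω (φ m)) ∧
      Tendsto (fun m => toL2 Ω (φ m)) atTop (𝓝 ψ) ∧
      ∃ w : ι → Lp ℂ 2 ((volume : Measure X).restrict Ω), ∀ i,
        Tendsto (fun m => toL2 Ω fun x => fderiv ℝ (φ m) x (e i)) atTop (𝓝 (w i)) := by
  constructor
  · rintro ⟨φ, G, hφ, hG, h1, h2⟩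
    have hGi : ∀ i, MemLp (fun x => G x (e i)) 2 ((volume : Measure X).restrict Ω) := fun i =>
      hG.of_le (ContinuousLinearMap.apply ℝ ℂ (e i) |>.continuous.comp_aestronglyMeasurable
        hG.aestronglyMeasurable) (ae_of_all _ fun x => by simpa using (G x).le_opNorm (e i))
    refine ⟨φ, hφ, ?_, fun i => toL2 Ω fun x => G x (e i), fun i => ?_⟩
    · have := (tendsto_toL2_iff (fun m => (hφ m).memLp) (Lp.memLp ψ)).mpr h1
      rwa [toL2_coeFn] at this
    · rw [tendsto_toL2_iff (fun m => ((hφ m).fderiv_apply (e i)).memLp) (hGi i)]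
      refine tendsto_of_tendsto_of_tendsto_of_le_of_le tendsto_const_nhds h2
        (fun _ => zero_le) fun m => eLpNorm_mono fun x => ?_
      simpa using (fderiv ℝ (φ m) x - G x).le_opNorm (e i)
  · rintro ⟨φ, hφ, h1, w, h2⟩
    refine ⟨φ, fun x => ∑ i, (innerSL ℝ (e i)).smulRight (w i x), hφ, ?_, ?_, ?_⟩
    · have hi : ∀ i, MemLp (fun x => (innerSL ℝ (e i)).smulRight (w i x)) 2
          ((volume : Measure X).restrict Ω) := fun i =>
        memLp_smulRight (innerSL ℝ (e i)) (Lp.memLp (w i))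
      exact memLp_sum_normed hi
    · rw [← toL2_coeFn ψ] at h1
      exact (tendsto_toL2_iff (fun m => (hφ m).memLp) (Lp.memLp ψ)).mp h1
    · have h3 : ∀ i, Tendsto (fun m => eLpNorm (fun x => fderiv ℝ (φ m) x (e i) - w i x) 2
          ((volume : Measure X).restrict Ω)) atTop (𝓝 0) := fun i => by
        have := h2 i
        rw [← toL2_coeFn (w i)] at this
        exact (tendsto_toL2_iff (fun m => ((hφ m).fderiv_apply (e i)).memLp) (Lp.memLp _)).mp this
      have h4 := tendsto_finsetSum Finset.univ fun i _ => h3 i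
      simp only [Finset.sum_const_zero] at h4
      refine tendsto_of_tendsto_of_tendsto_of_le_of_le tendsto_const_nhds h4
        (fun _ => zero_le) fun m => ?_
      have e1 : (fun x => fderiv ℝ (φ m) x - ∑ i, (innerSL ℝ (e i)).smulRight (w i x)) =
          ∑ i, fun x => (innerSL ℝ (e i)).smulRight (fderiv ℝ (φ m) x (e i) - w i x) := by
        ext x v
        simp only [Finset.sum_apply, sub_apply, sum_apply,
          ContinuousLinearMap.smulRight_apply, smul_sub, Finset.sum_sub_distrib]
        congr 1
        conv_lhs => rw [← e.sum_repr' v, map_sum]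
        simp
      rw [e1]
      refine (eLpNorm_sum_le_normed (fun i => ?_)).trans
        (Finset.sum_le_sum fun i _ => eLpNorm_mono fun x => ?_)
      · exact (memLp_smulRight (innerSL ℝ (e i)) (g := fun x => fderiv ℝ (φ m) x (e i) - w i x)
          (((hφ m).fderiv_apply (e i)).memLp.sub (Lp.memLp (w i)))).aestronglyMeasurable
      · rw [ContinuousLinearMap.norm_smulRight_apply]
        simp

/-- The weak form of `-½ Δ` on `H¹₀(Ω)`. -/
lemma integral_fderiv_mul_of_tendsto {φ : X → ℂ} (hφ : IsTestFunction Ω φ) {φs : ℕ → X → ℂ}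
    (hφs : ∀ m, IsTestFunction Ω (φs m)) {ψ w : Lp ℂ 2 ((volume : Measure X).restrict Ω)} {v : X}
    (h1 : Tendsto (fun m => toL2 Ω (φs m)) atTop (𝓝 ψ))
    (h2 : Tendsto (fun m => toL2 Ω fun x => fderiv ℝ (φs m) x v) atTop (𝓝 w)) :
    ∫ x in Ω, φ x * w x = -∫ x in Ω, fderiv ℝ φ x v * ψ x := by
  rw [← inner_toL2_conj hφ.memLp, ← inner_toL2_conj (hφ.fderiv_apply v).memLp]
  have t1 := (Tendsto.inner (𝕜 := ℂ)
    (tendsto_const_nhds (x := toL2 Ω fun x => star (fderiv ℝ φ x v))) h1).neg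
  have t2 := Tendsto.inner (𝕜 := ℂ) (tendsto_const_nhds (x := toL2 Ω fun x => star (φ x))) h2
  refine tendsto_nhds_unique t2 (t1.congr fun m => ?_)
  rw [inner_toL2_conj hφ.memLp, inner_toL2_conj (hφ.fderiv_apply v).memLp, neg_eq_iff_eq_neg]
  calc _ = ∫ x in Ω, fderiv ℝ φ x v * φs m x := by
        refine integral_congr_ae ?_
        filter_upwards [coeFn_toL2 (hφs m).memLp] with x hx
        rw [hx]
    _ = -∫ x in Ω, φ x * fderiv ℝ (φs m) x v := by
        rw [hφ.integral_fderiv_mul (hφs m), neg_neg]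
    _ = _ := by
        congr 1
        refine integral_congr_ae ?_
        filter_upwards [coeFn_toL2 ((hφs m).fderiv_apply v).memLp] with x hx
        rw [hx]

end Dirichlet

/-! ### The closed quadratic form of a Schrödinger operator and its resolvent. -/

section FormSpace

variable {X : Type*} [NormedAddCommGroup X] [InnerProductSpace ℝ X] [FiniteDimensional ℝ X]
  [MeasureSpace X] [BorelSpace X] [(volume : Measure X).IsAddHaarMeasure]

/-- The space `C_c^∞(Ω)`. -/
def testSpace (Ω : Set X) : Submodule ℂ (X → ℂ) where
  carrier := {φ | IsTestFunction Ω φ}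
  add_mem' := fun h h' => h.add h'
  zero_mem' := IsTestFunction.zero
  smul_mem' := fun c _ h => h.const_smul c

variable {Ω : Set X} {w : X → ℝ} {ι : Type*} [Fintype ι]

omit [FiniteDimensional ℝ X] in
lemma IsTestFunction.memLp_mul {φ : X → ℂ} (hφ : IsTestFunction Ω φ) (hw : Continuous w) :
    MemLp (fun x => (w x : ℂ) * φ x) 2 ((volume : Measure X).restrict Ω) :=
  (((Complex.continuous_ofReal.comp hw).mul hφ.smooth.continuous).memLp_of_hasCompactSupport
    hφ.compact.mul_left).restrict Ω

/-- The components `w φ` and `∂ᵢφ / √2` of the square root of the quadratic form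
`½ ‖∇φ‖² + ‖w φ‖²`. -/
def formComponents (e : OrthonormalBasis ι ℝ X) (w : X → ℝ) (φ : X → ℂ) : Option ι → X → ℂ
  | none => fun x => (w x : ℂ) * φ x
  | some i => fun x => ((√2)⁻¹ : ℂ) * fderiv ℝ φ x (e i)

omit [FiniteDimensional ℝ X] in
lemma IsTestFunction.memLp_formComponents (e : OrthonormalBasis ι ℝ X) {φ : X → ℂ}
    (hφ : IsTestFunction Ω φ) (hw : Continuous w) (j : Option ι) :
    MemLp (formComponents e w φ j) 2 ((volume : Measure X).restrict Ω) := by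
  cases j with
  | none => exact hφ.memLp_mul hw
  | some i => exact (hφ.fderiv_apply (e i)).memLp.const_mul _

/-- The square root of the quadratic form, as a map into a Hilbert space. -/
def formMap (Ω : Set X) (e : OrthonormalBasis ι ℝ X) (hw : Continuous w) :
    testSpace Ω →ₗ[ℂ] PiLp 2 fun _ : Option ι => Lp ℂ 2 ((volume : Measure X).restrict Ω) where
  toFun φ := WithLp.toLp 2 fun j => toL2 Ω (formComponents e w φ j)
  map_add' φ χ := by
    have hφ : IsTestFunction Ω (φ : X → ℂ) := φ.2
    have hχ : IsTestFunction Ω (χ : X → ℂ) := χ.2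
    ext1 j
    rw [PiLp.add_apply]
    simp only
    rw [← toL2_add (hφ.memLp_formComponents e hw j) (hχ.memLp_formComponents e hw j)]
    congr 1
    cases j with
    | none => ext x; simp [formComponents, mul_add]
    | some i =>
      ext x
      simp only [formComponents, Submodule.coe_add, Pi.add_apply]
      rw [fderiv_add (hφ.smooth.differentiable (by simp) x) (hχ.smooth.differentiable (by simp) x),
        add_apply, mul_add]
  map_smul' c φ := by
    have hφ : IsTestFunction Ω (φ : X → ℂ) := φ.2
    ext1 j
    rw [RingHom.id_apply, PiLp.smul_apply]
    simp only
    rw [← toL2_smul c (hφ.memLp_formComponents e hw j)]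
    congr 1
    cases j with
    | none => ext x; simp [formComponents, mul_left_comm]
    | some i =>
      ext x
      simp only [formComponents, SetLike.val_smul, Pi.smul_apply]
      rw [fderiv_const_smul (hφ.smooth.differentiable (by simp) x), smul_apply, mul_smul_comm]

lemma formMap_apply (e : OrthonormalBasis ι ℝ X) (hw : Continuous w) (φ : testSpace Ω)
    (j : Option ι) : formMap Ω e hw φ j = toL2 Ω (formComponents e w φ j) := rfl

variable (Ω) in
/-- The closure of the quadratic form domain. -/
def formSpace (e : OrthonormalBasis ι ℝ X) (hw : Continuous w) :
    Submodule ℂ (PiLp 2 fun _ : Option ι => Lp ℂ 2 ((volume : Measure X).restrict Ω)) :=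
  (formMap Ω e hw).range.topologicalClosure

instance (e : OrthonormalBasis ι ℝ X) (hw : Continuous w) : CompleteSpace (formSpace Ω e hw) :=
  (Submodule.isClosed_topologicalClosure _).completeSpace_coe

lemma exists_seq_of_mem_formSpace (e : OrthonormalBasis ι ℝ X) (hw : Continuous w)
    {v : PiLp 2 fun _ : Option ι => Lp ℂ 2 ((volume : Measure X).restrict Ω)}
    (hv : v ∈ formSpace Ω e hw) : ∃ φ : ℕ → X → ℂ, (∀ m, IsTestFunction Ω (φ m)) ∧
      ∀ j, Tendsto (fun m => toL2 Ω (formComponents e w (φ m) j)) atTop (𝓝 (v j)) := by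
  obtain ⟨x, hx, hlim⟩ := mem_closure_iff_seq_limit.mp hv
  choose φ hφ using hx
  refine ⟨fun m => φ m, fun m => (φ m).2, fun j => ?_⟩
  have := ((PiLp.continuous_apply 2 _ j).tendsto v).comp hlim
  refine this.congr fun m => ?_
  rw [Function.comp_apply, ← hφ]
  rfl

/-- Continuity in the components: membership of limits in the form space. -/
lemma mem_formSpace_of_tendsto (e : OrthonormalBasis ι ℝ X) (hw : Continuous w) {φ : ℕ → X → ℂ}
    (hφ : ∀ m, IsTestFunction Ω (φ m))
    {v : PiLp 2 fun _ : Option ι => Lp ℂ 2 ((volume : Measure X).restrict Ω)}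
    (h : ∀ j, Tendsto (fun m => toL2 Ω (formComponents e w (φ m) j)) atTop (𝓝 (v j))) :
    v ∈ formSpace Ω e hw := by
  refine mem_closure_of_tendsto (f := fun m => formMap Ω e hw ⟨φ m, hφ m⟩) (b := atTop) ?_
    (Eventually.of_forall fun m => ⟨_, rfl⟩)
  have : Tendsto (fun m j => toL2 Ω (formComponents e w (φ m) j)) atTop (𝓝 v.ofLp) :=
    tendsto_pi_nhds.mpr h
  exact ((PiLp.continuous_toLp 2 _).tendsto _).comp this

variable (hΩ : IsOpen Ω) (hw : Continuous w) (hw0 : ∀ x, 1 ≤ w x)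

include hw hw0 in
omit [FiniteDimensional ℝ X] [MeasureSpace X] [BorelSpace X]
  [(volume : Measure X).IsAddHaarMeasure] in
lemma continuous_inv_of_one_le : Continuous fun x => (w x)⁻¹ :=
  hw.inv₀ fun x => (zero_lt_one.trans_le (hw0 x)).ne'

include hw0 in
omit [NormedAddCommGroup X] [InnerProductSpace ℝ X] [FiniteDimensional ℝ X] [MeasureSpace X]
  [BorelSpace X] [(volume : Measure X).IsAddHaarMeasure] in
lemma abs_inv_le_one (x : X) : |(w x)⁻¹| ≤ 1 := by
  rw [abs_of_nonneg (inv_nonneg.mpr (zero_le_one.trans (hw0 x)))]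
  exact inv_le_one_of_one_le₀ (hw0 x)

include hw0 in
/-- Division by `w` in `L²(Ω)`. -/
def divL2 (hΩ : IsOpen Ω) (hw : Continuous w) :
    Lp ℂ 2 ((volume : Measure X).restrict Ω) →L[ℂ] Lp ℂ 2 ((volume : Measure X).restrict Ω) :=
  mulL2 hΩ.measurableSet (continuous_inv_of_one_le hw hw0) (C := 1)
    fun x _ => abs_inv_le_one hw0 x

lemma coeFn_divL2 (f : Lp ℂ 2 ((volume : Measure X).restrict Ω)) :
    divL2 hw0 hΩ hw f =ᵐ[(volume : Measure X).restrict Ω] fun x => ((w x : ℂ))⁻¹ * f x := by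
  filter_upwards [coeFn_mulL2 hΩ.measurableSet (continuous_inv_of_one_le hw hw0) (C := 1)
    (fun x _ => abs_inv_le_one hw0 x) f] with x hx
  rw [divL2, hx, Complex.ofReal_inv]

lemma divL2_toL2_mul {φ : X → ℂ} (hφ : IsTestFunction Ω φ) :
    divL2 hw0 hΩ hw (toL2 Ω fun x => (w x : ℂ) * φ x) = toL2 Ω φ := by
  rw [Lp.ext_iff]
  filter_upwards [coeFn_divL2 hΩ hw hw0 (toL2 Ω fun x => (w x : ℂ) * φ x),
    coeFn_toL2 (hφ.memLp_mul hw), coeFn_toL2 hφ.memLp] with x h1 h2 h3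
  have : (w x : ℂ) ≠ 0 := by exact_mod_cast (zero_lt_one.trans_le (hw0 x)).ne'
  rw [h1, h2, h3, inv_mul_cancel_left₀ this]

/-- The embedding of the form space into `L²(Ω)`. -/
def formEmbedding (e : OrthonormalBasis ι ℝ X) :
    formSpace Ω e hw →L[ℂ] Lp ℂ 2 ((volume : Measure X).restrict Ω) :=
  divL2 hw0 hΩ hw ∘L PiLp.proj 2 (fun _ : Option ι => Lp ℂ 2 ((volume : Measure X).restrict Ω)) none
    ∘L (formSpace Ω e hw).subtypeL

lemma formEmbedding_apply (e : OrthonormalBasis ι ℝ X) (v : formSpace Ω e hw) :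
    formEmbedding hΩ hw hw0 e v = divL2 hw0 hΩ hw (v.1 none) := rfl

/-- The operator associated with the form. -/
def formResolvent (e : OrthonormalBasis ι ℝ X) :
    Lp ℂ 2 ((volume : Measure X).restrict Ω) →L[ℂ] Lp ℂ 2 ((volume : Measure X).restrict Ω) :=
  formEmbedding hΩ hw hw0 e ∘L (formEmbedding hΩ hw hw0 e).adjoint

lemma isSelfAdjoint_formResolvent (e : OrthonormalBasis ι ℝ X) :
    IsSelfAdjoint (formResolvent hΩ hw hw0 e) := by
  rw [ContinuousLinearMap.isSelfAdjoint_iff', formResolvent, ContinuousLinearMap.adjoint_comp,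
    ContinuousLinearMap.adjoint_adjoint]

lemma sqrt_two_mul_inv : ((√2 : ℝ) : ℂ) * ((√2)⁻¹ : ℂ) = 1 := by
  rw [mul_inv_cancel₀]; exact_mod_cast (Real.sqrt_pos.mpr two_pos).ne'

include hw in
lemma tendsto_toL2_fderiv_of_formComponents (e : OrthonormalBasis ι ℝ X) {φs : ℕ → X → ℂ}
    (hφs : ∀ m, IsTestFunction Ω (φs m)) {i : ι} {v : Lp ℂ 2 ((volume : Measure X).restrict Ω)}
    (hlim : Tendsto (fun m => toL2 Ω (formComponents e w (φs m) (some i))) atTop (𝓝 v)) :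
    Tendsto (fun m => toL2 Ω fun x => fderiv ℝ (φs m) x (e i)) atTop (𝓝 ((√2 : ℂ) • v)) := by
  refine (hlim.const_smul (√2 : ℂ)).congr fun m => ?_
  rw [← toL2_smul _ ((hφs m).memLp_formComponents e hw _)]
  congr 1
  ext x
  simp only [formComponents, Pi.smul_apply, smul_eq_mul]
  rw [← mul_assoc, sqrt_two_mul_inv, one_mul]

/-- The form, evaluated on a test function. -/
lemma inner_formMap_star (e : OrthonormalBasis ι ℝ X) {φ : X → ℂ} (hφ : IsTestFunction Ω φ)
    {v : PiLp 2 fun _ : Option ι => Lp ℂ 2 ((volume : Measure X).restrict Ω)}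
    (hv : v ∈ formSpace Ω e hw) :
    inner ℂ (formMap Ω e hw ⟨fun x => star (φ x), hφ.star⟩) v =
      ∫ x in Ω, (-(1 / 2 : ℂ) * Laplacian.laplacian φ x + ((w x ^ 2 : ℝ) : ℂ) * φ x) *
        divL2 hw0 hΩ hw (v none) x := by
  obtain ⟨φs, hφs, hlim⟩ := exists_seq_of_mem_formSpace e hw hv
  set ψ := divL2 hw0 hΩ hw (v none) with hψ
  have h1 : Tendsto (fun m => toL2 Ω (φs m)) atTop (𝓝 ψ) := by
    refine (((divL2 hw0 hΩ hw).continuous.tendsto _).comp (hlim none)).congr fun m => ?_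
    exact divL2_toL2_mul hΩ hw hw0 (hφs m)
  have s2 := sqrt_two_mul_inv
  have s3 : ((√2)⁻¹ : ℂ) * ((√2)⁻¹ : ℂ) = 1 / 2 := by
    rw [← mul_inv, ← Complex.ofReal_mul, Real.mul_self_sqrt (by norm_num)]; simp
  have h2 : ∀ i, Tendsto (fun m => toL2 Ω fun x => fderiv ℝ (φs m) x (e i)) atTop
      (𝓝 ((√2 : ℂ) • v (some i))) := fun i =>
    tendsto_toL2_fderiv_of_formComponents hw e hφs (hlim (some i))
  have h3 : ∀ i, inner ℂ (toL2 Ω (formComponents e w (fun x => star (φ x)) (some i)))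
      (v (some i)) = ∫ x in Ω, -(1 / 2 : ℂ) *
        fderiv ℝ (fun y => fderiv ℝ φ y (e i)) x (e i) * ψ x := fun i => by
    have := integral_fderiv_mul_of_tendsto (hφ.fderiv_apply (e i)) hφs h1 (h2 i)
    have e1 : formComponents e w (fun x => star (φ x)) (some i) =
        fun x => star (((√2)⁻¹ : ℂ) * fderiv ℝ φ x (e i)) := by
      ext x
      simp only [formComponents]
      rw [hφ.fderiv_star, star_mul', Complex.star_def, map_inv₀,
        Complex.conj_ofReal]
    rw [e1, inner_toL2_conj ((hφ.fderiv_apply (e i)).memLp.const_mul _)]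
    calc _ = ∫ x in Ω, (1 / 2 : ℂ) * (fderiv ℝ φ x (e i) * ((√2 : ℂ) • v (some i)) x) := by
          refine integral_congr_ae ?_
          filter_upwards [Lp.coeFn_smul (√2 : ℂ) (v (some i))] with x hx
          rw [hx, Pi.smul_apply, smul_eq_mul]
          linear_combination (-(((√2)⁻¹ : ℂ) * fderiv ℝ φ x (e i) * v (some i) x)) * s2 +
            (√2 : ℂ) * fderiv ℝ φ x (e i) * v (some i) x * s3
      _ = _ := by
          rw [integral_const_mul, this, ← integral_neg, ← integral_const_mul]
          congr 1
          ext x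
          ring
  have h0 : inner ℂ (toL2 Ω (formComponents e w (fun x => star (φ x)) none)) (v none) =
      ∫ x in Ω, ((w x ^ 2 : ℝ) : ℂ) * φ x * ψ x := by
    have e1 : formComponents e w (fun x => star (φ x)) none =
        fun x => star ((w x : ℂ) * φ x) := by
      ext x
      simp [formComponents]
    rw [e1, inner_toL2_conj (hφ.memLp_mul hw)]
    refine integral_congr_ae ?_
    filter_upwards [coeFn_divL2 hΩ hw hw0 (v none)] with x hx
    have : (w x : ℂ) ≠ 0 := by exact_mod_cast (zero_lt_one.trans_le (hw0 x)).ne'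
    rw [hψ, hx]
    push_cast
    field_simp
  rw [PiLp.inner_apply, Fintype.sum_option]
  simp only [formMap_apply]
  rw [h0]
  simp only [h3]
  have hi : ∀ i, Integrable (fun x => -(1 / 2 : ℂ) *
      fderiv ℝ (fun y => fderiv ℝ φ y (e i)) x (e i) * ψ x)
      ((volume : Measure X).restrict Ω) := fun i =>
    MemLp.integrable_mul (p := 2) (q := 2)
      (((hφ.fderiv_apply (e i)).fderiv_apply (e i)).memLp.const_mul _) (Lp.memLp ψ)
  rw [← integral_finsetSum _ fun i _ => hi i, ← integral_add]
  · congr 1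
    ext x
    rw [laplacian_eq_sum_fderiv e hφ.contDiff_two, add_mul, Finset.mul_sum,
      Finset.sum_mul, add_comm]
  · refine MemLp.integrable_mul (p := 2) (q := 2) ?_ (Lp.memLp ψ)
    exact hφ.memLp_mul (hw.pow 2)
  · exact integrable_finsetSum _ fun i _ => hi i

/-- The defining property of the adjoint, since the embedding sends the form vector of a test
function back to that function. Together with `inner_formMap_star` it is the weak equation. -/
lemma inner_formMap_adjoint (e : OrthonormalBasis ι ℝ X) {φ : X → ℂ} (hφ : IsTestFunction Ω φ)
    (h : Lp ℂ 2 ((volume : Measure X).restrict Ω)) :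
    inner ℂ (formMap Ω e hw ⟨fun x => star (φ x), hφ.star⟩)
      ((formEmbedding hΩ hw hw0 e).adjoint h).1 = ∫ x in Ω, φ x * h x := by
  have hmem : formMap Ω e hw ⟨fun x => star (φ x), hφ.star⟩ ∈ formSpace Ω e hw :=
    subset_closure ⟨_, rfl⟩
  have := (formEmbedding hΩ hw hw0 e).adjoint_inner_right ⟨_, hmem⟩ h
  rw [Submodule.coe_inner] at this
  rw [this, ← inner_toL2_conj hφ.memLp, formEmbedding_apply]
  congr 1
  exact divL2_toL2_mul hΩ hw hw0 hφ.star

/-- The form vectors of test functions are dense in the form space, so the weak equation determines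
the vector. This is the Lax–Milgram uniqueness step. -/
lemma adjoint_eq_of_forall_inner (e : OrthonormalBasis ι ℝ X) (v : formSpace Ω e hw)
    (h : Lp ℂ 2 ((volume : Measure X).restrict Ω))
    (H : ∀ φ : X → ℂ, (hφ : IsTestFunction Ω φ) →
      inner ℂ (formMap Ω e hw ⟨fun x => star (φ x), hφ.star⟩) v.1 = ∫ x in Ω, φ x * h x) :
    (formEmbedding hΩ hw hw0 e).adjoint h = v := by
  refine ext_inner_left ℂ fun x => ?_
  rw [Submodule.coe_inner, Submodule.coe_inner]
  have hclosed : IsClosed {x : PiLp 2 fun _ : Option ι => Lp ℂ 2 ((volume : Measure X).restrict Ω) |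
      inner ℂ x ((formEmbedding hΩ hw hw0 e).adjoint h).1 = inner ℂ x v.1} :=
    isClosed_eq (by fun_prop) (by fun_prop)
  refine closure_minimal ?_ hclosed x.2
  rintro _ ⟨⟨φ, hφ⟩, rfl⟩
  have e1 := inner_formMap_adjoint hΩ hw hw0 e (IsTestFunction.star hφ) h
  have e2 := H _ (IsTestFunction.star hφ)
  simp only [star_star] at e1 e2
  exact e1.trans e2.symm

/-- If ιι*h = 0 then ι*h = 0, so `h` annihilates every test function and vanishes almost everywhere.
-/
lemma injective_formResolvent (e : OrthonormalBasis ι ℝ X) :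
    Function.Injective (formResolvent hΩ hw hw0 e) := by
  rw [injective_iff_map_eq_zero]
  intro h hh
  have h0 : (formEmbedding hΩ hw hw0 e).adjoint h = 0 := by
    rw [← inner_self_eq_zero (𝕜 := ℂ), ContinuousLinearMap.adjoint_inner_left]
    change inner ℂ h (formResolvent hΩ hw hw0 e h) = 0
    rw [hh, inner_zero_right]
  have h1 : ∀ᵐ x ∂(volume : Measure X), x ∈ Ω → h x = 0 := by
    refine hΩ.ae_eq_zero_of_integral_contDiff_smul_eq_zero
      (locallyIntegrableOn_of_locallyIntegrable_restrict ?_) fun g hg hgc hgs => ?_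
    · exact (Lp.memLp h).locallyIntegrable (by norm_num)
    · have ht : IsTestFunction Ω fun x => (g x : ℂ) :=
        ⟨Complex.ofRealCLM.contDiff.comp hg, hgc.comp_left (g := Complex.ofReal) rfl,
          (closure_mono fun x hx => by simpa using hx).trans hgs⟩
      have := inner_formMap_adjoint hΩ hw hw0 e ht h
      rw [h0] at this
      simp only [ZeroMemClass.coe_zero, inner_zero_right] at this
      rw [← setIntegral_eq_integral_of_forall_compl_eq_zero (s := Ω), this]
      · rfl
      · intro x hx
        rw [image_eq_zero_of_notMem_tsupport fun h => hx (hgs h), zero_smul]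
  rw [Lp.eq_zero_iff_ae_eq_zero]
  exact (ae_restrict_iff' hΩ.measurableSet).mpr h1

lemma weakForm_shift {V : X → ℝ} (hV : Continuous V) {c : ℝ} (hwV : ∀ x ∈ Ω, w x ^ 2 = V x + c)
    {φ : X → ℂ} (hφ : IsTestFunction Ω φ) (hΩ : IsOpen Ω)
    (ψ h : Lp ℂ 2 ((volume : Measure X).restrict Ω)) :
    (∫ x in Ω, (-(1 / 2 : ℂ) * Laplacian.laplacian φ x + ((w x ^ 2 : ℝ) : ℂ) * φ x) * ψ x =
      ∫ x in Ω, φ x * (h + (c : ℂ) • ψ : Lp ℂ 2 ((volume : Measure X).restrict Ω)) x) ↔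
    ∫ x in Ω, (-(1 / 2 : ℂ) * Laplacian.laplacian φ x + (V x : ℂ) * φ x) * ψ x =
      ∫ x in Ω, φ x * h x := by
  have i1 : Integrable (fun x => φ x * ψ x) ((volume : Measure X).restrict Ω) :=
    MemLp.integrable_mul (p := 2) (q := 2) hφ.memLp (Lp.memLp ψ)
  have i2 : Integrable (fun x => φ x * h x) ((volume : Measure X).restrict Ω) :=
    MemLp.integrable_mul (p := 2) (q := 2) hφ.memLp (Lp.memLp h)
  have i3 : Integrable (fun x => (-(1 / 2 : ℂ) * Laplacian.laplacian φ x + (V x : ℂ) * φ x) * ψ x)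
      ((volume : Measure X).restrict Ω) :=
    MemLp.integrable_mul (p := 2) (q := 2)
      ((hφ.laplacian.memLp.const_mul _).add (hφ.memLp_mul hV)) (Lp.memLp ψ)
  have e1 : ∫ x in Ω, (-(1 / 2 : ℂ) * Laplacian.laplacian φ x + ((w x ^ 2 : ℝ) : ℂ) * φ x) * ψ x =
      (∫ x in Ω, (-(1 / 2 : ℂ) * Laplacian.laplacian φ x + (V x : ℂ) * φ x) * ψ x) +
      c * ∫ x in Ω, φ x * ψ x := by
    rw [← integral_const_mul, ← integral_add i3 (i1.const_mul _)]
    refine setIntegral_congr_fun hΩ.measurableSet fun x hx => ?_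
    simp only [hwV x hx]
    push_cast
    ring
  have e2 : ∫ x in Ω, φ x * (h + (c : ℂ) • ψ : Lp ℂ 2 ((volume : Measure X).restrict Ω)) x =
      (∫ x in Ω, φ x * h x) + c * ∫ x in Ω, φ x * ψ x := by
    rw [← integral_const_mul, ← integral_add i2 (i1.const_mul _)]
    refine integral_congr_ae ?_
    filter_upwards [Lp.coeFn_add h ((c : ℂ) • ψ), Lp.coeFn_smul (c : ℂ) ψ] with x h1 h2
    rw [h1, Pi.add_apply, h2, Pi.smul_apply, smul_eq_mul]
    ring
  rw [e1, e2, add_left_inj]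

/-- Dirichlet Schrödinger operators with bounded continuous potential have a bounded injective
self-adjoint resolvent. -/
theorem exists_resolvent_dirichletSchrodinger (hΩ : IsOpen Ω) {V : X → ℝ} (hV : Continuous V)
    {M : ℝ} (hM : ∀ x ∈ Ω, |V x| ≤ M) :
    ∃ R : Lp ℂ 2 ((volume : Measure X).restrict Ω) →L[ℂ] Lp ℂ 2 ((volume : Measure X).restrict Ω),
      IsSelfAdjoint R ∧ Function.Injective R ∧
      dirichletSchrodinger Ω V = {p | R (p.2 + ((M + 1 : ℝ) : ℂ) • p.1) = p.1} := by
  -- The maximum has an effect only outside Ω; it makes w ≥ 1 everywhere, so that division by `w` is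
  -- bounded. On Ω the square is V + M + 1.
  set w : X → ℝ := fun x => √(max (V x + (M + 1)) 1) with hwdef
  have hw : Continuous w := by fun_prop
  have hw0 : ∀ x, 1 ≤ w x := fun x => Real.one_le_sqrt.mpr (le_max_right _ _)
  have hwV : ∀ x ∈ Ω, w x ^ 2 = V x + (M + 1) := fun x hx => by
    have : 1 ≤ V x + (M + 1) := by linarith [neg_le_of_abs_le (hM x hx)]
    rw [hwdef, Real.sq_sqrt (by positivity), max_eq_left this]
  have hwC : ∀ x ∈ Ω, |w x| ≤ √(2 * M + 1) := fun x hx => by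
    rw [abs_of_nonneg (Real.sqrt_nonneg _)]
    refine Real.le_sqrt_of_sq_le ?_
    rw [hwV x hx]
    linarith [le_of_abs_le (hM x hx)]
  let e := stdOrthonormalBasis ℝ X
  refine ⟨formResolvent hΩ hw hw0 e, isSelfAdjoint_formResolvent .., injective_formResolvent .., ?_⟩
  ext ⟨ψ, h⟩
  simp only [dirichletSchrodinger, mem_ofPred_eq]
  constructor
  · rintro ⟨hψ, hweak⟩
    obtain ⟨φs, hφs, h1, wi, h2⟩ := (memH10_iff e ψ).mp hψ
    -- The form vector of ψ, built from its weak derivatives; it is identified below with the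
    -- adjoint of the embedding applied to h + (M + 1)ψ.
    let v : PiLp 2 fun _ : Option (Fin (Module.finrank ℝ X)) =>
        Lp ℂ 2 ((volume : Measure X).restrict Ω) :=
      WithLp.toLp 2 fun | none => mulL2 hΩ.measurableSet hw hwC ψ | some i => ((√2)⁻¹ : ℂ) • wi i
    have hv : v ∈ formSpace Ω e hw := by
      refine mem_formSpace_of_tendsto e hw hφs fun j => ?_
      cases j with
      | none =>
        refine (((mulL2 hΩ.measurableSet hw hwC).continuous.tendsto _).comp h1).congr fun m => ?_
        rw [Function.comp_apply, mulL2_apply]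
        refine toL2_congr (memLp_mul_of_bounded hΩ.measurableSet hw hwC (Lp.memLp _)) ?_
        filter_upwards [coeFn_toL2 (hφs m).memLp] with x hx
        rw [hx, formComponents]
      | some i =>
        refine ((h2 i).const_smul ((√2)⁻¹ : ℂ)).congr fun m => ?_
        rw [← toL2_smul _ ((hφs m).fderiv_apply (e i)).memLp]
        rfl
    have hvψ : divL2 hw0 hΩ hw (v none) = ψ := by
      rw [Lp.ext_iff]
      filter_upwards [coeFn_divL2 hΩ hw hw0 (v none), coeFn_mulL2 hΩ.measurableSet hw hwC ψ]
        with x h1 h2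
      have : (w x : ℂ) ≠ 0 := by exact_mod_cast (zero_lt_one.trans_le (hw0 x)).ne'
      rw [h1]
      change _ * mulL2 hΩ.measurableSet hw hwC ψ x = _
      rw [h2, inv_mul_cancel_left₀ this]
    have := adjoint_eq_of_forall_inner hΩ hw hw0 e ⟨v, hv⟩ (h + ((M + 1 : ℝ) : ℂ) • ψ)
      fun φ hφ => by
        rw [inner_formMap_star hΩ hw hw0 e hφ hv, hvψ]
        exact (weakForm_shift hV hwV hφ hΩ ψ h).mpr (hweak φ hφ)
    rw [formResolvent, ContinuousLinearMap.comp_apply, this, formEmbedding_apply, hvψ]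
  · intro hR
    -- The embedding maps this vector to ψ, so test functions that approximate it in the form space
    -- show ψ ∈ H¹₀(Ω).
    set v := (formEmbedding hΩ hw hw0 e).adjoint (h + ((M + 1 : ℝ) : ℂ) • ψ) with hvdef
    have hvψ : divL2 hw0 hΩ hw (v.1 none) = ψ := by
      rw [← formEmbedding_apply, ← hR]; rfl
    obtain ⟨φs, hφs, hlim⟩ := exists_seq_of_mem_formSpace e hw v.2
    constructor
    · refine (memH10_iff e ψ).mpr ⟨φs, hφs, ?_, fun i => (√2 : ℂ) • v.1 (some i), fun i => ?_⟩
      · rw [← hvψ]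
        refine (((divL2 hw0 hΩ hw).continuous.tendsto _).comp (hlim none)).congr fun m => ?_
        exact divL2_toL2_mul hΩ hw hw0 (hφs m)
      · exact tendsto_toL2_fderiv_of_formComponents hw e hφs (hlim (some i))
    · intro φ hφ
      rw [← weakForm_shift hV hwV hφ hΩ ψ h, ← inner_formMap_adjoint hΩ hw hw0 e hφ,
        inner_formMap_star hΩ hw hw0 e hφ v.2, hvψ]

end FormSpace

/-! ### A smooth cutoff function -/

/-- A smooth function that is `1` on `[-1/2, 1/2]` and vanishes outside `(-3/4, 3/4)`. -/
def cutoff (z : ℝ) : ℝ := (⟨1 / 2, 3 / 4, by norm_num, by norm_num⟩ : ContDiffBump (0 : ℝ)) z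

lemma contDiff_cutoff : ContDiff ℝ ∞ cutoff := ContDiffBump.contDiff _

lemma hasCompactSupport_cutoff : HasCompactSupport cutoff := ContDiffBump.hasCompactSupport _

lemma cutoff_nonneg (z : ℝ) : 0 ≤ cutoff z := ContDiffBump.nonneg _

lemma cutoff_le_one (z : ℝ) : cutoff z ≤ 1 := ContDiffBump.le_one _

lemma cutoff_eq_one {z : ℝ} (hz : |z| ≤ 1 / 2) : cutoff z = 1 :=
  ContDiffBump.one_of_mem_closedBall _ (by simpa using hz)

lemma cutoff_eq_zero {z : ℝ} (hz : 3 / 4 ≤ |z|) : cutoff z = 0 :=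
  ContDiffBump.zero_of_le_dist _ (by simpa using hz)

lemma deriv_cutoff_eq_zero {z : ℝ} (hz : |z| < 1 / 2) : deriv cutoff z = 0 := by
  have h : cutoff =ᶠ[𝓝 z] fun _ => (1 : ℝ) := by
    filter_upwards [(isOpen_lt continuous_abs continuous_const).mem_nhds hz] with y hy
    exact cutoff_eq_one (le_of_lt hy)
  rw [h.deriv_eq, deriv_const]

lemma contDiff_deriv_cutoff : ContDiff ℝ ∞ (deriv cutoff) :=
  (contDiff_infty_iff_deriv.mp contDiff_cutoff).2

lemma deriv_deriv_cutoff_eq_zero {z : ℝ} (hz : |z| < 1 / 2) : deriv (deriv cutoff) z = 0 := by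
  have h : deriv cutoff =ᶠ[𝓝 z] fun _ => (0 : ℝ) := by
    filter_upwards [(isOpen_lt continuous_abs continuous_const).mem_nhds hz] with y hy
    exact deriv_cutoff_eq_zero hy
  rw [h.deriv_eq, deriv_const]

lemma hasDerivAt_cutoff (z : ℝ) : HasDerivAt cutoff (deriv cutoff z) z :=
  (contDiff_cutoff.differentiable (by simp) z).hasDerivAt

lemma hasDerivAt_deriv_cutoff (z : ℝ) : HasDerivAt (deriv cutoff) (deriv (deriv cutoff) z) z :=
  (contDiff_deriv_cutoff.differentiable (by simp) z).hasDerivAt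

lemma exists_bound_deriv_cutoff : ∃ C : ℝ, 1 ≤ C ∧ (∀ z, |deriv cutoff z| ≤ C) ∧
    ∀ z, |deriv (deriv cutoff) z| ≤ C := by
  obtain ⟨C₁, h₁⟩ := contDiff_deriv_cutoff.continuous.bounded_above_of_compact_support
    hasCompactSupport_cutoff.deriv
  obtain ⟨C₂, h₂⟩ := ((contDiff_infty_iff_deriv.mp contDiff_deriv_cutoff).2.continuous
    ).bounded_above_of_compact_support hasCompactSupport_cutoff.deriv.deriv
  exact ⟨max 1 (max C₁ C₂), le_max_left _ _,
    fun z => (h₁ z).trans ((le_max_left _ _).trans (le_max_right _ _)),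
    fun z => (h₂ z).trans ((le_max_right _ _).trans (le_max_right _ _))⟩

/-- The left side vanishes for |z| ≤ 1/2 and is at most 1 elsewhere. This lets the cutoff of the
oscillator mode be paid for by a factor |u|/r. -/
lemma abs_one_sub_cutoff_le (z : ℝ) : |1 - cutoff z| ≤ 2 * |z| := by
  rw [abs_of_nonneg (by linarith [cutoff_le_one z])]
  by_cases h : |z| ≤ 1 / 2
  · rw [cutoff_eq_one h]; simp
  · push Not at h; linarith [cutoff_nonneg z]

/-! ### Test functions form a core of Schrödinger operators on the line -/

section Graph

variable {X : Type*} [NormedAddCommGroup X] [InnerProductSpace ℝ X] [FiniteDimensional ℝ X]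
  [MeasureSpace X] [BorelSpace X] [(volume : Measure X).IsAddHaarMeasure] {Ω : Set X}

lemma IsTestFunction.integral_laplacian_mul {φ χ : X → ℂ} (hφ : IsTestFunction Ω φ)
    (hχ : IsTestFunction Ω χ) :
    ∫ x in Ω, Laplacian.laplacian φ x * χ x = ∫ x in Ω, φ x * Laplacian.laplacian χ x := by
  let e := stdOrthonormalBasis ℝ X
  simp_rw [laplacian_eq_sum_fderiv e hφ.contDiff_two, laplacian_eq_sum_fderiv e hχ.contDiff_two,
    Finset.sum_mul, Finset.mul_sum]
  have hint : ∀ {α β : X → ℂ}, IsTestFunction Ω α → IsTestFunction Ω β →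
      Integrable (fun x => α x * β x) ((volume : Measure X).restrict Ω) := fun ha hb =>
    MemLp.integrable_mul (p := 2) (q := 2) ha.memLp hb.memLp
  rw [integral_finsetSum _ fun i _ => hint ((hφ.fderiv_apply (e i)).fderiv_apply (e i)) hχ,
    integral_finsetSum _ fun i _ => hint hφ ((hχ.fderiv_apply (e i)).fderiv_apply (e i))]
  refine Finset.sum_congr rfl fun i _ => ?_
  rw [hφ.integral_fderiv_mul (hχ.fderiv_apply (e i)),
    (hφ.fderiv_apply (e i)).integral_fderiv_mul hχ, neg_neg]

lemma IsTestFunction.memLp_schrodinger {φ : X → ℂ} (hφ : IsTestFunction Ω φ) {V : X → ℝ}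
    (hV : Continuous V) :
    MemLp (fun x => -(1 / 2 : ℂ) * Laplacian.laplacian φ x + (V x : ℂ) * φ x) 2
      ((volume : Measure X).restrict Ω) :=
  (hφ.laplacian.memLp.const_mul _).add (hφ.memLp_mul hV)

/-- Test functions are in the domain of the Dirichlet Schrödinger operator. -/
theorem IsTestFunction.mem_dirichletSchrodinger {φ : X → ℂ} (hφ : IsTestFunction Ω φ) {V : X → ℝ}
    (hV : Continuous V) :
    (toL2 Ω φ, toL2 Ω fun x => -(1 / 2 : ℂ) * Laplacian.laplacian φ x + (V x : ℂ) * φ x) ∈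
      dirichletSchrodinger Ω V := by
  constructor
  · rw [memH10_iff (stdOrthonormalBasis ℝ X)]
    exact ⟨fun _ => φ, fun _ => hφ, tendsto_const_nhds, _, fun _ => tendsto_const_nhds⟩
  · intro χ hχ
    have hint : ∀ {α β : X → ℂ}, MemLp α 2 ((volume : Measure X).restrict Ω) →
        MemLp β 2 ((volume : Measure X).restrict Ω) →
        Integrable (fun x => α x * β x) ((volume : Measure X).restrict Ω) := fun ha hb =>
      MemLp.integrable_mul (p := 2) (q := 2) ha hb
    calc _ = ∫ x in Ω, (-(1 / 2 : ℂ) * (Laplacian.laplacian χ x * φ x) +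
          (V x * χ x) * φ x) := by
          refine integral_congr_ae ?_
          filter_upwards [coeFn_toL2 hφ.memLp] with x hx
          simp only [hx]
          ring
      _ = ∫ x in Ω, (-(1 / 2 : ℂ) * (χ x * Laplacian.laplacian φ x) + (V x * χ x) * φ x) := by
          rw [integral_add ((hint hχ.laplacian.memLp hφ.memLp).const_mul _)
            (hint (hχ.memLp_mul hV) hφ.memLp),
            integral_add ((hint hχ.memLp hφ.laplacian.memLp).const_mul _)
            (hint (hχ.memLp_mul hV) hφ.memLp), integral_const_mul, integral_const_mul,
            hχ.integral_laplacian_mul hφ]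
      _ = _ := by
          refine integral_congr_ae ?_
          filter_upwards [coeFn_toL2 (hφ.memLp_schrodinger hV)] with x hx
          simp only [hx]
          ring

/-- In terms of the bounded resolvent, the graph is the solution set of an equation between
continuous maps. -/
theorem isClosed_dirichletSchrodinger (hΩ : IsOpen Ω) {V : X → ℝ} (hV : Continuous V) {M : ℝ}
    (hM : ∀ x ∈ Ω, |V x| ≤ M) : IsClosed (dirichletSchrodinger Ω V) := by
  obtain ⟨R, -, -, h⟩ := exists_resolvent_dirichletSchrodinger hΩ hV hM
  rw [h]
  exact isClosed_eq (by fun_prop) (by fun_prop)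

theorem isUnitaryGroup_dirichletSchrodinger (hΩ : IsOpen Ω) {V : X → ℝ} (hV : Continuous V) {M : ℝ}
    (hM : ∀ x ∈ Ω, |V x| ≤ M) :
    IsUnitaryGroup (dirichletSchrodinger Ω V) (unitaryGroup (dirichletSchrodinger Ω V)) := by
  obtain ⟨R, hR, hinj, h⟩ := exists_resolvent_dirichletSchrodinger hΩ hV hM
  have hex : ∃ U, IsUnitaryGroup (dirichletSchrodinger Ω V) U :=
    ⟨_, h ▸ isUnitaryGroup_shiftedInverseGroup hR hinj (M + 1)⟩
  rw [unitaryGroup, dif_pos hex]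
  exact hex.choose_spec

/-- Removing a bounded potential. -/
lemma mem_dirichletSchrodinger_zero (hΩ : IsOpen Ω) {V : X → ℝ} (hV : Continuous V) {M : ℝ}
    (hM : ∀ x ∈ Ω, |V x| ≤ M) {p : Lp ℂ 2 ((volume : Measure X).restrict Ω) ×
      Lp ℂ 2 ((volume : Measure X).restrict Ω)} (hp : p ∈ dirichletSchrodinger Ω V) :
    (p.1, p.2 - mulL2 hΩ.measurableSet hV hM p.1) ∈ dirichletSchrodinger Ω fun _ => 0 := by
  refine ⟨hp.1, fun φ hφ => ?_⟩
  have hint : ∀ {α : X → ℂ}, MemLp α 2 ((volume : Measure X).restrict Ω) →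
      ∀ β : Lp ℂ 2 ((volume : Measure X).restrict Ω),
      Integrable (fun x => α x * β x) ((volume : Measure X).restrict Ω) := fun ha hb =>
    MemLp.integrable_mul (p := 2) (q := 2) ha (Lp.memLp hb)
  have e1 : ∫ x in Ω, (-(1 / 2 : ℂ) * Laplacian.laplacian φ x + (V x : ℂ) * φ x) * p.1 x =
      (∫ x in Ω, (-(1 / 2 : ℂ) * Laplacian.laplacian φ x + ((0 : ℝ) : ℂ) * φ x) * p.1 x) +
      ∫ x in Ω, ((V x : ℂ) * φ x) * p.1 x := by
    rw [← integral_add]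
    · congr 1; ext x; push_cast; ring
    · refine hint ?_ _
      simpa using hφ.laplacian.memLp.const_mul (-(1 / 2 : ℂ))
    · exact hint (hφ.memLp_mul hV) _
  have e2 : ∫ x in Ω, φ x * (p.2 - mulL2 hΩ.measurableSet hV hM p.1 :
        Lp ℂ 2 ((volume : Measure X).restrict Ω)) x =
      (∫ x in Ω, φ x * p.2 x) - ∫ x in Ω, ((V x : ℂ) * φ x) * p.1 x := by
    rw [← integral_sub (hint hφ.memLp _) (hint (hφ.memLp_mul hV) _)]
    refine integral_congr_ae ?_
    filter_upwards [Lp.coeFn_sub p.2 (mulL2 hΩ.measurableSet hV hM p.1),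
      coeFn_mulL2 hΩ.measurableSet hV hM p.1] with x h1 h2
    rw [h1, Pi.sub_apply, h2]
    ring
  rw [e2, ← hp.2 φ hφ, e1, add_sub_cancel_right]

end Graph

/-! ### Density of the range on test functions, and the core property on the line. -/

section Core

lemma laplacian_eq_deriv_deriv (φ : ℝ → ℂ) (x : ℝ) :
    Laplacian.laplacian φ x = deriv (deriv φ) x := by
  rw [InnerProductSpace.laplacian_eq_iteratedDeriv_real, iteratedDeriv_succ, iteratedDeriv_one]

open SchwartzMap in
/-- The equation `-½ φ'' + 2π² φ = σ` can be solved in the Schwartz space. -/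
lemma exists_schwartz_solution (σ : SchwartzMap ℝ ℂ) : ∃ φ : SchwartzMap ℝ ℂ, ∀ x,
    -(1 / 2 : ℂ) * deriv (deriv φ) x + (2 * Real.pi ^ 2 : ℝ) * φ x = σ x := by
  -- In this normalization of the Fourier transform -½ d²/dx² has symbol 2π²ξ², so with the constant
  -- 2π² the operator has symbol 2π²(1 + ξ²), and its inverse preserves the Schwartz space.
  have h1 : (fun ξ : ℝ => ((1 + ‖ξ‖ ^ 2) ^ (-1 : ℝ) : ℝ)).HasTemperateGrowth :=
    Function.hasTemperateGrowth_one_add_norm_sq_rpow ℝ (-1)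
  have h2 : (fun ξ : ℝ => (1 + ‖ξ‖ ^ 2 : ℝ)).HasTemperateGrowth := by fun_prop
  set ψ := fourierMultiplierCLM ℂ (fun ξ : ℝ => ((1 + ‖ξ‖ ^ 2) ^ (-1 : ℝ) : ℝ)) σ with hψ
  have h3 : fourierMultiplierCLM ℂ (fun ξ : ℝ => (1 + ‖ξ‖ ^ 2 : ℝ)) ψ = σ := by
    rw [hψ, fourierMultiplierCLM_fourierMultiplierCLM_apply h2 h1]
    have : ((fun ξ : ℝ => (1 + ‖ξ‖ ^ 2 : ℝ)) * fun ξ : ℝ => ((1 + ‖ξ‖ ^ 2) ^ (-1 : ℝ) : ℝ)) =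
        fun _ => 1 := by
      ext ξ
      rw [Pi.mul_apply, Real.rpow_neg_one, mul_inv_cancel₀ (by positivity)]
    rw [this, fourierMultiplierCLM_const]
    simp
  have h4 : ψ + fourierMultiplierCLM ℂ (‖·‖ ^ 2 : ℝ → ℝ) ψ = σ := by
    have h5 := fourierMultiplierCLM_sum (E := ℝ) ℂ (s := (Finset.univ : Finset Bool))
      (g := fun b ξ => if b then (1 : ℝ) else ‖ξ‖ ^ 2) (fun b _ => by
        cases b
        · simp only [Bool.false_eq_true, ↓reduceIte]; fun_prop
        · simp only [↓reduceIte]; fun_prop)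
    simp only [Fintype.univ_bool, Finset.mem_singleton, Bool.true_eq_false, not_false_eq_true,
      Finset.sum_insert, ↓reduceIte, Finset.sum_singleton, Bool.false_eq_true,
      fourierMultiplierCLM_const] at h5
    rw [h5] at h3
    simpa using! h3
  refine ⟨((2 * Real.pi ^ 2)⁻¹ : ℝ) • ψ, fun x => ?_⟩
  have h6 := DFunLike.congr_fun (laplacian_eq_fourierMultiplierCLM ψ) x
  rw [SchwartzMap.laplacian_apply, laplacian_eq_deriv_deriv] at h6
  have h7 := DFunLike.congr_fun h4 x
  have hs : ⇑(((2 * Real.pi ^ 2)⁻¹ : ℝ) • ψ) = ((2 * Real.pi ^ 2)⁻¹ : ℝ) • ⇑ψ := rfl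
  have hψ2 : deriv (deriv (((2 * Real.pi ^ 2)⁻¹ : ℝ) • ⇑ψ)) x =
      ((2 * Real.pi ^ 2)⁻¹ : ℝ) • deriv (deriv ψ) x := by
    have e1 : deriv (((2 * Real.pi ^ 2)⁻¹ : ℝ) • ⇑ψ) = ((2 * Real.pi ^ 2)⁻¹ : ℝ) • deriv ψ :=
      funext fun y => deriv_const_smul _ ψ.differentiableAt
    rw [e1]
    exact deriv_const_smul _ (SchwartzMap.derivCLM ℝ ℂ ψ).differentiableAt
  rw [hs, hψ2, h6]
  simp only [add_apply, smul_apply, Pi.smul_apply] at h7 ⊢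
  rw [← h7]
  have hpi : (Real.pi : ℂ) ≠ 0 := by exact_mod_cast Real.pi_ne_zero
  simp only [Complex.real_smul]
  push_cast
  field_simp
  ring

/-- The restriction of a Schwartz function to a large interval. -/
lemma exists_testFunction_schrodinger_near (σ : SchwartzMap ℝ ℂ) {η : ℝ} (hη : 0 < η) :
    ∃ φ : ℝ → ℂ, IsTestFunction univ φ ∧
      eLpNorm (fun x => -(1 / 2 : ℂ) * deriv (deriv φ) x + (2 * Real.pi ^ 2 : ℝ) * φ x - σ x) 2
        volume ≤ ENNReal.ofReal η := by
  obtain ⟨φ, hφ⟩ := exists_schwartz_solution σ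
  obtain ⟨C, hC1, hC, hC'⟩ := exists_bound_deriv_cutoff
  have d1 : ∀ x, HasDerivAt φ (deriv φ x) x := fun x => φ.differentiableAt.hasDerivAt
  have d2 : ∀ x, HasDerivAt (deriv φ) (deriv (deriv φ) x) x := fun x =>
    ((SchwartzMap.derivCLM ℝ ℂ φ).differentiableAt (x := x)).hasDerivAt
  -- A square-integrable majorant for r times the error of cutting off at scale `r`: the factor x in
  -- xσ pays for the removal of the tail of σ, and the other terms for the commutator with the
  -- second derivative.
  set G : ℝ → ℝ := fun x => ‖(x : ℂ) * σ x‖ + (‖deriv φ x‖ + ‖φ x‖)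
  have hG : MemLp G 2 volume := by
    refine MemLp.add ?_ (MemLp.add ?_ ?_)
    · have := (SchwartzMap.smulLeftCLM ℂ (fun x : ℝ => x) σ).memLp 2
      refine (this.norm).congr_norm ?_ (ae_of_all _ fun x => ?_)
      · exact (Complex.continuous_ofReal.mul σ.continuous).norm.aestronglyMeasurable
      · rw [SchwartzMap.smulLeftCLM_apply_apply (by fun_prop)]
        simp
    · exact ((SchwartzMap.derivCLM ℝ ℂ φ).memLp 2).norm
    · exact (φ.memLp 2).norm
  have key : ∀ r : ℝ, 1 ≤ r → ∃ χ : ℝ → ℂ, IsTestFunction univ χ ∧ ∀ x,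
      ‖-(1 / 2 : ℂ) * deriv (deriv χ) x + (2 * Real.pi ^ 2 : ℝ) * χ x - σ x‖ ≤
        (2 * C / r) * G x := by
    intro r hr
    have c1 : ∀ x, HasDerivAt (fun x : ℝ => ((cutoff (x / r) : ℝ) : ℂ))
        ((deriv cutoff (x / r) / r : ℝ) : ℂ) x := fun x => by
      have := ((hasDerivAt_cutoff (x / r)).comp x ((hasDerivAt_id x).div_const r)).ofReal_comp
      simpa [div_eq_mul_inv] using! this
    have c2 : ∀ x, HasDerivAt (fun x : ℝ => ((deriv cutoff (x / r) / r : ℝ) : ℂ))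
        ((deriv (deriv cutoff) (x / r) / r / r : ℝ) : ℂ) x := fun x => by
      have := (((hasDerivAt_deriv_cutoff (x / r)).comp x
        ((hasDerivAt_id x).div_const r)).div_const r).ofReal_comp
      simpa [div_eq_mul_inv] using! this
    set χ : ℝ → ℂ := fun x => ((cutoff (x / r) : ℝ) : ℂ) * φ x with hχ
    have e1 : deriv χ = fun x => ((deriv cutoff (x / r) / r : ℝ) : ℂ) * φ x +
        ((cutoff (x / r) : ℝ) : ℂ) * deriv φ x := funext fun x => ((c1 x).mul (d1 x)).deriv
    have e2 : ∀ x, deriv (deriv χ) x = ((deriv (deriv cutoff) (x / r) / r / r : ℝ) : ℂ) * φ x +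
        ((deriv cutoff (x / r) / r : ℝ) : ℂ) * deriv φ x +
        (((deriv cutoff (x / r) / r : ℝ) : ℂ) * deriv φ x +
        ((cutoff (x / r) : ℝ) : ℂ) * deriv (deriv φ) x) := fun x => by
      rw [e1]; exact (((c2 x).mul (d1 x)).add ((c1 x).mul (d2 x))).deriv
    refine ⟨χ, ⟨?_, ?_, subset_univ _⟩, fun x => ?_⟩
    · exact (Complex.ofRealCLM.contDiff.comp (contDiff_cutoff.comp (contDiff_id.div_const r))).mul
        (φ.smooth ⊤)
    · refine HasCompactSupport.mul_right ?_
      refine HasCompactSupport.of_support_subset_isCompact (isCompact_Icc (a := -r) (b := r)) ?_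
      intro x hx
      rw [mem_Icc, ← abs_le]
      by_contra hlt
      push Not at hlt
      refine hx ?_
      simp only
      rw [cutoff_eq_zero, Complex.ofReal_zero]
      rw [abs_div, abs_of_pos (by linarith : 0 < r), le_div_iff₀ (by linarith)]
      linarith
    · have hr0 : 0 < r := by linarith
      have e3 : -(1 / 2 : ℂ) * deriv (deriv χ) x + (2 * Real.pi ^ 2 : ℝ) * χ x - σ x =
          ((-(1 - cutoff (x / r)) : ℝ) : ℂ) * σ x +
          (((-(deriv cutoff (x / r) / r) : ℝ) : ℂ) * deriv φ x +
          ((-(1 / 2) * (deriv (deriv cutoff) (x / r) / r / r) : ℝ) : ℂ) * φ x) := by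
        rw [e2, hχ, ← hφ x]
        push_cast
        ring
      rw [e3]
      have b1 : ‖((-(1 - cutoff (x / r)) : ℝ) : ℂ) * σ x‖ ≤ (2 * C / r) * ‖(x : ℂ) * σ x‖ := by
        rw [norm_mul, norm_mul, Complex.norm_real, Complex.norm_real, norm_neg, ← mul_assoc]
        gcongr
        refine (abs_one_sub_cutoff_le _).trans ?_
        rw [abs_div, abs_of_pos hr0, Real.norm_eq_abs, ← mul_div_assoc, div_mul_eq_mul_div]
        gcongr
        linarith
      have b2 : ‖((-(deriv cutoff (x / r) / r) : ℝ) : ℂ) * deriv φ x‖ ≤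
          (2 * C / r) * ‖deriv φ x‖ := by
        rw [norm_mul, Complex.norm_real, norm_neg, Real.norm_eq_abs, abs_div, abs_of_pos hr0]
        gcongr
        linarith [hC (x / r)]
      have b3 : ‖((-(1 / 2) * (deriv (deriv cutoff) (x / r) / r / r) : ℝ) : ℂ) * φ x‖ ≤
          (2 * C / r) * ‖φ x‖ := by
        rw [norm_mul, Complex.norm_real, Real.norm_eq_abs, abs_mul, abs_div, abs_div,
          abs_of_pos hr0]
        gcongr
        have : |deriv (deriv cutoff) (x / r)| / r / r ≤ C / r := by
          gcongr
          exact (div_le_self (abs_nonneg _) hr).trans (hC' _)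
        rw [abs_neg, abs_of_pos (by norm_num : (0 : ℝ) < 1 / 2), mul_div_assoc]
        have : 0 ≤ C / r := by positivity
        linarith
      calc _ ≤ _ := (norm_add_le _ _).trans (add_le_add_right (norm_add_le _ _) _)
        _ ≤ _ := add_le_add b1 (add_le_add b2 b3)
        _ = _ := by simp only [G]; ring
  set N := (eLpNorm G 2 volume).toReal
  have hN : eLpNorm G 2 volume = ENNReal.ofReal N := (ENNReal.ofReal_toReal hG.2.ne).symm
  have hN0 : 0 ≤ N := ENNReal.toReal_nonneg
  obtain ⟨χ, hχ, hb⟩ := key (max 1 (2 * C * N / η)) (le_max_left _ _)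
  refine ⟨χ, hχ, ?_⟩
  refine (eLpNorm_le_mul_eLpNorm_of_ae_le_mul (g := G) (c := 2 * C / max 1 (2 * C * N / η))
    (ae_of_all _ fun x => ?_) 2).trans ?_
  · refine (hb x).trans ?_
    gcongr
    exact le_abs_self _
  · rw [hN, ← ENNReal.ofReal_mul (by positivity)]
    refine ENNReal.ofReal_le_ofReal ?_
    rw [div_mul_eq_mul_div, div_le_iff₀ (by positivity)]
    calc _ = η * (2 * C * N / η) := by field_simp
      _ ≤ _ := by gcongr; exact le_max_right _ _

/-- The range of `-½ d²/dx² + 2π²` on test functions is dense. -/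
lemma exists_testFunction_resolvent_near {γ : ℝ → ℂ}
    (hγ : MemLp γ 2 ((volume : Measure ℝ).restrict univ)) {η : ℝ} (hη : 0 < η) :
    ∃ φ : ℝ → ℂ, IsTestFunction univ φ ∧
      eLpNorm (fun x => -(1 / 2 : ℂ) * deriv (deriv φ) x + (2 * Real.pi ^ 2 : ℝ) * φ x - γ x) 2
        ((volume : Measure ℝ).restrict univ) ≤ ENNReal.ofReal η := by
  rw [Measure.restrict_univ] at hγ ⊢
  have hη2 : 0 < η / 2 := by positivity
  obtain ⟨g, hgc, hgs, hg⟩ := hγ.exist_eLpNorm_sub_le (by norm_num) (by norm_num) hη2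
  let σ : SchwartzMap ℝ ℂ := hgc.toSchwartzMap hgs
  obtain ⟨φ, hφ, hb⟩ := exists_testFunction_schrodinger_near σ hη2
  refine ⟨φ, hφ, ?_⟩
  have hφ2 : MemLp (fun x => -(1 / 2 : ℂ) * deriv (deriv φ) x +
        (2 * Real.pi ^ 2 : ℝ) * φ x - σ x) 2 (volume : Measure ℝ) := by
    have := hφ.memLp_schrodinger (V := fun _ => 2 * Real.pi ^ 2) continuous_const
    rw [Measure.restrict_univ] at this
    simp only [laplacian_eq_deriv_deriv] at this
    exact this.sub (σ.memLp 2)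
  have e : (fun x => -(1 / 2 : ℂ) * deriv (deriv φ) x + (2 * Real.pi ^ 2 : ℝ) * φ x - γ x) =
      (fun x => -(1 / 2 : ℂ) * deriv (deriv φ) x +
        (2 * Real.pi ^ 2 : ℝ) * φ x - σ x) + fun x => σ x - γ x := by
    ext x
    simp
  rw [e]
  refine (eLpNorm_add_le hφ2.aestronglyMeasurable
    ((σ.memLp 2).sub hγ).aestronglyMeasurable (by norm_num)).trans ?_
  rw [← add_halves η, ENNReal.ofReal_add hη2.le hη2.le]
  refine add_le_add hb ?_
  rw [eLpNorm_sub_comm] at hg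
  exact hg

/-- Test functions are a core of Schrödinger operators with bounded potential on the line. -/
theorem exists_testFunction_core {V : ℝ → ℝ} (hV : Continuous V) {M : ℝ} (hM : ∀ x, |V x| ≤ M)
    {p : Lp ℂ 2 ((volume : Measure ℝ).restrict univ) × Lp ℂ 2 ((volume : Measure ℝ).restrict univ)}
    (hp : p ∈ dirichletSchrodinger univ V) :
    ∃ φ : ℕ → ℝ → ℂ, (∀ m, IsTestFunction univ (φ m)) ∧
      Tendsto (fun m => toL2 univ (φ m)) atTop (𝓝 p.1) ∧
      Tendsto (fun m => toL2 univ fun x => -(1 / 2 : ℂ) * Laplacian.laplacian (φ m) x +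
        (V x : ℂ) * φ m x) atTop (𝓝 p.2) := by
  have hMu : ∀ x ∈ (univ : Set ℝ), |V x| ≤ M := fun x _ => hM x
  set Vm := mulL2 (MeasurableSet.univ) hV hMu with hVm
  have hp0 := mem_dirichletSchrodinger_zero isOpen_univ hV hMu hp
  have hpi : 1 ≤ 2 * Real.pi ^ 2 := by nlinarith [Real.pi_gt_three]
  -- The bound 2π² - 1 on the zero potential is chosen so that the resolvent shift M + 1 is 2π².
  obtain ⟨R, -, -, hR⟩ := exists_resolvent_dirichletSchrodinger (isOpen_univ (X := ℝ))
    (V := fun _ => 0) continuous_const (M := 2 * Real.pi ^ 2 - 1) (fun x _ => by simpa using hpi)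
  rw [sub_add_cancel] at hR
  set c : ℂ := ((2 * Real.pi ^ 2 : ℝ) : ℂ) with hc
  rw [hR, mem_ofPred_eq] at hp0
  simp only at hp0
  set g := p.2 - mulL2 isOpen_univ.measurableSet hV hMu p.1 + c • p.1 with hg
  have happ : ∀ m : ℕ, ∃ φ : ℝ → ℂ, IsTestFunction univ φ ∧
      ‖toL2 univ (fun x => -(1 / 2 : ℂ) * Laplacian.laplacian φ x + ((0 : ℝ) : ℂ) * φ x) +
        c • toL2 univ φ - g‖ ≤ 1 / ((m : ℝ) + 1) := by
    intro m
    have hη : 0 < 1 / ((m : ℝ) + 1) := by positivity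
    obtain ⟨φ, hφ, hb⟩ := exists_testFunction_resolvent_near (Lp.memLp g) hη
    refine ⟨φ, hφ, ?_⟩
    have hl : MemLp (fun x => -(1 / 2 : ℂ) * Laplacian.laplacian φ x + ((0 : ℝ) : ℂ) * φ x) 2
        ((volume : Measure ℝ).restrict univ) := hφ.memLp_schrodinger (V := fun _ => 0) continuous_const
    conv_lhs => rw [← toL2_coeFn g]
    rw [← toL2_smul c hφ.memLp, ← toL2_add hl (hφ.memLp.const_smul c), toL2_of_memLp
      (hl.add (hφ.memLp.const_smul c)), toL2_of_memLp (Lp.memLp g), ← MemLp.toLp_sub,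
      Lp.norm_toLp]
    refine ENNReal.toReal_le_of_le_ofReal (by positivity) ?_
    convert! hb using 2
    ext x
    simp only [Pi.sub_apply, Pi.add_apply, Pi.smul_apply, laplacian_eq_deriv_deriv, hc,
      smul_eq_mul]
    push_cast
    ring
  choose φ hφ hb using happ
  have t1 : Tendsto (fun m => toL2 univ (fun x => -(1 / 2 : ℂ) * Laplacian.laplacian (φ m) x +
      ((0 : ℝ) : ℂ) * φ m x) + c • toL2 univ (φ m)) atTop (𝓝 g) := by
    rw [tendsto_iff_norm_sub_tendsto_zero]
    exact squeeze_zero (fun _ => norm_nonneg _) hb tendsto_one_div_add_atTop_nhds_zero_nat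
  -- Boundedness of the resolvent turns convergence of the images under -½Δ + 2π² into convergence
  -- of the functions themselves.
  have t2 : Tendsto (fun m => toL2 univ (φ m)) atTop (𝓝 p.1) := by
    have := (R.continuous.tendsto g).comp t1
    rw [hp0] at this
    refine this.congr fun m => ?_
    have hm := (hφ m).mem_dirichletSchrodinger (V := fun _ => 0) continuous_const
    rw [hR] at hm
    exact hm
  refine ⟨φ, hφ, t2, ?_⟩
  have t3 := (t1.sub (t2.const_smul c)).add ((Vm.continuous.tendsto _).comp t2)
  have e3 : g - c • p.1 + Vm p.1 = p.2 := by rw [hg, hVm]; abel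
  rw [e3] at t3
  refine t3.congr fun m => ?_
  have hl : MemLp (fun x => -(1 / 2 : ℂ) * Laplacian.laplacian (φ m) x + ((0 : ℝ) : ℂ) * φ m x) 2
      ((volume : Measure ℝ).restrict univ) :=
    (hφ m).memLp_schrodinger (V := fun _ => 0) continuous_const
  rw [add_sub_cancel_right, Function.comp_apply, hVm, mulL2_apply]
  have e4 : toL2 univ (fun x => (V x : ℂ) * toL2 univ (φ m) x) =
      toL2 univ (fun x => (V x : ℂ) * φ m x) := by
    refine toL2_congr (memLp_mul_of_bounded MeasurableSet.univ hV hMu (Lp.memLp _)) ?_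
    filter_upwards [coeFn_toL2 (hφ m).memLp] with x hx
    rw [hx]
  rw [e4, ← toL2_add hl ((hφ m).memLp_mul hV)]
  congr 1
  ext x
  simp

end Core

/-! ### Comparison of unitary groups -/

section Comparison

variable {E : Type*} [NormedAddCommGroup E] [InnerProductSpace ℂ E] {A : Set (E × E)}
  {U : ℝ → (E ≃ₗᵢ[ℂ] E)}

namespace IsUnitaryGroup

lemma apply_add (hU : IsUnitaryGroup A U) (s t : ℝ) (ψ : E) : U (s + t) ψ = U s (U t ψ) := by
  rw [hU.map_add]; rfl

lemma apply_zero (hU : IsUnitaryGroup A U) (ψ : E) : U 0 ψ = ψ := by rw [hU.map_zero]; rfl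

lemma apply_neg_apply (hU : IsUnitaryGroup A U) (t : ℝ) (ψ : E) : U t (U (-t) ψ) = ψ := by
  rw [← hU.apply_add, add_neg_cancel, hU.apply_zero]

lemma hasDerivAt (hU : IsUnitaryGroup A U) {ψ h : E} (hp : (ψ, h) ∈ A) (t : ℝ) :
    HasDerivAt (fun s => U s ψ) (U t (-(Complex.I • h))) t := by
  have h0 := (hU.generator ψ h).mpr hp
  have h1 : HasDerivAt (fun s => U (s - t) ψ) (-(Complex.I • h)) t := by
    rw [← sub_self t] at h0
    exact h0.comp_sub_const t t
  have h2 := (((U t).toContinuousLinearEquiv : E →L[ℂ] E).restrictScalars ℝ).hasFDerivAt.comp_hasDerivAt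
    t h1
  refine h2.congr_of_eventuallyEq (Eventually.of_forall fun s => ?_)
  change U s ψ = U t (U (s - t) ψ)
  rw [← hU.apply_add, add_sub_cancel]

lemma apply_mem (hU : IsUnitaryGroup A U) {ψ h : E} (hp : (ψ, h) ∈ A) (t : ℝ) :
    (U t ψ, U t h) ∈ A := by
  rw [← hU.generator]
  have h2 := (((U t).toContinuousLinearEquiv : E →L[ℂ] E).restrictScalars ℝ).hasFDerivAt.comp_hasDerivAt
    0 ((hU.generator ψ h).mpr hp)
  have e : -(Complex.I • U t h) = U t (-(Complex.I • h)) := by rw [map_neg, map_smul]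
  rw [e]
  refine h2.congr_of_eventuallyEq (Eventually.of_forall fun s => ?_)
  change U s (U t ψ) = U t (U s ψ)
  rw [← hU.apply_add, ← hU.apply_add, add_comm]

lemma smul_mem (hU : IsUnitaryGroup A U) {ψ h : E} (hp : (ψ, h) ∈ A) (c : ℂ) :
    (c • ψ, c • h) ∈ A := by
  rw [← hU.generator]
  have := ((hU.generator ψ h).mpr hp).const_smul c
  have e : -(Complex.I • c • h) = c • -(Complex.I • h) := by module
  rw [e]
  refine this.congr_of_eventuallyEq (Eventually.of_forall fun s => ?_)
  simp

/-- A product rule for a group that is only strongly continuous, at a time when `y t` lies in the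
domain. The increment splits into the motion of the fixed vector `y t`, the Taylor remainder of `y`
carried along isometrically, and (s - t)(U(-s) - U(-t))y', which is small by strong continuity. -/
lemma hasDerivAt_neg_apply (hU : IsUnitaryGroup A U) {y : ℝ → E} {y' h : E} {t : ℝ}
    (hy : HasDerivAt y y' t) (hp : (y t, h) ∈ A) :
    HasDerivAt (fun s => U (-s) (y s)) (U (-t) (Complex.I • h + y')) t := by
  have h1 : HasDerivAt (fun s => U (-s) (y t)) (U (-t) (Complex.I • h)) t := by
    have := (hU.hasDerivAt hp (-t)).scomp t (hasDerivAt_neg t)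
    simpa using! this
  rw [hasDerivAt_iff_isLittleO] at h1 hy ⊢
  have h2 : (fun s => U (-s) (y s - y t - (s - t) • y')) =o[𝓝 t] fun s => s - t := by
    rw [Asymptotics.isLittleO_iff] at hy ⊢
    intro c hc
    filter_upwards [hy hc] with s hs
    rwa [LinearIsometryEquiv.norm_map]
  have h3 : (fun s => (s - t) • (U (-s) y' - U (-t) y')) =o[𝓝 t] fun s => s - t := by
    have hc : Tendsto (fun s => U (-s) y' - U (-t) y') (𝓝 t) (𝓝 0) := by
      have := (((hU.continuous y').comp continuous_neg).tendsto t).sub_const (U (-t) y')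
      simpa using this
    have := (Asymptotics.isBigO_refl (fun s : ℝ => s - t) (𝓝 t)).smul_isLittleO
      ((Asymptotics.isLittleO_one_iff ℝ).mpr hc)
    simpa using this
  refine ((h1.add h2).add h3).congr_left fun s => ?_
  have hr : ∀ (a b : ℝ) (z : E), U a (b • z) = b • U a z := fun a b z => by
    rw [← Complex.coe_smul, map_smul, Complex.coe_smul]
  simp only [(U (-t)).map_add (Complex.I • h) y', map_sub, hr, smul_sub, smul_add]
  abel

end IsUnitaryGroup

variable {F : Type*} [NormedAddCommGroup F] [InnerProductSpace ℂ F] {B : Set (F × F)}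
  {W : ℝ → (F ≃ₗᵢ[ℂ] F)}

/-- If `J` intertwines the generators of two unitary groups up to an error that is small relative
to the graph norm, then it approximately intertwines the groups. -/
theorem norm_unitaryGroup_sub_le (hW : IsUnitaryGroup B W) (hU : IsUnitaryGroup A U)
    (J : E →L[ℂ] F) {l η : ℝ}
    (hJ : ∀ g h : E, (g, h) ∈ A → ∃ r : F, (J g, J h + (l : ℂ) • J g + r) ∈ B ∧
      ‖r‖ ≤ η * (‖g‖ + ‖h‖))
    {f h : E} (hf : (f, h) ∈ A) {t : ℝ} (ht : 0 ≤ t) :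
    ‖W t (J f) - Complex.exp (-(Complex.I * t * l)) • J (U t f)‖ ≤ η * (‖f‖ + ‖h‖) * t := by
  set y : ℝ → F := fun s => Complex.exp (-(Complex.I * s * l)) • J (U s f) with hy
  have hexp : ∀ s : ℝ, HasDerivAt (fun s : ℝ => Complex.exp (-(Complex.I * s * l)))
      (-(Complex.I * l) * Complex.exp (-(Complex.I * s * l))) s := fun s => by
    have := (((Complex.ofRealCLM.hasDerivAt (x := s)).const_mul Complex.I).mul_const (l : ℂ)).neg.cexp
    simpa [mul_comm] using! this
  have hexp1 : ∀ s : ℝ, ‖Complex.exp (-(Complex.I * s * l))‖ = 1 := fun s => by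
    have : -(Complex.I * s * l) = ((-(s * l) : ℝ) : ℂ) * Complex.I := by push_cast; ring
    rw [this, Complex.norm_exp_ofReal_mul_I]
  have hy' : ∀ s : ℝ, HasDerivAt y (Complex.exp (-(Complex.I * s * l)) • J (U s (-(Complex.I • h))) +
      (-(Complex.I * l) * Complex.exp (-(Complex.I * s * l))) • J (U s f)) s := fun s =>
    (hexp s).smul ((J.restrictScalars ℝ).hasFDerivAt.comp_hasDerivAt s (hU.hasDerivAt hf s))
  have hw : ∀ s : ℝ, ∃ d : F, HasDerivAt (fun s => W (-s) (y s)) d s ∧ ‖d‖ ≤ η * (‖f‖ + ‖h‖) := by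
    intro s
    -- The pair `(U s f, U s h)` is again in the graph of `A` with the same norms, so the residual
    -- bound is uniform in `s`.
    obtain ⟨r, hr, hrn⟩ := hJ _ _ (hU.apply_mem hf s)
    refine ⟨_, hW.hasDerivAt_neg_apply (hy' s)
      (hW.smul_mem hr (Complex.exp (-(Complex.I * s * l)))), ?_⟩
    rw [LinearIsometryEquiv.norm_map]
    have e : Complex.I • Complex.exp (-(Complex.I * s * l)) •
        (J (U s h) + (l : ℂ) • J (U s f) + r) +
        (Complex.exp (-(Complex.I * s * l)) • J (U s (-(Complex.I • h))) +
        (-(Complex.I * l) * Complex.exp (-(Complex.I * s * l))) • J (U s f)) =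
        (Complex.I * Complex.exp (-(Complex.I * s * l))) • r := by
      simp only [map_neg, map_smul]
      module
    rw [e, norm_smul, norm_mul, hexp1, Complex.norm_I, one_mul, one_mul]
    rwa [LinearIsometryEquiv.norm_map, LinearIsometryEquiv.norm_map] at hrn
  choose d hd hdn using hw
  have key := norm_image_sub_le_of_norm_deriv_le_segment'
    (f := fun s => W (-s) (y s)) (f' := d) (a := 0) (b := t) (C := η * (‖f‖ + ‖h‖))
    (fun s _ => (hd s).hasDerivWithinAt) (fun s _ => hdn s) t ⟨ht, le_rfl⟩
  have e0 : W (-0) (y 0) = J f := by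
    simp [hy, hW.apply_zero, hU.apply_zero]
  rw [e0, sub_zero, ← LinearIsometryEquiv.norm_map (W t), map_sub, hW.apply_neg_apply,
    norm_sub_rev] at key
  exact key

end Comparison

/-! ### Geometry of the smoothed curve -/

section PlaneVectors

lemma plane_vec_eq (a b : ℝ) : (!₂[a, b] : Plane) = a • !₂[1, 0] + b • !₂[0, 1] := by
  ext i; fin_cases i <;> simp

lemma plane_inner (x y : Plane) : inner ℝ x y = x 0 * y 0 + x 1 * y 1 := by
  rw [PiLp.inner_apply, Fin.sum_univ_two]
  simp only [RCLike.inner_apply, conj_trivial]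
  ring

lemma inner_tangentVec_tangentVec (a b : ℝ) :
    inner ℝ (tangentVec a) (tangentVec b) = Real.cos (a - b) := by
  rw [plane_inner, Real.cos_sub]; simp [tangentVec]

lemma inner_normalVec_normalVec (a b : ℝ) :
    inner ℝ (normalVec a) (normalVec b) = Real.cos (a - b) := by
  rw [plane_inner, Real.cos_sub]; simp [normalVec]; ring

lemma inner_normalVec_tangentVec (a b : ℝ) :
    inner ℝ (normalVec a) (tangentVec b) = Real.sin (a - b) := by
  rw [plane_inner, Real.sin_sub]; simp [tangentVec, normalVec]; ring

lemma inner_tangentVec_normalVec (a b : ℝ) :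
    inner ℝ (tangentVec a) (normalVec b) = Real.sin (b - a) := by
  rw [real_inner_comm, inner_normalVec_tangentVec]

lemma norm_tangentVec (a : ℝ) : ‖tangentVec a‖ = 1 := by
  rw [← sq_eq_sq₀ (norm_nonneg _) zero_le_one, ← real_inner_self_eq_norm_sq,
    inner_tangentVec_tangentVec]; simp

lemma norm_normalVec (a : ℝ) : ‖normalVec a‖ = 1 := by
  rw [← sq_eq_sq₀ (norm_nonneg _) zero_le_one, ← real_inner_self_eq_norm_sq,
    inner_normalVec_normalVec]; simp

lemma eq_tangentVec_add_normalVec (a : ℝ) (q : Plane) :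
    q = (inner ℝ (tangentVec a) q : ℝ) • tangentVec a +
      (inner ℝ (normalVec a) q : ℝ) • normalVec a := by
  have h := Real.sin_sq_add_cos_sq a
  ext i
  rw [plane_inner, plane_inner]
  fin_cases i
  · simp [tangentVec, normalVec]
    linear_combination (-q 0) * h
  · simp [tangentVec, normalVec]
    linear_combination (-q 1) * h

variable {a b : ℝ → ℝ} {a' b' s : ℝ}

lemma HasDerivAt.planeVec (ha : HasDerivAt a a' s) (hb : HasDerivAt b b' s) :
    HasDerivAt (fun s => (!₂[a s, b s] : Plane)) !₂[a', b'] s := by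
  rw [plane_vec_eq a' b']
  simp_rw [fun s => plane_vec_eq (a s) (b s)]
  exact (ha.smul_const _).add (hb.smul_const _)

lemma ContDiff.planeVec {n : WithTop ℕ∞} (ha : ContDiff ℝ n a) (hb : ContDiff ℝ n b) :
    ContDiff ℝ n (fun s => (!₂[a s, b s] : Plane)) := by
  simp_rw [fun s => plane_vec_eq (a s) (b s)]
  exact (ha.smul contDiff_const).add (hb.smul contDiff_const)

lemma hasDerivAt_tangentVec (ha : HasDerivAt a a' s) :
    HasDerivAt (fun s => tangentVec (a s)) (-a' • normalVec (a s)) s := by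
  have := ha.cos.planeVec ha.sin.neg
  convert! this using 1
  ext i; fin_cases i <;> simp [normalVec] <;> ring

lemma hasDerivAt_normalVec (ha : HasDerivAt a a' s) :
    HasDerivAt (fun s => normalVec (a s)) (a' • tangentVec (a s)) s := by
  have := ha.sin.planeVec ha.cos
  convert! this using 1
  ext i; fin_cases i <;> simp [tangentVec] <;> ring

end PlaneVectors

section Primitive

lemma hasDerivAt_primitive {h : ℝ → ℝ} (hh : Continuous h) (a s : ℝ) :
    HasDerivAt (fun s => ∫ r in a..s, h r) (h s) s :=
  intervalIntegral.integral_hasDerivAt_right (hh.intervalIntegrable _ _)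
    (hh.stronglyMeasurableAtFilter _ _) hh.continuousAt

lemma contDiff_primitive {h : ℝ → ℝ} (hh : ContDiff ℝ ∞ h) (a : ℝ) :
    ContDiff ℝ ∞ fun s => ∫ r in a..s, h r := by
  have e : deriv (fun s => ∫ r in a..s, h r) = h :=
    funext fun s => (hasDerivAt_primitive hh.continuous a s).deriv
  rw [contDiff_infty_iff_deriv, e]
  exact ⟨fun s => (hasDerivAt_primitive hh.continuous a s).differentiableAt, hh⟩

end Primitive

/-! ### Turning angle, straight parts and scaling of the smoothed curve. -/

section Curve

variable {ϑ : ℝ} {k : ℝ → ℝ} {d : ℝ}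

lemma contDiff_scaledCurvature (hk : ContDiff ℝ ∞ k) : ContDiff ℝ ∞ (scaledCurvature ϑ k d) :=
  contDiff_const.mul (hk.comp (contDiff_id.div_const d))

lemma curvature_eq_zero (hs : tsupport k ⊆ Ioo (-1) 1) {z : ℝ} (hz : 1 ≤ |z|) : k z = 0 :=
  image_eq_zero_of_notMem_tsupport fun h => by
    have := abs_lt.mpr (hs h)
    linarith

lemma scaledCurvature_eq_zero (hs : tsupport k ⊆ Ioo (-1) 1) (hd : 0 < d) {s : ℝ} (h : d ≤ |s|) :
    scaledCurvature ϑ k d s = 0 := by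
  rw [scaledCurvature, curvature_eq_zero hs, mul_zero]
  rwa [abs_div, abs_of_pos hd, one_le_div hd]

lemma hasDerivAt_turningAngle (hk : ContDiff ℝ ∞ k) (s : ℝ) :
    HasDerivAt (turningAngle ϑ k d) (scaledCurvature ϑ k d s) s :=
  hasDerivAt_primitive (contDiff_scaledCurvature hk).continuous _ _

lemma contDiff_turningAngle (hk : ContDiff ℝ ∞ k) : ContDiff ℝ ∞ (turningAngle ϑ k d) :=
  contDiff_primitive (contDiff_scaledCurvature hk) _

lemma turningAngle_eq_zero (hs : tsupport k ⊆ Ioo (-1) 1) (hd : 0 < d) {s : ℝ} (h : s ≤ -d) :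
    turningAngle ϑ k d s = 0 := by
  rw [turningAngle, intervalIntegral.integral_congr (g := fun _ => 0)]
  · simp
  · intro r hr
    rw [uIcc_of_ge h] at hr
    refine scaledCurvature_eq_zero hs hd ?_
    rw [abs_of_nonpos (by linarith [hr.2])]
    linarith [hr.2]

lemma turningAngle_eq (hs : tsupport k ⊆ Ioo (-1) 1) (hi : ∫ s, k s = 1)
    (hd : 0 < d) {s : ℝ} (h : d ≤ s) : turningAngle ϑ k d s = ϑ := by
  have h0 : Function.support (scaledCurvature ϑ k d) ⊆ Ioc (-d) s := by
    intro r hr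
    by_contra hn
    refine hr (scaledCurvature_eq_zero hs hd ?_)
    by_contra hlt
    push Not at hlt
    rw [abs_lt] at hlt
    exact hn ⟨hlt.1, by linarith⟩
  rw [turningAngle, intervalIntegral.integral_eq_integral_of_support_subset h0]
  simp only [scaledCurvature]
  rw [integral_const_mul, Measure.integral_comp_div k d, hi, abs_of_pos hd, smul_eq_mul, mul_one,
    div_mul_cancel₀ _ hd.ne']

lemma hasDerivAt_smoothedCurve (hk : ContDiff ℝ ∞ k) (s : ℝ) :
    HasDerivAt (smoothedCurve ϑ k d) (tangentVec (turningAngle ϑ k d s)) s := by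
  have hc := (contDiff_turningAngle (ϑ := ϑ) (d := d) hk).continuous
  exact ((hasDerivAt_primitive (Real.continuous_cos.comp hc) (-d) s).planeVec
    (hasDerivAt_primitive (Real.continuous_sin.comp hc) (-d) s).neg).const_add _

lemma contDiff_smoothedCurve (hk : ContDiff ℝ ∞ k) : ContDiff ℝ ∞ (smoothedCurve ϑ k d) := by
  have hc := contDiff_turningAngle (ϑ := ϑ) (d := d) hk
  exact contDiff_const.add ((contDiff_primitive (Real.contDiff_cos.comp hc) _).planeVec
    (contDiff_primitive (Real.contDiff_sin.comp hc) _).neg)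

lemma abs_integral_le_of_abs_le_one {h : ℝ → ℝ} (hd : 0 < d) (hb : ∀ r, |h r| ≤ 1) :
    |∫ r in (-d)..d, h r| ≤ 2 * d := by
  have := intervalIntegral.norm_integral_le_of_norm_le_const (a := -d) (b := d) (f := h) (C := 1)
    fun r _ => hb r
  rw [Real.norm_eq_abs, one_mul, abs_of_pos (by linarith : 0 < d - -d)] at this
  linarith

/-- The straight parts of the curve. -/
lemma exists_shift (hϑ : ϑ ∈ Ioo 0 Real.pi) (hk : ContDiff ℝ ∞ k) (hs : tsupport k ⊆ Ioo (-1) 1)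
    (hi : ∫ s, k s = 1) : ∃ C : ℝ, 0 < C ∧ ∀ d, 0 < d → ∃ σ₁ σ₂ : ℝ, |σ₁| ≤ C * d ∧ |σ₂| ≤ C * d ∧
      (∀ s ≤ -d, smoothedCurve ϑ k d s = (s + σ₁) • tangentVec 0) ∧
      ∀ s ≥ d, smoothedCurve ϑ k d s = (s + σ₂) • tangentVec ϑ := by
  have hsin : 0 < Real.sin ϑ := Real.sin_pos_of_mem_Ioo hϑ
  refine ⟨3 + 2 / Real.sin ϑ, by positivity, fun d hd => ?_⟩
  set c := ∫ r in (-d)..d, Real.cos (turningAngle ϑ k d r) with hc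
  set z := ∫ r in (-d)..d, Real.sin (turningAngle ϑ k d r) with hz
  have bc : |c| ≤ 2 * d := abs_integral_le_of_abs_le_one hd fun r => Real.abs_cos_le_one _
  have bz : |z| ≤ 2 * d := abs_integral_le_of_abs_le_one hd fun r => Real.abs_sin_le_one _
  have bz' : |z / Real.sin ϑ| ≤ 2 / Real.sin ϑ * d := by
    rw [abs_div, abs_of_pos hsin, div_mul_eq_mul_div]; gcongr
  -- The displacement (c, -z) along the bend is decomposed in the two edge directions, with
  -- coefficients c - z cot ϑ and z / sin ϑ. The curve enters the bend at minus the first on one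
  -- line and leaves it at the second on the other; comparison with s = -d and s = d gives the
  -- shifts.
  refine ⟨d - (c - z * (Real.cos ϑ / Real.sin ϑ)), z / Real.sin ϑ - d, ?_, ?_, ?_, ?_⟩
  · have b3 : |z * (Real.cos ϑ / Real.sin ϑ)| ≤ 2 / Real.sin ϑ * d := by
      rw [show z * (Real.cos ϑ / Real.sin ϑ) = z / Real.sin ϑ * Real.cos ϑ by ring, abs_mul]
      exact (mul_le_of_le_one_right (abs_nonneg _) (Real.abs_cos_le_one _)).trans bz'
    rw [abs_le] at *
    constructor <;> linarith
  · rw [abs_le] at *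
    constructor <;> linarith
  · intro s h
    have e1 : ∫ r in (-d)..s, Real.cos (turningAngle ϑ k d r) = s + d := by
      rw [intervalIntegral.integral_congr (g := fun _ => 1)]
      · simp
      · intro r hr
        rw [uIcc_of_ge h] at hr
        simp only
        rw [turningAngle_eq_zero hs hd hr.2, Real.cos_zero]
    have e2 : ∫ r in (-d)..s, Real.sin (turningAngle ϑ k d r) = 0 := by
      rw [intervalIntegral.integral_congr (g := fun _ => 0)]
      · simp
      · intro r hr
        rw [uIcc_of_ge h] at hr
        simp only
        rw [turningAngle_eq_zero hs hd hr.2, Real.sin_zero]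
    rw [smoothedCurve, e1, e2, ← hc, ← hz]
    ext i
    fin_cases i <;> simp [tangentVec]
    ring
  · intro s h
    have hcont := (contDiff_turningAngle (ϑ := ϑ) (d := d) hk).continuous
    have hcos : Continuous fun r => Real.cos (turningAngle ϑ k d r) := by fun_prop
    have hsin' : Continuous fun r => Real.sin (turningAngle ϑ k d r) := by fun_prop
    have e1 : ∫ r in (-d)..s, Real.cos (turningAngle ϑ k d r) = c + (s - d) * Real.cos ϑ := by
      rw [← intervalIntegral.integral_add_adjacent_intervals (b := d)
        (hcos.intervalIntegrable _ _) (hcos.intervalIntegrable _ _), hc]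
      congr 1
      rw [intervalIntegral.integral_congr (g := fun _ => Real.cos ϑ)]
      · simp
      · intro r hr
        rw [uIcc_of_le h] at hr
        simp only
        rw [turningAngle_eq hs hi hd hr.1]
    have e2 : ∫ r in (-d)..s, Real.sin (turningAngle ϑ k d r) = z + (s - d) * Real.sin ϑ := by
      rw [← intervalIntegral.integral_add_adjacent_intervals (b := d)
        (hsin'.intervalIntegrable _ _) (hsin'.intervalIntegrable _ _), hz]
      congr 1
      rw [intervalIntegral.integral_congr (g := fun _ => Real.sin ϑ)]
      · simp
      · intro r hr
        rw [uIcc_of_le h] at hr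
        simp only
        rw [turningAngle_eq hs hi hd hr.1]
    rw [smoothedCurve, e1, e2, ← hc, ← hz]
    ext i
    fin_cases i
    · simp [tangentVec]
      field_simp
      ring
    · simp [tangentVec]
      field_simp
      ring

/-! #### Scaling -/

lemma turningAngle_scale (hd : 0 < d) (s : ℝ) :
    turningAngle ϑ k d s = turningAngle ϑ k 1 (s / d) := by
  simp only [turningAngle, scaledCurvature, div_one]
  have h := intervalIntegral.integral_comp_div (a := -d) (b := s) (fun r => ϑ * k r) hd.ne'
  rw [neg_div, div_self hd.ne', smul_eq_mul] at h
  have e : ∀ r, ϑ / d * k (r / d) = d⁻¹ * (ϑ * k (r / d)) := fun r => by ring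
  simp_rw [e]
  rw [intervalIntegral.integral_const_mul, h, inv_mul_cancel_left₀ hd.ne']

lemma integral_comp_turningAngle_scale (hd : 0 < d) (g : ℝ → ℝ) (s : ℝ) :
    ∫ r in (-d)..s, g (turningAngle ϑ k d r) =
      d * ∫ r in (-1)..(s / d), g (turningAngle ϑ k 1 r) := by
  simp_rw [turningAngle_scale hd]
  have h := intervalIntegral.integral_comp_div (a := -d) (b := s)
    (fun r => g (turningAngle ϑ k 1 r)) hd.ne'
  rw [neg_div, div_self hd.ne', smul_eq_mul] at h
  exact h

lemma smoothedCurve_scale (hd : 0 < d) (s : ℝ) :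
    smoothedCurve ϑ k d s = d • smoothedCurve ϑ k 1 (s / d) := by
  simp only [smoothedCurve]
  rw [integral_comp_turningAngle_scale hd Real.cos s, integral_comp_turningAngle_scale hd Real.sin s,
    integral_comp_turningAngle_scale hd Real.cos d, integral_comp_turningAngle_scale hd Real.sin d,
    div_self hd.ne']
  ext i
  fin_cases i <;> simp [tangentVec]
  ring

lemma tubularMap_scale (hd : 0 < d) (p : ℝ × ℝ) :
    tubularMap ϑ k d p = d • tubularMap ϑ k 1 (p.1 / d, p.2 / d) := by
  rw [tubularMap, tubularMap, smoothedCurve_scale hd, turningAngle_scale hd, smul_add, smul_smul,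
    mul_div_cancel₀ _ hd.ne']

end Curve

/-! ### Tubular coordinates -/

section Tube

variable {ϑ : ℝ} {k : ℝ → ℝ} {d : ℝ}

/-- The curve moves at a definite rate in the direction of the bisector. -/
lemma exists_coercive (hϑ : ϑ ∈ Ioo 0 Real.pi) (hk : ContDiff ℝ ∞ k)
    (hs : tsupport k ⊆ Ioo (-1) 1) (hi : ∫ s, k s = 1) (hd : 0 < d) :
    ∃ κ C : ℝ, 0 < κ ∧ ∀ s s', κ * |s - s'| - C ≤
      ‖smoothedCurve ϑ k d s - smoothedCurve ϑ k d s'‖ := by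
  obtain ⟨_, _, h⟩ := exists_shift (k := k) hϑ hk hs hi
  obtain ⟨σ₁, σ₂, -, -, h1, h2⟩ := h d hd
  set v := tangentVec (ϑ / 2)
  set κ := Real.cos (ϑ / 2)
  have hκ : 0 < κ := Real.cos_pos_of_mem_Ioo ⟨by linarith [hϑ.1, Real.pi_pos], by linarith [hϑ.2]⟩
  -- Both edges make the angle ϑ/2 with the bisector, so this defect is constant on each straight
  -- part; it is bounded on the compact bend.
  set w : ℝ → ℝ := fun s => inner ℝ v (smoothedCurve ϑ k d s) - κ * s with hw
  have hwc : Continuous w :=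
    (continuous_const.inner (contDiff_smoothedCurve hk).continuous).sub (continuous_const.mul continuous_id)
  obtain ⟨C, hC⟩ := (isCompact_Icc (a := -d) (b := d)).exists_bound_of_continuousOn hwc.continuousOn
  set B := max C (max |κ * σ₁| |κ * σ₂|)
  have hB : ∀ s, |w s| ≤ B := by
    intro s
    rcases le_or_gt s (-d) with h | h
    · have : w s = κ * σ₁ := by
        rw [hw]; simp only; rw [h1 s h, inner_smul_right, inner_tangentVec_tangentVec, sub_zero]; ring
      rw [this]; exact (le_max_left _ _).trans (le_max_right _ _)
    · rcases le_or_gt d s with h' | h'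
      · have : w s = κ * σ₂ := by
          rw [hw]; simp only; rw [h2 s h', inner_smul_right, inner_tangentVec_tangentVec,
            show ϑ / 2 - ϑ = -(ϑ / 2) by ring, Real.cos_neg]; ring
        rw [this]; exact (le_max_right _ _).trans (le_max_right _ _)
      · exact (hC s ⟨h.le, h'.le⟩).trans (le_max_left _ _)
  refine ⟨κ, 2 * B, hκ, fun s s' => ?_⟩
  have e : inner ℝ v (smoothedCurve ϑ k d s - smoothedCurve ϑ k d s') =
      κ * (s - s') + (w s - w s') := by
    rw [inner_sub_right, hw]; ring
  have h3 := abs_real_inner_le_norm v (smoothedCurve ϑ k d s - smoothedCurve ϑ k d s')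
  rw [norm_tangentVec, one_mul, e] at h3
  have h4 : |κ * (s - s')| ≤ |κ * (s - s') + (w s - w s')| + |w s - w s'| := by
    have := abs_sub_abs_le_abs_sub (κ * (s - s') + (w s - w s')) (w s - w s')
    have := abs_sub (κ * (s - s') + (w s - w s')) (w s - w s')
    rwa [add_sub_cancel_right] at this
  have h5 : |w s - w s'| ≤ 2 * B := (abs_sub _ _).trans (by linarith [hB s, hB s'])
  rw [abs_mul, abs_of_pos hκ] at h4
  linarith

/-- A quantitative form of injectivity. For distant parameters it is coercivity, for two points on
one straight part the distance is the arc length, and the remaining pairs form a compact set on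
which injectivity gives a positive minimum. -/
lemma exists_separation (hϑ : ϑ ∈ Ioo 0 Real.pi) (hk : ContDiff ℝ ∞ k)
    (hs : tsupport k ⊆ Ioo (-1) 1) (hi : ∫ s, k s = 1)
    (hinj : Function.Injective (smoothedCurve ϑ k 1)) {r : ℝ} (hr : 0 < r) :
    ∃ m : ℝ, 0 < m ∧ ∀ s s', r ≤ |s - s'| →
      m ≤ ‖smoothedCurve ϑ k 1 s - smoothedCurve ϑ k 1 s'‖ := by
  obtain ⟨_, _, h⟩ := exists_shift (k := k) hϑ hk hs hi
  obtain ⟨σ₁, σ₂, -, -, h1, h2⟩ := h 1 one_pos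
  obtain ⟨κ, C, hκ, hco⟩ := exists_coercive hϑ hk hs hi one_pos
  -- At parameter distance `M` the coercive lower bound κ|s - s'| - C reaches 1.
  set M := |C + 1| / κ with hM
  have hM0 : 0 ≤ M := by positivity
  set K : Set (ℝ × ℝ) := (Icc (-1 - M) (1 + M) ×ˢ Icc (-1 - 2 * M) (1 + 2 * M)) ∩
    {p | r ≤ |p.1 - p.2|} with hK
  have hKc : IsCompact K := (isCompact_Icc.prod isCompact_Icc).inter_right
    (isClosed_le continuous_const (by fun_prop))
  have hζ := (contDiff_smoothedCurve (ϑ := ϑ) (d := 1) hk).continuous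
  obtain ⟨m, hm, hmK⟩ : ∃ m > 0, ∀ p ∈ K,
      m ≤ ‖smoothedCurve ϑ k 1 p.1 - smoothedCurve ϑ k 1 p.2‖ := by
    rcases K.eq_empty_or_nonempty with hE | hN
    · exact ⟨1, one_pos, fun p hp => by rw [hE] at hp; exact hp.elim⟩
    · obtain ⟨p, hp, hmin⟩ := hKc.exists_isMinOn hN
        (f := fun p => ‖smoothedCurve ϑ k 1 p.1 - smoothedCurve ϑ k 1 p.2‖)
        (by fun_prop)
      refine ⟨_, ?_, hmin⟩
      rw [gt_iff_lt, norm_pos_iff, sub_ne_zero]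
      intro heq
      have := hp.2
      rw [mem_ofPred_eq, hinj heq, sub_self, abs_zero] at this
      linarith
  refine ⟨min m (min 1 r), lt_min hm (lt_min one_pos hr), fun s s' hss => ?_⟩
  by_cases hfar : M ≤ |s - s'|
  · refine (min_le_right _ _).trans ((min_le_left _ _).trans ?_)
    have := hco s s'
    have h3 : |C + 1| ≤ κ * |s - s'| := by
      rw [hM, div_le_iff₀ hκ] at hfar; linarith
    linarith [le_abs_self (C + 1)]
  · push Not at hfar
    rw [abs_lt] at hfar
    have hstraight : ∀ θ σ : ℝ, smoothedCurve ϑ k 1 s = (s + σ) • tangentVec θ →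
        smoothedCurve ϑ k 1 s' = (s' + σ) • tangentVec θ →
        r ≤ ‖smoothedCurve ϑ k 1 s - smoothedCurve ϑ k 1 s'‖ := fun θ σ e e' => by
      rw [e, e', ← sub_smul, norm_smul, norm_tangentVec, mul_one, Real.norm_eq_abs,
        add_sub_add_right_eq_sub]
      exact hss
    by_cases hl : s < -1 - M
    · exact (min_le_right _ _).trans ((min_le_right _ _).trans
        (hstraight _ _ (h1 s (by linarith)) (h1 s' (by linarith))))
    by_cases hl' : 1 + M < s
    · exact (min_le_right _ _).trans ((min_le_right _ _).trans
        (hstraight _ _ (h2 s (by linarith)) (h2 s' (by linarith))))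
    push Not at hl hl'
    exact (min_le_left _ _).trans
      (hmK (s, s') ⟨⟨⟨hl, hl'⟩, ⟨by simp only; linarith, by simp only; linarith⟩⟩, hss⟩)

lemma exists_curvature_bound (ϑ : ℝ) (hk : ContDiff ℝ ∞ k) (hs : tsupport k ⊆ Ioo (-1) 1) :
    ∃ K : ℝ, 1 ≤ K ∧ (∀ z, |ϑ * k z| ≤ K) ∧ (∀ z, |ϑ * deriv k z| ≤ K) ∧
      ∀ z, |ϑ * deriv (deriv k) z| ≤ K := by
  have hc : HasCompactSupport k := HasCompactSupport.of_support_subset_isCompact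
    (isCompact_Icc (a := -1) (b := 1)) fun x hx => Ioo_subset_Icc_self (hs (subset_tsupport _ hx))
  have hk1 := (contDiff_infty_iff_deriv.mp hk).2
  have hk2 := (contDiff_infty_iff_deriv.mp hk1).2
  obtain ⟨C₀, h₀⟩ := (continuous_const.mul hk.continuous).bounded_above_of_compact_support
    (hc.mul_left (f := fun _ => ϑ))
  obtain ⟨C₁, h₁⟩ := (continuous_const.mul hk1.continuous).bounded_above_of_compact_support
    (hc.deriv.mul_left (f := fun _ => ϑ))
  obtain ⟨C₂, h₂⟩ := (continuous_const.mul hk2.continuous).bounded_above_of_compact_support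
    (hc.deriv.deriv.mul_left (f := fun _ => ϑ))
  refine ⟨max 1 (max C₀ (max C₁ C₂)), le_max_left _ _, fun z => (h₀ z).trans ?_,
    fun z => (h₁ z).trans ?_, fun z => (h₂ z).trans ?_⟩ <;> simp

/-- The turning angle is Lipschitz. -/
lemma abs_turningAngle_sub_le (hk : ContDiff ℝ ∞ k) {K : ℝ} (hK : ∀ z, |ϑ * k z| ≤ K) (s s' : ℝ) :
    |turningAngle ϑ k 1 s - turningAngle ϑ k 1 s'| ≤ K * |s - s'| := by
  have := convex_univ.norm_image_sub_le_of_norm_hasDerivWithin_le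
    (f := turningAngle ϑ k 1) (C := K) (x := s') (y := s)
    (fun x _ => (hasDerivAt_turningAngle hk x).hasDerivWithinAt)
    (fun x _ => by simpa [scaledCurvature] using hK x) (mem_univ _) (mem_univ _)
  exact this

/-- The tubular map is injective on short arcs near the curve. -/
lemma not_tubularMap_eq_of_lt (hk : ContDiff ℝ ∞ k) {K : ℝ} (hK1 : 1 ≤ K)
    (hK : ∀ z, |ϑ * k z| ≤ K) {s s' u u' : ℝ} (hlt : s' < s) (hr : s - s' < 1 / K)
    (hu : |u| < 1 / (2 * K)) : tubularMap ϑ k 1 (s, u) ≠ tubularMap ϑ k 1 (s', u') := by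
  intro heq
  have hK0 : 0 < K := by linarith
  set a := turningAngle ϑ k 1 s' with ha
  have hder : ∀ x, HasDerivAt (fun x => inner ℝ (tangentVec a) (smoothedCurve ϑ k 1 x))
      (Real.cos (a - turningAngle ϑ k 1 x)) x := fun x => by
    have := (hasDerivAt_const x (tangentVec a)).inner ℝ (hasDerivAt_smoothedCurve (ϑ := ϑ) (d := 1) hk x)
    simpa [inner_tangentVec_tangentVec] using this
  obtain ⟨c, hc, hslope⟩ := exists_hasDerivAt_eq_slope _ _ hlt
    (fun x _ => (hder x).continuousAt.continuousWithinAt) (fun x _ => hder x)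
  -- On an arc shorter than 1/K the tangent turns by at most 1, and cos is at least 1/2 there. The
  -- curve then advances by at least (s - s')/2 along the tangent at `s'`, whereas the normal offset
  -- `u` can compensate at most |u|K(s - s'), which is less.
  have hcos : 1 / 2 ≤ Real.cos (a - turningAngle ϑ k 1 c) := by
    have h1 := abs_turningAngle_sub_le hk hK s' c
    have h2 : |a - turningAngle ϑ k 1 c| ≤ 1 := by
      refine h1.trans ?_
      rw [abs_sub_comm, abs_of_pos (by linarith [hc.1])]
      rw [lt_div_iff₀ hK0] at hr
      nlinarith [hc.2]
    have h3 := Real.one_sub_sq_div_two_le_cos (x := a - turningAngle ϑ k 1 c)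
    have h4 : (a - turningAngle ϑ k 1 c) ^ 2 ≤ 1 := by rwa [sq_le_one_iff_abs_le_one]
    linarith
  rw [hslope, le_div_iff₀ (by linarith), ← inner_sub_right] at hcos
  have h5 := congrArg (fun q => inner ℝ (tangentVec a) q) heq
  simp only [tubularMap, inner_add_right, inner_smul_right, inner_tangentVec_normalVec] at h5
  rw [← ha, sub_self, Real.sin_zero, mul_zero, add_zero] at h5
  have h6 : |u * Real.sin (turningAngle ϑ k 1 s - a)| ≤ |u| * (K * (s - s')) := by
    rw [abs_mul]
    gcongr
    have := abs_turningAngle_sub_le hk hK s s'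
    rw [abs_of_pos (by linarith : 0 < s - s')] at this
    exact Real.abs_sin_le_abs.trans this
  rw [inner_sub_right] at hcos
  have h7 : 1 / 2 * (s - s') ≤ |u| * (K * (s - s')) := by
    have := neg_abs_le (u * Real.sin (turningAngle ϑ k 1 s - a))
    linarith
  rw [lt_div_iff₀ (by positivity)] at hu
  nlinarith

/-- There is a tube, of width proportional to `d`, on which the tubular map is injective. -/
theorem exists_tube_width (hϑ : ϑ ∈ Ioo 0 Real.pi) (hk : ContDiff ℝ ∞ k)
    (hs : tsupport k ⊆ Ioo (-1) 1) (hi : ∫ s, k s = 1)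
    (hinj : Function.Injective (smoothedCurve ϑ k 1)) :
    ∃ c : ℝ, 0 < c ∧ c ≤ 1 ∧ ∀ d, 0 < d →
      (∀ p p' : ℝ × ℝ, |p.2| < c * d → |p'.2| < c * d → tubularMap ϑ k d p = tubularMap ϑ k d p' →
        p = p') ∧ ∀ s u, |u| ≤ c * d → |u * scaledCurvature ϑ k d s| ≤ 1 / 2 := by
  obtain ⟨K, hK1, hK, -, -⟩ := exists_curvature_bound ϑ hk hs
  have hK0 : 0 < K := by linarith
  obtain ⟨m, hm, hsep⟩ := exists_separation hϑ hk hs hi hinj (r := 1 / K) (by positivity)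
  have hcK : min (1 / (2 * K)) (m / 2) ≤ 1 / (2 * K) := min_le_left _ _
  have hcm : min (1 / (2 * K)) (m / 2) ≤ m / 2 := min_le_right _ _
  -- The first bound serves injectivity on short arcs and |uκ| ≤ 1/2. The second excludes
  -- coincidences of distant arcs: points of the curve at distance at least `m` cannot be joined by
  -- two offsets smaller than m/2.
  refine ⟨min (1 / (2 * K)) (m / 2), by positivity, hcK.trans ?_, fun d hd => ⟨?_, ?_⟩⟩
  · rw [div_le_one (by positivity)]; linarith
  · have key : ∀ p p' : ℝ × ℝ, |p.2| < min (1 / (2 * K)) (m / 2) →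
        |p'.2| < min (1 / (2 * K)) (m / 2) → tubularMap ϑ k 1 p = tubularMap ϑ k 1 p' → p = p' := by
      rintro ⟨s, u⟩ ⟨s', u'⟩ hu hu' heq
      simp only at hu hu'
      have hclose : |s - s'| < 1 / K := by
        by_contra hfar
        push Not at hfar
        have h1 := hsep s s' hfar
        have h2 : smoothedCurve ϑ k 1 s - smoothedCurve ϑ k 1 s' =
            u' • normalVec (turningAngle ϑ k 1 s') - u • normalVec (turningAngle ϑ k 1 s) := by
          simp only [tubularMap] at heq
          rw [sub_eq_sub_iff_add_eq_add, heq, add_comm]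
        have h3 : ‖smoothedCurve ϑ k 1 s - smoothedCurve ϑ k 1 s'‖ ≤ |u'| + |u| := by
          rw [h2]
          refine (norm_sub_le _ _).trans ?_
          rw [norm_smul, norm_smul, norm_normalVec, norm_normalVec, mul_one, mul_one,
            Real.norm_eq_abs, Real.norm_eq_abs]
        linarith
      rw [abs_lt] at hclose
      have hss : s = s' := by
        rcases lt_trichotomy s s' with h | h | h
        · exact (not_tubularMap_eq_of_lt hk hK1 hK h (by linarith) (hu'.trans_le hcK) heq.symm).elim
        · exact h
        · exact (not_tubularMap_eq_of_lt hk hK1 hK h (by linarith) (hu.trans_le hcK) heq).elim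
      subst hss
      simp only [tubularMap, add_right_inj] at heq
      have h4 := congrArg (fun q => inner ℝ (normalVec (turningAngle ϑ k 1 s)) q) heq
      simp only [inner_smul_right, inner_normalVec_normalVec, sub_self, Real.cos_zero, mul_one] at h4
      rw [h4]
    intro p p' hp hp' heq
    rw [tubularMap_scale hd, tubularMap_scale hd] at heq
    have h1 := key (p.1 / d, p.2 / d) (p'.1 / d, p'.2 / d)
      (by simpa [abs_div, abs_of_pos hd, div_lt_iff₀ hd] using hp)
      (by simpa [abs_div, abs_of_pos hd, div_lt_iff₀ hd] using hp')
      (smul_right_injective Plane hd.ne' heq)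
    rw [Prod.mk.injEq, div_left_inj' hd.ne', div_left_inj' hd.ne'] at h1
    exact Prod.ext h1.1 h1.2
  · intro s u hu
    rw [scaledCurvature, show u * (ϑ / d * k (s / d)) = (u / d) * (ϑ * k (s / d)) by ring, abs_mul,
      abs_div, abs_of_pos hd]
    have h1 : |u| / d ≤ 1 / (2 * K) := by
      rw [div_le_iff₀ hd]
      exact hu.trans (by gcongr)
    calc _ ≤ 1 / (2 * K) * K := mul_le_mul h1 (hK _) (abs_nonneg _) (by positivity)
      _ = 1 / 2 := by field_simp

/-- Every point has tubular coordinates. -/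
theorem tubularCoord_spec (hϑ : ϑ ∈ Ioo 0 Real.pi) (hk : ContDiff ℝ ∞ k)
    (hs : tsupport k ⊆ Ioo (-1) 1) (hi : ∫ s, k s = 1) (hd : 0 < d) (q : Plane) :
    tubularMap ϑ k d (tubularCoord ϑ k d q) = q ∧
      |(tubularCoord ϑ k d q).2| = curveDist ϑ k d q := by
  refine Classical.epsilon_spec (p := fun p : ℝ × ℝ => tubularMap ϑ k d p = q ∧
    |p.2| = curveDist ϑ k d q) ?_
  obtain ⟨κ, C, hκ, hco⟩ := exists_coercive hϑ hk hs hi hd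
  have hζ := (contDiff_smoothedCurve (ϑ := ϑ) (d := d) hk).continuous
  have hlim : Tendsto (fun s => dist q (smoothedCurve ϑ k d s)) (cocompact ℝ) atTop := by
    have h1 : Tendsto (fun s : ℝ => κ * |s| - C - dist q (smoothedCurve ϑ k d 0))
        (cocompact ℝ) atTop := by
      refine tendsto_atTop_add_const_right _ _ (tendsto_atTop_add_const_right _ _ ?_)
      exact (tendsto_norm_cocompact_atTop (E := ℝ)).const_mul_atTop hκ
    refine tendsto_atTop_mono (fun s => ?_) h1
    have h2 := hco s 0
    rw [sub_zero, ← dist_eq_norm] at h2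
    have h3 := dist_triangle_left (smoothedCurve ϑ k d s) (smoothedCurve ϑ k d 0) q
    linarith
  -- The distance to `q` tends to infinity along the curve, so a nearest point exists; the first
  -- variation there makes the connecting vector normal.
  obtain ⟨s, hsmin⟩ := (show Continuous fun s => dist q (smoothedCurve ϑ k d s) by
    fun_prop).exists_forall_le hlim
  have hdist : curveDist ϑ k d q = dist q (smoothedCurve ϑ k d s) := by
    refine le_antisymm (Metric.infDist_le_dist_of_mem ⟨s, rfl⟩) ?_
    rw [curveDist, Metric.le_infDist (range_nonempty _)]
    rintro _ ⟨s', rfl⟩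
    exact hsmin s'
  set a := turningAngle ϑ k d s with ha
  have horth : inner ℝ (tangentVec a) (q - smoothedCurve ϑ k d s) = 0 := by
    have h1 : HasDerivAt (fun x => ‖q - smoothedCurve ϑ k d x‖ ^ 2)
        (2 * inner ℝ (q - smoothedCurve ϑ k d s) (-tangentVec a)) s :=
      ((hasDerivAt_smoothedCurve hk s).const_sub q).norm_sq
    have h2 : IsLocalMin (fun x => ‖q - smoothedCurve ϑ k d x‖ ^ 2) s := by
      refine Eventually.of_forall fun x => ?_
      have := hsmin x
      rw [dist_eq_norm, dist_eq_norm] at this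
      exact pow_le_pow_left₀ (norm_nonneg _) this 2
    have h3 := h2.hasDerivAt_eq_zero h1
    rw [inner_neg_right, real_inner_comm] at h3
    linarith
  have hq : q - smoothedCurve ϑ k d s =
      (inner ℝ (normalVec a) (q - smoothedCurve ϑ k d s) : ℝ) • normalVec a := by
    conv_lhs => rw [eq_tangentVec_add_normalVec a (q - smoothedCurve ϑ k d s), horth, zero_smul,
      zero_add]
  refine ⟨(s, inner ℝ (normalVec a) (q - smoothedCurve ϑ k d s)), ?_, ?_⟩
  · simp only [tubularMap]
    rw [← ha, ← hq]; abel
  · rw [hdist, dist_eq_norm]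
    conv_rhs => rw [hq, norm_smul, norm_normalVec, mul_one, Real.norm_eq_abs]

lemma curveDist_tubularMap_le (p : ℝ × ℝ) : curveDist ϑ k d (tubularMap ϑ k d p) ≤ |p.2| := by
  refine (Metric.infDist_le_dist_of_mem (mem_range_self p.1)).trans ?_
  rw [dist_eq_norm, tubularMap, add_sub_cancel_left, norm_smul, norm_normalVec, mul_one,
    Real.norm_eq_abs]

lemma continuous_curveDist : Continuous (curveDist ϑ k d) := Metric.continuous_infDist_pt _

lemma isOpen_curveTube : IsOpen (curveTube ϑ k d) :=
  isOpen_lt continuous_curveDist continuous_const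

end Tube

/-! ### Orthonormal frames -/

section Frame

lemma orthonormal_frame (θ : ℝ) : Orthonormal ℝ ![tangentVec θ, normalVec θ] := by
  rw [orthonormal_iff_ite]
  intro i j
  fin_cases i <;> fin_cases j <;>
    simp [inner_normalVec_tangentVec, inner_tangentVec_normalVec,
      norm_tangentVec, norm_normalVec]

/-- The orthonormal frame of tangent and normal. -/
def frameBasis (θ : ℝ) : OrthonormalBasis (Fin 2) ℝ Plane :=
  OrthonormalBasis.mk (orthonormal_frame θ) fun q _ => by
    rw [eq_tangentVec_add_normalVec θ q]
    exact add_mem (Submodule.smul_mem _ _ (Submodule.subset_span ⟨0, rfl⟩))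
      (Submodule.smul_mem _ _ (Submodule.subset_span ⟨1, rfl⟩))

lemma frameBasis_zero (θ : ℝ) : frameBasis θ 0 = tangentVec θ := by simp [frameBasis]

lemma frameBasis_one (θ : ℝ) : frameBasis θ 1 = normalVec θ := by simp [frameBasis]

/-- Cartesian coordinates in the frame. -/
def frameCoord (θ : ℝ) : Plane ≃ᵐ ℝ × ℝ :=
  ((frameBasis θ).measurableEquiv.trans (MeasurableEquiv.toLp 2 (Fin 2 → ℝ)).symm).trans
    MeasurableEquiv.finTwoArrow

lemma frameCoord_apply (θ : ℝ) (q : Plane) :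
    frameCoord θ q = (inner ℝ (tangentVec θ) q, inner ℝ (normalVec θ) q) := by
  rw [← frameBasis_zero, ← frameBasis_one]
  have h : ∀ i, (frameBasis θ).repr q i = inner ℝ (frameBasis θ i) q :=
    (frameBasis θ).repr_apply_apply q
  rw [← h, ← h]
  rfl

lemma measurePreserving_frameCoord (θ : ℝ) :
    MeasurePreserving (frameCoord θ) (volume : Measure Plane) (volume : Measure (ℝ × ℝ)) :=
  ((frameBasis θ).measurePreserving_measurableEquiv.trans
    (EuclideanSpace.volume_preserving_symm_measurableEquiv_toLp (Fin 2))).trans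
    (volume_preserving_finTwoArrow ℝ)

end Frame

/-! ### Calculus of the tubular map -/

section TubularCalculus

variable {ϑ : ℝ} {k : ℝ → ℝ} {d : ℝ}

lemma contDiff_tubularMap (hk : ContDiff ℝ ∞ k) : ContDiff ℝ ∞ (tubularMap ϑ k d) := by
  have h1 : ContDiff ℝ ∞ fun s => normalVec (turningAngle ϑ k d s) :=
    (Real.contDiff_sin.comp (contDiff_turningAngle hk)).planeVec
      (Real.contDiff_cos.comp (contDiff_turningAngle hk))
  exact ((contDiff_smoothedCurve hk).comp contDiff_fst).add
    (contDiff_snd.smul (h1.comp contDiff_fst))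

/-- The differential of the tubular map. -/
def tubularDeriv (ϑ : ℝ) (k : ℝ → ℝ) (d : ℝ) (p : ℝ × ℝ) : ℝ × ℝ →L[ℝ] Plane :=
  (ContinuousLinearMap.fst ℝ ℝ ℝ).smulRight
    ((1 + p.2 * scaledCurvature ϑ k d p.1) • tangentVec (turningAngle ϑ k d p.1)) +
  (ContinuousLinearMap.snd ℝ ℝ ℝ).smulRight (normalVec (turningAngle ϑ k d p.1))

lemma hasFDerivAt_tubularMap (hk : ContDiff ℝ ∞ k) (p : ℝ × ℝ) :
    HasFDerivAt (tubularMap ϑ k d) (tubularDeriv ϑ k d p) p := by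
  have h1 := (hasDerivAt_smoothedCurve (ϑ := ϑ) (d := d) hk p.1).hasFDerivAt.comp p
    (hasFDerivAt_fst (𝕜 := ℝ))
  have h2 := (hasDerivAt_normalVec (hasDerivAt_turningAngle (ϑ := ϑ) (d := d) hk p.1)).hasFDerivAt.comp p
    (hasFDerivAt_fst (𝕜 := ℝ))
  have h3 := h1.add ((hasFDerivAt_snd (𝕜 := ℝ) (p := p)).smul h2)
  refine HasFDerivAt.congr_fderiv h3 ?_
  ext
  · simp [tubularDeriv]; ring
  · simp [tubularDeriv]

lemma hasDerivAt_tubularMap_fst (hk : ContDiff ℝ ∞ k) (s u : ℝ) :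
    HasDerivAt (fun s => tubularMap ϑ k d (s, u))
      ((1 + u * scaledCurvature ϑ k d s) • tangentVec (turningAngle ϑ k d s)) s := by
  have := (hasFDerivAt_tubularMap (ϑ := ϑ) (d := d) hk (s, u)).comp_hasDerivAt s
    ((hasDerivAt_id s).prodMk (hasDerivAt_const s u))
  simpa [tubularDeriv] using! this

lemma hasDerivAt_tubularMap_snd (hk : ContDiff ℝ ∞ k) (s u : ℝ) :
    HasDerivAt (fun u => tubularMap ϑ k d (s, u)) (normalVec (turningAngle ϑ k d s)) u := by
  have := (hasFDerivAt_tubularMap (ϑ := ϑ) (d := d) hk (s, u)).comp_hasDerivAt u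
    ((hasDerivAt_const u s).prodMk (hasDerivAt_id u))
  simpa [tubularDeriv] using! this

/-- The differential of the tubular map as an equivalence. -/
def tubularDerivEquiv (p : ℝ × ℝ) (hp : 1 + p.2 * scaledCurvature ϑ k d p.1 ≠ 0) :
    (ℝ × ℝ) ≃L[ℝ] Plane :=
  ContinuousLinearEquiv.equivOfInverse (tubularDeriv ϑ k d p)
    (((1 + p.2 * scaledCurvature ϑ k d p.1)⁻¹ • innerSL ℝ (tangentVec (turningAngle ϑ k d p.1))).prod
      (innerSL ℝ (normalVec (turningAngle ϑ k d p.1))))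
    (fun x => by
      ext
      · simp [tubularDeriv, inner_add_right, inner_smul_right,
          inner_tangentVec_normalVec, norm_tangentVec]
        field_simp
      · simp [tubularDeriv, inner_add_right, inner_smul_right,
          inner_normalVec_tangentVec, norm_normalVec])
    (fun q => by
      conv_rhs => rw [eq_tangentVec_add_normalVec (turningAngle ϑ k d p.1) q]
      simp only [tubularDeriv, add_apply, ContinuousLinearMap.smulRight_apply,
        ContinuousLinearMap.prod_apply, ContinuousLinearMap.coe_fst', ContinuousLinearMap.coe_snd',
        smul_apply, innerSL_apply_apply, smul_eq_mul, smul_smul]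
      congr 2
      field_simp)

/-- The local inverse supplied by the inverse function theorem takes values in the strip |u| < r
near the point, and there `tubularCoord` is a left inverse of the tubular map. The two therefore
agree near the point. -/
lemma contDiffAt_tubularCoord (hk : ContDiff ℝ ∞ k) {r : ℝ}
    (hcoord : ∀ p : ℝ × ℝ, |p.2| < r → tubularCoord ϑ k d (tubularMap ϑ k d p) = p)
    {p : ℝ × ℝ} (hp : |p.2| < r) (hp' : 1 + p.2 * scaledCurvature ϑ k d p.1 ≠ 0) :
    ContDiffAt ℝ ∞ (tubularCoord ϑ k d) (tubularMap ϑ k d p) := by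
  have h1 := (contDiff_tubularMap (ϑ := ϑ) (d := d) hk).contDiffAt (x := p)
  have h2 : HasFDerivAt (tubularMap ϑ k d) (tubularDerivEquiv p hp' : ℝ × ℝ →L[ℝ] Plane) p :=
    hasFDerivAt_tubularMap hk p
  have hst := h1.hasStrictFDerivAt' h2 (by simp)
  refine (h1.to_localInverse h2 (by simp)).congr_of_eventuallyEq ?_
  have h3 : ∀ᶠ q in 𝓝 (tubularMap ϑ k d p), |(hst.localInverse _ _ _ q).2| < r :=
    hst.localInverse_tendsto.eventually
      ((isOpen_lt (continuous_abs.comp continuous_snd) continuous_const).mem_nhds hp)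
  filter_upwards [h3, hst.eventually_right_inverse] with q hq hq'
  have := hcoord _ hq
  rw [hq'] at this
  exact this

/-- The Laplacian in tubular coordinates. -/
theorem laplacian_tubularMap (hk : ContDiff ℝ ∞ k) {Ψ : Plane → ℂ} (hΨ : ContDiff ℝ 2 Ψ) {s u : ℝ}
    {κ' : ℝ} (hκ : HasDerivAt (scaledCurvature ϑ k d) κ' s)
    (ha : 1 + u * scaledCurvature ϑ k d s ≠ 0) {Gs Gu : ℝ → ℂ} {Gss Guu : ℂ}
    (h1 : ∀ᶠ x in 𝓝 s, HasDerivAt (fun x => Ψ (tubularMap ϑ k d (x, u))) (Gs x) x)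
    (h1' : HasDerivAt Gs Gss s)
    (h2 : ∀ᶠ x in 𝓝 u, HasDerivAt (fun x => Ψ (tubularMap ϑ k d (s, x))) (Gu x) x)
    (h2' : HasDerivAt Gu Guu u) :
    Laplacian.laplacian Ψ (tubularMap ϑ k d (s, u)) = Guu +
      ((1 + u * scaledCurvature ϑ k d s : ℝ) : ℂ)⁻¹ ^ 2 * (Gss -
        ((u * κ' : ℝ) : ℂ) * ((1 + u * scaledCurvature ϑ k d s : ℝ) : ℂ)⁻¹ * Gs s +
        ((1 + u * scaledCurvature ϑ k d s : ℝ) : ℂ) * scaledCurvature ϑ k d s * Gu u) := by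
  set κ := scaledCurvature ϑ k d with hκdef
  set θ := turningAngle ϑ k d with hθ
  set q := tubularMap ϑ k d (s, u) with hq
  set D := fderiv ℝ Ψ
  set D2 := fderiv ℝ D q
  have hD : ∀ x, HasFDerivAt Ψ (D x) x := fun x => (hΨ.differentiable (by norm_num) x).hasFDerivAt
  have hD2 : HasFDerivAt D D2 q :=
    ((hΨ.fderiv_right (m := 1) (by norm_num)).differentiable (by norm_num) q).hasFDerivAt
  have e2 : ∀ᶠ x in 𝓝 u, Gu x = D (tubularMap ϑ k d (s, x)) (normalVec (θ s)) := by
    filter_upwards [h2] with x hx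
    exact hx.unique ((hD _).comp_hasDerivAt x (hasDerivAt_tubularMap_snd hk s x))
  have e1 : ∀ᶠ x in 𝓝 s, Gs x = D (tubularMap ϑ k d (x, u)) ((1 + u * κ x) • tangentVec (θ x)) := by
    filter_upwards [h1] with x hx
    exact hx.unique ((hD _).comp_hasDerivAt x (hasDerivAt_tubularMap_fst hk x u))
  have f2 : Guu = D2 (normalVec (θ s)) (normalVec (θ s)) := by
    have h3 := hD2.comp_hasDerivAt u (hasDerivAt_tubularMap_snd (ϑ := ϑ) (d := d) hk s u)
    have h4 := h3.clm_apply (hasDerivAt_const u (normalVec (θ s)))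
    have h5 := h2'.unique (h4.congr_of_eventuallyEq e2)
    simpa using h5
  have f1 : Gss = D2 ((1 + u * κ s) • tangentVec (θ s)) ((1 + u * κ s) • tangentVec (θ s)) +
      D q ((u * κ') • tangentVec (θ s) + (1 + u * κ s) • (-κ s • normalVec (θ s))) := by
    have h3 := hD2.comp_hasDerivAt s (hasDerivAt_tubularMap_fst (ϑ := ϑ) (d := d) hk s u)
    have h4 := h3.clm_apply (((hκ.const_mul u).const_add 1).smul
      (hasDerivAt_tangentVec (hasDerivAt_turningAngle (ϑ := ϑ) (d := d) hk s)))
    have h5 := h1'.unique (h4.congr_of_eventuallyEq e1)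
    rw [h5, add_comm ((u * κ') • tangentVec (θ s))]
    rfl
  have g1 : Gs s = ((1 + u * κ s : ℝ) : ℂ) * D q (tangentVec (θ s)) := by
    rw [e1.self_of_nhds, map_smul, Complex.real_smul]
  have g2 : Gu u = D q (normalVec (θ s)) := e2.self_of_nhds
  -- The Laplacian is the trace of the Hessian in the local frame. The second derivative along a
  -- coordinate line also sees the curvature of that line, which yields the first-order corrections
  -- when solved for the tangential entry.
  have hlap : Laplacian.laplacian Ψ q = D2 (tangentVec (θ s)) (tangentVec (θ s)) +
      D2 (normalVec (θ s)) (normalVec (θ s)) := by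
    rw [laplacian_eq_sum_fderiv (frameBasis (θ s)) hΨ, Fin.sum_univ_two, frameBasis_zero,
      frameBasis_one]
    congr 1
    · rw [(hD2.clm_apply (hasFDerivAt_const _ _)).fderiv]; simp
    · rw [(hD2.clm_apply (hasFDerivAt_const _ _)).fderiv]; simp
  have ha' : ((1 + u * κ s : ℝ) : ℂ) ≠ 0 := by exact_mod_cast ha
  rw [hlap, f2, f1, g1, g2]
  simp only [map_add, map_smul, smul_apply, Complex.real_smul, neg_smul, map_neg]
  set A := ((1 + u * κ s : ℝ) : ℂ)
  field_simp
  push_cast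
  ring

end TubularCalculus

/-! ### Integration in tubular coordinates -/

section TubularIntegral

variable {ϑ : ℝ} {k : ℝ → ℝ} {d : ℝ}

/-- The Jacobian determinant of the tubular map is 1 + uκ(s), and as an inequality the area formula
needs no injectivity. -/
lemma volume_image_tubularMap_le (hk : ContDiff ℝ ∞ k) {S : Set (ℝ × ℝ)} (hS : MeasurableSet S)
    {A : ℝ} (hA : ∀ p ∈ S, |1 + p.2 * scaledCurvature ϑ k d p.1| ≤ A) :
    volume (tubularMap ϑ k d '' S) ≤ ENNReal.ofReal A * volume S := by
  set f : ℝ × ℝ → ℝ × ℝ := fun p => frameCoord 0 (tubularMap ϑ k d p) with hf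
  set f' : ℝ × ℝ → ℝ × ℝ →L[ℝ] ℝ × ℝ := fun p =>
    (Matrix.toLin (.finTwoProd ℝ) (.finTwoProd ℝ)
      !![(1 + p.2 * scaledCurvature ϑ k d p.1) * Real.cos (turningAngle ϑ k d p.1),
          Real.sin (turningAngle ϑ k d p.1);
        (1 + p.2 * scaledCurvature ϑ k d p.1) * -Real.sin (turningAngle ϑ k d p.1),
          Real.cos (turningAngle ϑ k d p.1)]).toContinuousLinearMap with hf'
  have hdet : ∀ p, (f' p).det = 1 + p.2 * scaledCurvature ϑ k d p.1 := fun p => by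
    simp only [hf', LinearMap.det_toContinuousLinearMap, LinearMap.det_toLin, Matrix.det_fin_two_of]
    linear_combination (1 + p.2 * scaledCurvature ϑ k d p.1) *
      Real.sin_sq_add_cos_sq (turningAngle ϑ k d p.1)
  have hder : ∀ p, HasFDerivAt f (f' p) p := fun p => by
    have h1 := ((innerSL ℝ (tangentVec 0)).prod (innerSL ℝ (normalVec 0))).hasFDerivAt.comp p
      (hasFDerivAt_tubularMap (ϑ := ϑ) (d := d) hk p)
    have e : f = (innerSL ℝ (tangentVec 0)).prod (innerSL ℝ (normalVec 0)) ∘ tubularMap ϑ k d := by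
      ext1 q
      rw [hf]; simp only; rw [frameCoord_apply]; rfl
    rw [e]
    refine h1.congr_fderiv ?_
    simp only [hf']
    rw [Matrix.toLin_finTwoProd_toContinuousLinearMap]
    ext <;> simp [tubularDeriv, inner_tangentVec_tangentVec,
      inner_normalVec_tangentVec, inner_tangentVec_normalVec, inner_normalVec_normalVec]
  have hvol : volume (tubularMap ϑ k d '' S) = volume (f '' S) := by
    have e : f '' S = frameCoord 0 '' (tubularMap ϑ k d '' S) := by rw [image_image]
    rw [e, ← (measurePreserving_frameCoord 0).measure_preimage_equiv,
      preimage_image_eq _ (frameCoord 0).injective]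
  rw [hvol]
  refine (addHaar_image_le_lintegral_abs_det_fderiv volume hS
    fun p _ => (hder p).hasFDerivWithinAt).trans ?_
  rw [← setLIntegral_const]
  refine setLIntegral_mono measurable_const fun p hp => ENNReal.ofReal_le_ofReal ?_
  rw [hdet]
  exact hA p hp

/-- Integrals over the tube, in tubular coordinates. -/
theorem lintegral_tubularCoord_le (hϑ : ϑ ∈ Ioo 0 Real.pi) (hk : ContDiff ℝ ∞ k)
    (hs : tsupport k ⊆ Ioo (-1) 1) (hi : ∫ s, k s = 1) (hd : 0 < d) {A : ℝ}
    (hA : ∀ p : ℝ × ℝ, |p.2| < d → |1 + p.2 * scaledCurvature ϑ k d p.1| ≤ A)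
    {F : ℝ × ℝ → ENNReal} (hF : Measurable F) :
    ∫⁻ q in curveTube ϑ k d, F (tubularCoord ϑ k d q) ≤ ENNReal.ofReal A * ∫⁻ p, F p := by
  have hTm : Measurable (tubularMap ϑ k d) := (contDiff_tubularMap hk).continuous.measurable
  -- The tubular coordinates are chosen by `epsilon` and may fail to be measurable, so the bound is
  -- proved for each measurable simple function below the integrand.
  rw [lintegral]
  refine iSup₂_le fun g hg => ?_
  -- A measurable set of coordinates whose image covers the part of the tube where `g` equals `x`,
  -- by existence of tubular coordinates. For different `x` these sets are disjoint, which bounds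
  -- the sum of indicators by `F`.
  set M : ENNReal → Set (ℝ × ℝ) := fun x =>
    {p | |p.2| < d ∧ g (tubularMap ϑ k d p) = x ∧ x ≤ F p} with hM
  have hMm : ∀ x, MeasurableSet (M x) := fun x =>
    (measurableSet_lt (f := fun p : ℝ × ℝ => |p.2|) (g := fun _ => d) (by fun_prop)
      measurable_const).inter (((g.measurable.comp hTm) (measurableSet_singleton x)).inter
        (measurableSet_le (f := fun _ => x) measurable_const hF))
  have hsub : ∀ x, g ⁻¹' {x} ∩ curveTube ϑ k d ⊆ tubularMap ϑ k d '' M x := by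
    rintro x q ⟨hq, hqt⟩
    have hspec := tubularCoord_spec hϑ hk hs hi hd q
    refine ⟨tubularCoord ϑ k d q, ⟨?_, ?_, ?_⟩, hspec.1⟩
    · rw [hspec.2]; exact hqt
    · rw [hspec.1]; exact hq
    · have h1 : g q = x := hq
      rw [← h1]; exact hg q
  calc g.lintegral (volume.restrict (curveTube ϑ k d))
      ≤ ∑ x ∈ g.range, x * (ENNReal.ofReal A * volume (M x)) := by
        refine Finset.sum_le_sum fun x _ => ?_
        gcongr
        rw [Measure.restrict_apply (g.measurableSet_fiber x)]
        exact (measure_mono (hsub x)).trans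
          (volume_image_tubularMap_le hk (hMm x) fun p hp => hA p hp.1)
    _ = ENNReal.ofReal A * ∫⁻ p, ∑ x ∈ g.range, (M x).indicator (fun _ => x) p := by
        rw [lintegral_finsetSum _ fun x _ => measurable_const.indicator (hMm x), Finset.mul_sum]
        refine Finset.sum_congr rfl fun x _ => ?_
        rw [lintegral_indicator_const (hMm x)]
        ring
    _ ≤ ENNReal.ofReal A * ∫⁻ p, F p := by
        gcongr with p
        rw [Finset.sum_eq_single (g (tubularMap ϑ k d p))]
        · by_cases hp : p ∈ M (g (tubularMap ϑ k d p))
          · rw [indicator_of_mem hp]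
            exact hp.2.2
          · rw [indicator_of_notMem hp]
            exact zero_le
        · intro x _ hx
          exact indicator_of_notMem (fun h => hx h.2.1.symm) _
        · intro h
          exact (h (g.mem_range_self _)).elim

lemma eLpNorm_two_sq {α E : Type*} [MeasurableSpace α] {μ : Measure α} [NormedAddCommGroup E]
    (f : α → E) : eLpNorm f 2 μ ^ 2 = ∫⁻ x, ‖f x‖ₑ ^ 2 ∂μ := by
  rw [eLpNorm_eq_lintegral_rpow_enorm_toReal (by norm_num) (by norm_num), ← ENNReal.rpow_natCast,
    ← ENNReal.rpow_mul]
  simp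

lemma lintegral_prod_sq (P m : ℝ → ℝ) (hP : Measurable P) (hm : Measurable m) :
    ∫⁻ p : ℝ × ℝ, ‖P p.1‖ₑ ^ 2 * ‖m p.2‖ₑ ^ 2 =
      (eLpNorm P 2 volume * eLpNorm m 2 volume) ^ 2 := by
  rw [Measure.volume_eq_prod, lintegral_prod_mul (f := fun s => ‖P s‖ₑ ^ 2)
    (g := fun u => ‖m u‖ₑ ^ 2) (by fun_prop) (by fun_prop), mul_pow, eLpNorm_two_sq,
    eLpNorm_two_sq]

/-- The `L²` norm of a function on the tube that is bounded by a product in tubular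
coordinates. -/
theorem eLpNorm_tube_le (hϑ : ϑ ∈ Ioo 0 Real.pi) (hk : ContDiff ℝ ∞ k)
    (hs : tsupport k ⊆ Ioo (-1) 1) (hi : ∫ s, k s = 1) (hd : 0 < d) {A : ℝ} (hA1 : 1 ≤ A)
    (hA : ∀ p : ℝ × ℝ, |p.2| < d → |1 + p.2 * scaledCurvature ϑ k d p.1| ≤ A)
    {Z : Plane → ℂ} {P m : ℝ → ℝ} (hP : Measurable P) (hm : Measurable m)
    (hZ : ∀ q ∈ curveTube ϑ k d,
      ‖Z q‖ ≤ P (tubularCoord ϑ k d q).1 * m (tubularCoord ϑ k d q).2) :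
    eLpNorm Z 2 ((volume : Measure Plane).restrict (curveTube ϑ k d)) ≤
      ENNReal.ofReal A * (eLpNorm P 2 volume * eLpNorm m 2 volume) := by
  have h1 : eLpNorm Z 2 ((volume : Measure Plane).restrict (curveTube ϑ k d)) ^ 2 ≤
      ENNReal.ofReal A * (eLpNorm P 2 volume * eLpNorm m 2 volume) ^ 2 := by
    rw [eLpNorm_two_sq, ← lintegral_prod_sq P m hP hm]
    refine le_trans ?_ (lintegral_tubularCoord_le hϑ hk hs hi hd hA
      (F := fun p => ‖P p.1‖ₑ ^ 2 * ‖m p.2‖ₑ ^ 2) (by fun_prop))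
    refine setLIntegral_mono' isOpen_curveTube.measurableSet fun q hq => ?_
    rw [← mul_pow, ← enorm_mul]
    gcongr
    rw [enorm_le_iff_norm_le, Real.norm_eq_abs]
    exact (hZ q hq).trans (le_abs_self _)
  -- Since A ≥ 1, the constant can be enlarged to a square and the root taken on both sides.
  have h2 : ENNReal.ofReal A ≤ ENNReal.ofReal A ^ 2 := by
    rw [← ENNReal.ofReal_pow (by linarith)]
    exact ENNReal.ofReal_le_ofReal (by nlinarith)
  have h3 := h1.trans (mul_le_mul_left h2 _)
  rw [← mul_pow] at h3
  exact (ENNReal.pow_le_pow_left_iff (by norm_num)).mp h3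

end TubularIntegral

/-! ### The modes of the harmonic oscillator -/

section Oscillator

open Polynomial

/-- Hermite's equation. In the induction it gives H_(n+1)' = (n + 1)H_n, and this identity in turn
gives the equation of the next degree. -/
lemma derivative_hermite_aux (n : ℕ) :
    derivative (derivative (hermite n)) = X * derivative (hermite n) - (n : ℤ[X]) * hermite n := by
  induction n with
  | zero => simp
  | succ n ih =>
    have h : derivative (hermite (n + 1)) = ((n + 1 : ℕ) : ℤ[X]) * hermite n := by
      rw [hermite_succ, derivative_sub, derivative_mul, derivative_X, ih]
      push_cast
      ring
    rw [h, derivative_mul, derivative_natCast, zero_mul, zero_add, hermite_succ]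
    ring

/-- The normalized Hermite polynomial. -/
def normalizedHermite (n : ℕ) : ℝ[X] :=
  C (Real.sqrt n.factorial)⁻¹ * (hermite n).map (Int.castRingHom ℝ)

lemma normalizedHermite_ode (n : ℕ) : derivative (derivative (normalizedHermite n)) =
    X * derivative (normalizedHermite n) - (n : ℝ[X]) * normalizedHermite n := by
  simp only [normalizedHermite, derivative_mul, derivative_C, zero_mul, zero_add, derivative_map]
  rw [derivative_hermite_aux, Polynomial.map_sub, Polynomial.map_mul, Polynomial.map_mul, map_X,
    Polynomial.map_natCast]
  ring

/-- A polynomial times a Gaussian, in `L²`-invariant scaling. -/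
def gaussPoly (p : ℝ[X]) (ε y : ℝ) : ℝ :=
  (Real.pi * ε) ^ (-(1 / 4) : ℝ) * p.eval (Real.sqrt (2 / ε) * y) * Real.exp (-(y ^ 2) / (2 * ε))

lemma oscillatorMode_eq (n : ℕ) (ε y : ℝ) :
    oscillatorMode n ε y = gaussPoly (normalizedHermite n) ε y := by
  simp only [oscillatorMode, gaussPoly, normalizedHermite, eval_mul, eval_C, eval_map,
    aeval_def]
  rw [algebraMap_int_eq]
  ring

lemma contDiff_gaussPoly (p : ℝ[X]) (ε : ℝ) : ContDiff ℝ ∞ (gaussPoly p ε) := by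
  have : ContDiff ℝ ∞ fun y : ℝ => p.eval (Real.sqrt (2 / ε) * y) :=
    (by simpa [coe_aeval_eq_eval] using p.contDiff_aeval (𝕜 := ℝ) (n := ∞) :
      ContDiff ℝ ∞ fun x => p.eval x).comp (contDiff_const.mul contDiff_id)
  unfold gaussPoly
  fun_prop

/-- The derivative of a polynomial times a Gaussian. -/
def gaussDerivative (p : ℝ[X]) : ℝ[X] := derivative p - C (1 / 2) * X * p

lemma hasDerivAt_gaussPoly (p : ℝ[X]) {ε : ℝ} (hε : 0 < ε) (y : ℝ) :
    HasDerivAt (gaussPoly p ε) (Real.sqrt (2 / ε) * gaussPoly (gaussDerivative p) ε y) y := by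
  have h1 : HasDerivAt (fun y => p.eval (Real.sqrt (2 / ε) * y))
      ((derivative p).eval (Real.sqrt (2 / ε) * y) * (Real.sqrt (2 / ε) * 1)) y :=
    (p.hasDerivAt _).comp y ((hasDerivAt_id y).const_mul _)
  have h2 : HasDerivAt (fun y : ℝ => Real.exp (-(y ^ 2) / (2 * ε)))
      (Real.exp (-(y ^ 2) / (2 * ε)) * (-(2 * y) / (2 * ε))) y := by
    have := (((hasDerivAt_pow 2 y).neg).div_const (2 * ε)).exp
    simpa using! this
  have h3 := (h1.const_mul ((Real.pi * ε) ^ (-(1 / 4) : ℝ))).mul h2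
  refine h3.congr_deriv ?_
  simp only [gaussPoly, gaussDerivative, eval_sub, eval_mul, eval_C, eval_X]
  have h4 : Real.sqrt (2 / ε) * Real.sqrt (2 / ε) = 2 / ε := Real.mul_self_sqrt (by positivity)
  have h5 : -(2 * y) / (2 * ε) = -(1 / 2) * (Real.sqrt (2 / ε) * Real.sqrt (2 / ε)) * y := by
    rw [h4]; field_simp
  rw [h5]
  ring

lemma sqrt_half_mul_sqrt {ε : ℝ} (hε : 0 < ε) : Real.sqrt (ε / 2) * Real.sqrt (2 / ε) = 1 := by
  rw [← Real.sqrt_mul (by positivity), show ε / 2 * (2 / ε) = 1 by field_simp, Real.sqrt_one]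

lemma mul_gaussPoly (p : ℝ[X]) {ε : ℝ} (hε : 0 < ε) (y : ℝ) :
    y * gaussPoly p ε y = Real.sqrt (ε / 2) * gaussPoly (X * p) ε y := by
  have h := sqrt_half_mul_sqrt hε
  simp only [gaussPoly, eval_mul, eval_X]
  linear_combination (-(y * (Real.pi * ε) ^ (-(1 / 4) : ℝ) * p.eval (Real.sqrt (2 / ε) * y) *
    Real.exp (-(y ^ 2) / (2 * ε)))) * h

/-- Hermite's equation conjugated by the Gaussian exp(-z²/4), that is, the oscillator equation at
the level of polynomials. -/
lemma gaussDerivative_gaussDerivative (n : ℕ) :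
    gaussDerivative (gaussDerivative (normalizedHermite n)) =
      C (1 / 4) * (X * (X * normalizedHermite n)) -
        C ((n : ℝ) + 1 / 2) * normalizedHermite n := by
  have hC : (C (1 / 2) * C (1 / 2) : ℝ[X]) = C (1 / 4) := by rw [← C_mul]; norm_num
  have hC2 : (C (1 / 2) + C (1 / 2) : ℝ[X]) = 1 := by rw [← C_add]; norm_num
  have hn : (C (n : ℝ) : ℝ[X]) = (n : ℝ[X]) := by simp
  simp only [gaussDerivative, derivative_sub, derivative_mul, derivative_C, derivative_X,
    normalizedHermite_ode, C_add, hn]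
  linear_combination (X * X * normalizedHermite n) * hC -
    (X * derivative (normalizedHermite n)) * hC2

/-- The derivative of the oscillator mode. -/
def oscillatorDeriv (n : ℕ) (ε y : ℝ) : ℝ :=
  Real.sqrt (2 / ε) * gaussPoly (gaussDerivative (normalizedHermite n)) ε y

lemma contDiff_oscillatorMode (n : ℕ) (ε : ℝ) : ContDiff ℝ ∞ (oscillatorMode n ε) := by
  rw [funext (oscillatorMode_eq n ε)]
  exact contDiff_gaussPoly _ _

lemma continuous_oscillatorDeriv (n : ℕ) (ε : ℝ) : Continuous (oscillatorDeriv n ε) :=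
  continuous_const.mul (contDiff_gaussPoly _ _).continuous

lemma hasDerivAt_oscillatorMode (n : ℕ) {ε : ℝ} (hε : 0 < ε) (y : ℝ) :
    HasDerivAt (oscillatorMode n ε) (oscillatorDeriv n ε y) y := by
  rw [funext (oscillatorMode_eq n ε)]
  exact hasDerivAt_gaussPoly _ hε y

lemma hasDerivAt_oscillatorDeriv (n : ℕ) {ε : ℝ} (hε : 0 < ε) (y : ℝ) :
    HasDerivAt (oscillatorDeriv n ε)
      ((y ^ 2 / ε ^ 2 - 2 * ((n + 1 / 2) / ε)) * oscillatorMode n ε y) y := by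
  refine ((hasDerivAt_gaussPoly (gaussDerivative (normalizedHermite n)) hε y).const_mul
    (Real.sqrt (2 / ε))).congr_deriv ?_
  have h4 : Real.sqrt (2 / ε) * Real.sqrt (2 / ε) = 2 / ε := Real.mul_self_sqrt (by positivity)
  rw [← mul_assoc, h4, oscillatorMode_eq, gaussDerivative_gaussDerivative]
  simp only [gaussPoly, eval_sub, eval_mul, eval_C, eval_X]
  have h6 : 2 / ε * (1 / 4 * (Real.sqrt (2 / ε) * y * (Real.sqrt (2 / ε) * y))) =
      y ^ 2 / ε ^ 2 := by
    rw [show Real.sqrt (2 / ε) * y * (Real.sqrt (2 / ε) * y) =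
      (Real.sqrt (2 / ε) * Real.sqrt (2 / ε)) * y ^ 2 by ring, h4]
    field_simp
    ring
  linear_combination ((Real.pi * ε) ^ (-(1 / 4) : ℝ) *
    (normalizedHermite n).eval (Real.sqrt (2 / ε) * y) * Real.exp (-(y ^ 2) / (2 * ε))) * h6

lemma integrable_polynomial_mul_gaussian (p : ℝ[X]) :
    Integrable fun z : ℝ => p.eval z * Real.exp (-(1 / 2) * z ^ 2) := by
  have h : ∀ m : ℕ, Integrable fun z : ℝ => z ^ m * Real.exp (-(1 / 2) * z ^ 2) := fun m => by
    have := integrable_rpow_mul_exp_neg_mul_sq (b := 1 / 2) (by norm_num) (s := m)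
      (by have : (0 : ℝ) ≤ m := m.cast_nonneg
          linarith)
    simpa using this
  induction p using Polynomial.induction_on' with
  | add p q hp hq => simpa [add_mul] using! hp.add hq
  | monomial m a => simpa [mul_assoc] using (h m).const_mul a

lemma memLp_polynomial_mul_gaussian (p : ℝ[X]) :
    MemLp (fun z : ℝ => p.eval z * Real.exp (-(z ^ 2 / 4))) 2 := by
  refine (memLp_two_iff_integrable_sq ?_).2 ?_
  · have := p.continuous
    exact Continuous.aestronglyMeasurable (by fun_prop)
  · refine (integrable_polynomial_mul_gaussian (p ^ 2)).congr (.of_forall fun z => ?_)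
    simp only [eval_pow, mul_pow, ← Real.exp_nat_mul]
    congr 2
    push_cast
    ring

lemma eLpNorm_comp_mul (g : ℝ → ℝ) (hg : Continuous g) {a : ℝ} (ha : 0 < a) :
    eLpNorm (fun y => g (a * y)) 2 volume ^ 2 =
      ENNReal.ofReal a⁻¹ * eLpNorm g 2 volume ^ 2 := by
  rw [eLpNorm_two_sq, eLpNorm_two_sq, ← lintegral_map (μ := volume) (f := fun x => ‖g x‖ₑ ^ 2)
    (g := fun y => a * y) (by fun_prop) (by fun_prop), Real.map_volume_mul_left ha.ne',
    lintegral_smul_measure, abs_of_pos (inv_pos.2 ha), smul_eq_mul]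

/-- The `L²` norm of a polynomial times a Gaussian does not depend on the scale. -/
lemma exists_eLpNorm_gaussPoly_le (p : ℝ[X]) :
    ∃ C : ℝ, 0 ≤ C ∧ ∀ ε : ℝ, 0 < ε → eLpNorm (gaussPoly p ε) 2 volume ≤ ENNReal.ofReal C := by
  set g : ℝ → ℝ := fun z => p.eval z * Real.exp (-(z ^ 2 / 4)) with hg
  have hgc : Continuous g := by
    have := p.continuous
    fun_prop
  have hfin := (memLp_polynomial_mul_gaussian p).eLpNorm_ne_top
  refine ⟨(eLpNorm g 2 volume).toReal, ENNReal.toReal_nonneg, fun ε hε => ?_⟩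
  rw [ENNReal.ofReal_toReal hfin]
  refine (ENNReal.pow_le_pow_left_iff (n := 2) (by norm_num)).mp ?_
  have e : gaussPoly p ε = (Real.pi * ε) ^ (-(1 / 4) : ℝ) •
      fun y => g (Real.sqrt (2 / ε) * y) := by
    ext y
    simp only [gaussPoly, Pi.smul_apply, hg, smul_eq_mul, mul_assoc, mul_pow]
    rw [Real.sq_sqrt (by positivity)]
    congr 3
    field_simp
    norm_num
  rw [e, eLpNorm_const_smul, mul_pow, eLpNorm_comp_mul g hgc (by positivity), ← mul_assoc]
  -- The squared amplitude (πε)^(-1/2) times the Jacobian (2/ε)^(-1/2) equals (2π)^(-1/2) ≤ 1,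
  -- whatever ε is.
  refine mul_le_of_le_one_left' ?_
  rw [Real.enorm_eq_ofReal (by positivity), ← ENNReal.ofReal_pow (by positivity),
    ← ENNReal.ofReal_mul (by positivity), ← ENNReal.ofReal_one]
  refine ENNReal.ofReal_le_ofReal ?_
  have h1 : ((Real.pi * ε) ^ (-(1 / 4) : ℝ)) ^ 2 = (Real.sqrt (Real.pi * ε))⁻¹ := by
    rw [← Real.rpow_natCast, ← Real.rpow_mul (by positivity), Real.sqrt_eq_rpow,
      ← Real.rpow_neg (by positivity)]
    norm_num
  rw [h1, ← mul_inv, ← Real.sqrt_mul (by positivity),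
    show Real.pi * ε * (2 / ε) = 2 * Real.pi by field_simp]
  exact inv_le_one_of_one_le₀ (Real.one_le_sqrt.2 (by linarith [Real.pi_gt_three]))

/-- The weighted `L²` norms of the oscillator mode. -/
theorem exists_oscillator_bound (n : ℕ) : ∃ C : ℝ, 1 ≤ C ∧ ∀ ε : ℝ, 0 < ε →
    eLpNorm (oscillatorMode n ε) 2 volume ≤ ENNReal.ofReal C ∧
    eLpNorm (fun u => u * oscillatorMode n ε u) 2 volume ≤ ENNReal.ofReal (C * Real.sqrt ε) ∧
    eLpNorm (fun u => u ^ 2 * oscillatorDeriv n ε u) 2 volume ≤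
      ENNReal.ofReal (C * Real.sqrt ε) := by
  obtain ⟨C₁, h1, H1⟩ := exists_eLpNorm_gaussPoly_le (normalizedHermite n)
  obtain ⟨C₂, h2, H2⟩ := exists_eLpNorm_gaussPoly_le (X * normalizedHermite n)
  obtain ⟨C₃, h3, H3⟩ := exists_eLpNorm_gaussPoly_le
    (X * (X * gaussDerivative (normalizedHermite n)))
  -- The second alternative merely lets one statement cover the several constants C'; it is excluded
  -- at each use.
  have key : ∀ (c ε C' : ℝ) (p : ℝ[X]) (h : ℝ → ℝ), 0 ≤ c → 0 < ε → 0 ≤ C' →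
      eLpNorm (gaussPoly p ε) 2 volume ≤ ENNReal.ofReal C' → c ≤ Real.sqrt ε →
      (∀ u, h u = c * gaussPoly p ε u) →
      eLpNorm h 2 volume ≤ ENNReal.ofReal ((1 + C₁ + C₂ + C₃) * Real.sqrt ε) ∨
        1 + C₁ + C₂ + C₃ < C' := by
    intro c ε C' p h hc hε hC' hp hcε hh
    refine or_iff_not_imp_right.2 fun hn => ?_
    rw [show h = c • gaussPoly p ε from funext hh, eLpNorm_const_smul,
      Real.enorm_eq_ofReal hc]
    refine (mul_le_mul_right hp _).trans ?_
    rw [← ENNReal.ofReal_mul hc]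
    refine ENNReal.ofReal_le_ofReal ?_
    rw [mul_comm]
    exact mul_le_mul (not_lt.1 hn) hcε hc (by positivity)
  have hs : ∀ ε : ℝ, 0 < ε → Real.sqrt (ε / 2) ≤ Real.sqrt ε := fun ε hε =>
    Real.sqrt_le_sqrt (by linarith)
  refine ⟨1 + C₁ + C₂ + C₃, by linarith, fun ε hε => ⟨?_, ?_, ?_⟩⟩
  · rw [funext (oscillatorMode_eq n ε)]
    exact (H1 ε hε).trans (ENNReal.ofReal_le_ofReal (by linarith))
  · refine (key _ ε C₂ _ _ (Real.sqrt_nonneg _) hε h2 (H2 ε hε) (hs ε hε) fun u => ?_).resolve_right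
      (by linarith)
    rw [oscillatorMode_eq, mul_gaussPoly _ hε]
  · refine (key _ ε C₃ _ _ (Real.sqrt_nonneg _) hε h3 (H3 ε hε) (hs ε hε) fun u => ?_).resolve_right
      (by linarith)
    have h := sqrt_half_mul_sqrt hε
    have e1 := mul_gaussPoly (gaussDerivative (normalizedHermite n)) hε u
    have e2 := mul_gaussPoly (X * gaussDerivative (normalizedHermite n)) hε u
    rw [oscillatorDeriv]
    -- Each factor `u` contributes √(ε/2) and the derivative contributes √(2/ε), so the net factor
    -- is √(ε/2).
    linear_combination (Real.sqrt (2 / ε) * u) * e1 +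
      (Real.sqrt (2 / ε) * Real.sqrt (ε / 2)) * e2 + (Real.sqrt (ε / 2) *
        gaussPoly (X * (X * gaussDerivative (normalizedHermite n))) ε u) * h

end Oscillator

/-! ### Tubular coordinates near the curve -/

/-- The normal coordinate chosen for the image point is the distance to the curve in absolute value,
hence at most |p.2| < r. So both coordinate pairs lie in the strip of injectivity. -/
lemma tubularCoord_tubularMap {ϑ : ℝ} {k : ℝ → ℝ} {d r : ℝ} (hϑ : ϑ ∈ Ioo 0 Real.pi)
    (hk : ContDiff ℝ ∞ k) (hs : tsupport k ⊆ Ioo (-1) 1) (hi : ∫ s, k s = 1) (hd : 0 < d)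
    (hinj : ∀ p p' : ℝ × ℝ, |p.2| < r → |p'.2| < r →
      tubularMap ϑ k d p = tubularMap ϑ k d p' → p = p') {p : ℝ × ℝ} (hp : |p.2| < r) :
    tubularCoord ϑ k d (tubularMap ϑ k d p) = p := by
  have h := tubularCoord_spec hϑ hk hs hi hd (tubularMap ϑ k d p)
  exact hinj _ _ (by rw [h.2]; exact (curveDist_tubularMap_le p).trans_lt hp) hp h.1

/-! ### Quasimodes -/

/-- The tubular coordinates of the smoothed curve are regular in the tube of radius `r`, with
curvature bounds in terms of `K`. -/
structure IsTubeWidth (ϑ : ℝ) (k : ℝ → ℝ) (d r K : ℝ) : Prop where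
  angle : ϑ ∈ Ioo 0 Real.pi
  smooth : ContDiff ℝ ∞ k
  supp : tsupport k ⊆ Ioo (-1) 1
  int : ∫ s, k s = 1
  r_pos : 0 < r
  r_le : r ≤ d
  d_le : d ≤ 1
  coord : ∀ p : ℝ × ℝ, |p.2| < r → tubularCoord ϑ k d (tubularMap ϑ k d p) = p
  half : ∀ s u, |u| ≤ r → |u * scaledCurvature ϑ k d s| ≤ 1 / 2
  one_le : 1 ≤ K
  area : ∀ p : ℝ × ℝ, |p.2| < d → |1 + p.2 * scaledCurvature ϑ k d p.1| ≤ 1 + K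
  curv : ∀ s, |scaledCurvature ϑ k d s| ≤ K / r
  curv_deriv : ∀ s, |deriv (scaledCurvature ϑ k d) s| ≤ K / r ^ 2
  curv_deriv2 : ∀ s, |deriv (deriv (scaledCurvature ϑ k d)) s| ≤ K / r ^ 3

lemma IsTubeWidth.d_pos {ϑ : ℝ} {k : ℝ → ℝ} {d r K : ℝ} (h : IsTubeWidth ϑ k d r K) : 0 < d :=
  h.r_pos.trans_le h.r_le

theorem exists_isTubeWidth {ϑ : ℝ} (hϑ : ϑ ∈ Ioo 0 Real.pi) {k : ℝ → ℝ} (hk : ContDiff ℝ ∞ k)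
    (hs : tsupport k ⊆ Ioo (-1) 1) (hi : ∫ s, k s = 1)
    (hinj : Function.Injective (smoothedCurve ϑ k 1)) :
    ∃ c K : ℝ, 0 < c ∧ ∀ d, 0 < d → d ≤ 1 → IsTubeWidth ϑ k d (c * d) K := by
  obtain ⟨c, hc, hc1, H⟩ := exists_tube_width hϑ hk hs hi hinj
  obtain ⟨K, hK, K0, K1, K2⟩ := exists_curvature_bound ϑ hk hs
  refine ⟨c, K, hc, fun d hd hd1 => ?_⟩
  have hk1 := (contDiff_infty_iff_deriv.mp hk).2
  have hr : 0 < c * d := by positivity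
  have hrd : c * d ≤ d := by nlinarith
  have e1 : deriv (scaledCurvature ϑ k d) = fun s => ϑ / d ^ 2 * deriv k (s / d) := by
    ext s
    have := (((hk.differentiable (by simp)).differentiableAt.hasDerivAt (x := s / d)).comp s
      ((hasDerivAt_id s).div_const d)).const_mul (ϑ / d)
    refine this.deriv.trans ?_
    field_simp
  have e2 : deriv (deriv (scaledCurvature ϑ k d)) = fun s => ϑ / d ^ 3 * deriv (deriv k) (s / d) := by
    ext s
    rw [e1]
    have := (((hk1.differentiable (by simp)).differentiableAt.hasDerivAt (x := s / d)).comp s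
      ((hasDerivAt_id s).div_const d)).const_mul (ϑ / d ^ 2)
    refine this.deriv.trans ?_
    field_simp
  -- Each derivative of the scaled curvature costs a factor 1/d; since c ≤ 1, powers of 1/d are at
  -- most powers of 1/(cd).
  have key : ∀ (j : ℕ) (x : ℝ), |ϑ * x| ≤ K → |ϑ / d ^ j * x| ≤ K / (c * d) ^ j := by
    intro j x hx
    rw [div_mul_eq_mul_div, abs_div, abs_of_pos (pow_pos hd j)]
    gcongr
  have hκ : ∀ s, |scaledCurvature ϑ k d s| ≤ K / d := fun s => by
    rw [scaledCurvature, div_mul_eq_mul_div, abs_div, abs_of_pos hd]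
    gcongr
    exact K0 _
  refine ⟨hϑ, hk, hs, hi, hr, hrd, hd1, fun p hp =>
    tubularCoord_tubularMap hϑ hk hs hi hd (H d hd).1 hp, (H d hd).2, hK, fun p hp => ?_,
    fun s => ?_, fun s => ?_, fun s => ?_⟩
  · refine (abs_add_le _ _).trans ?_
    rw [abs_one, abs_mul]
    have : |p.2| * |scaledCurvature ϑ k d p.1| ≤ d * (K / d) :=
      mul_le_mul hp.le (hκ _) (abs_nonneg _) hd.le
    rw [mul_div_cancel₀ _ hd.ne'] at this
    linarith
  · simpa [scaledCurvature] using key 1 _ (K0 (s / d))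
  · rw [e1]; exact key 2 _ (K1 _)
  · rw [e2]; exact key 3 _ (K2 _)

/-! ### The transverse weight and the localized oscillator mode. -/

section Weight

/-- The weight `(1 + u κ(s))^{-1/2}`. -/
def tubeWeight (ϑ : ℝ) (k : ℝ → ℝ) (d s u : ℝ) : ℝ := (Real.sqrt (1 + u * scaledCurvature ϑ k d s))⁻¹

/-- The localized oscillator mode. -/
def cutMode (n : ℕ) (ε r u : ℝ) : ℝ := cutoff (u / r) * oscillatorMode n ε u

lemma HasDerivAt.inv_sqrt {a : ℝ → ℝ} {a' x : ℝ} (h : HasDerivAt a a' x) (ha : 0 < a x) :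
    HasDerivAt (fun x => (Real.sqrt (a x))⁻¹) (-(1 / 2) * a' * (Real.sqrt (a x))⁻¹ ^ 3) x := by
  refine ((h.sqrt ha.ne').inv (Real.sqrt_pos.2 ha).ne').congr_deriv ?_
  have := (Real.sqrt_pos.2 ha).ne'
  field_simp

lemma cutMode_eq_zero (n : ℕ) (ε : ℝ) {r u : ℝ} (hr : 0 < r) (hu : 3 / 4 * r ≤ |u|) :
    cutMode n ε r u = 0 := by
  rw [cutMode, cutoff_eq_zero, zero_mul]
  rwa [abs_div, abs_of_pos hr, le_div_iff₀ hr]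

lemma abs_cutMode_le (n : ℕ) (ε r u : ℝ) : |cutMode n ε r u| ≤ |oscillatorMode n ε u| := by
  rw [cutMode, abs_mul, abs_of_nonneg (cutoff_nonneg _)]
  exact mul_le_of_le_one_left (abs_nonneg _) (cutoff_le_one _)

lemma contDiff_cutMode (n : ℕ) (ε r : ℝ) : ContDiff ℝ ∞ (cutMode n ε r) :=
  (contDiff_cutoff.comp (contDiff_id.div_const r)).mul (contDiff_oscillatorMode n ε)

/-- The derivative of the localized oscillator mode. -/
def cutModeDeriv (n : ℕ) (ε r u : ℝ) : ℝ :=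
  deriv cutoff (u / r) / r * oscillatorMode n ε u + cutoff (u / r) * oscillatorDeriv n ε u

/-- The error term produced by the localization of the oscillator mode. -/
def cutModeError (n : ℕ) (ε r u : ℝ) : ℝ :=
  deriv (deriv cutoff) (u / r) / r ^ 2 * oscillatorMode n ε u +
    2 * (deriv cutoff (u / r) / r) * oscillatorDeriv n ε u

lemma hasDerivAt_cutMode (n : ℕ) {ε : ℝ} (hε : 0 < ε) (r u : ℝ) :
    HasDerivAt (cutMode n ε r) (cutModeDeriv n ε r u) u := by
  have h1 : HasDerivAt (fun u => cutoff (u / r)) (deriv cutoff (u / r) * (1 / r)) u :=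
    (hasDerivAt_cutoff (u / r)).comp u ((hasDerivAt_id u).div_const r)
  refine (h1.mul (hasDerivAt_oscillatorMode n hε u)).congr_deriv ?_
  rw [cutModeDeriv]
  ring

lemma hasDerivAt_cutModeDeriv (n : ℕ) {ε : ℝ} (hε : 0 < ε) (r u : ℝ) :
    HasDerivAt (cutModeDeriv n ε r)
      (cutModeError n ε r u + (u ^ 2 / ε ^ 2 - 2 * ((n + 1 / 2) / ε)) * cutMode n ε r u) u := by
  have h1 : HasDerivAt (fun u => cutoff (u / r)) (deriv cutoff (u / r) * (1 / r)) u :=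
    (hasDerivAt_cutoff (u / r)).comp u ((hasDerivAt_id u).div_const r)
  have h2 : HasDerivAt (fun u => deriv cutoff (u / r)) (deriv (deriv cutoff) (u / r) * (1 / r)) u :=
    HasDerivAt.comp (h₂ := deriv cutoff) u (hasDerivAt_deriv_cutoff (u / r)) ((hasDerivAt_id u).div_const r)
  refine (((h2.div_const r).mul (hasDerivAt_oscillatorMode n hε u)).add
    (h1.mul (hasDerivAt_oscillatorDeriv n hε u))).congr_deriv ?_
  rw [cutModeError, cutMode]
  ring

/-- The derivatives of the cutoff vanish for |z| < 1/2, so |χ'(z)| ≤ 4C z² and |χ''(z)| ≤ 2C|z| for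
all z. The localization error thereby acquires the same small weights as the curvature terms. -/
lemma exists_cutModeError_bound : ∃ C : ℝ, 1 ≤ C ∧ ∀ (n : ℕ) (ε r u : ℝ), 0 < r → r ≤ 1 →
    |cutModeError n ε r u| ≤
      C / r ^ 3 * (|u * oscillatorMode n ε u| + |u ^ 2 * oscillatorDeriv n ε u|) := by
  obtain ⟨C, hC, h1, h2⟩ := exists_bound_deriv_cutoff
  refine ⟨8 * C, by linarith, fun n ε r u hr hr1 => ?_⟩
  have b1 : ∀ z : ℝ, |deriv cutoff z| ≤ 4 * C * |z| ^ 2 := fun z => by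
    rcases lt_or_ge |z| (1 / 2) with hz | hz
    · rw [deriv_cutoff_eq_zero hz, abs_zero]; positivity
    · refine (h1 z).trans ?_
      nlinarith [mul_self_le_mul_self (by norm_num) hz]
  have b2 : ∀ z : ℝ, |deriv (deriv cutoff) z| ≤ 2 * C * |z| := fun z => by
    rcases lt_or_ge |z| (1 / 2) with hz | hz
    · rw [deriv_deriv_cutoff_eq_zero hz, abs_zero]; positivity
    · refine (h2 z).trans ?_
      nlinarith
  have hz : |u / r| = |u| / r := by rw [abs_div, abs_of_pos hr]
  have t1 : |deriv (deriv cutoff) (u / r) / r ^ 2 * oscillatorMode n ε u| ≤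
      8 * C / r ^ 3 * |u * oscillatorMode n ε u| := by
    rw [abs_mul, abs_mul, abs_div, abs_of_pos (pow_pos hr 2), ← mul_assoc]
    refine mul_le_mul_of_nonneg_right ?_ (abs_nonneg _)
    calc |deriv (deriv cutoff) (u / r)| / r ^ 2 ≤ 2 * C * |u / r| / r ^ 2 := by
          gcongr; exact b2 _
      _ = 2 * C / r ^ 3 * |u| := by rw [hz]; field_simp
      _ ≤ 8 * C / r ^ 3 * |u| := by gcongr; norm_num
  have t2 : |2 * (deriv cutoff (u / r) / r) * oscillatorDeriv n ε u| ≤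
      8 * C / r ^ 3 * |u ^ 2 * oscillatorDeriv n ε u| := by
    rw [abs_mul, abs_mul, abs_mul, abs_div, abs_of_pos hr, ← mul_assoc, abs_two]
    refine mul_le_mul_of_nonneg_right ?_ (abs_nonneg _)
    calc 2 * (|deriv cutoff (u / r)| / r) ≤ 2 * (4 * C * |u / r| ^ 2 / r) := by
          gcongr; exact b1 _
      _ = 8 * C / r ^ 3 * |u ^ 2| := by rw [hz, abs_pow]; field_simp; norm_num; ring
  rw [cutModeError, mul_add]
  exact (abs_add_le _ _).trans (add_le_add t1 t2)

variable {ϑ : ℝ} {k : ℝ → ℝ} {d r K : ℝ}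

lemma IsTubeWidth.half_le (h : IsTubeWidth ϑ k d r K) (s : ℝ) {u : ℝ} (hu : |u| ≤ r) :
    1 / 2 ≤ 1 + u * scaledCurvature ϑ k d s ∧ 1 + u * scaledCurvature ϑ k d s ≤ 3 / 2 := by
  have := abs_le.1 (h.half s u hu)
  constructor <;> linarith [this.1, this.2]

lemma IsTubeWidth.tubeWeight_sq (h : IsTubeWidth ϑ k d r K) (s : ℝ) {u : ℝ} (hu : |u| ≤ r) :
    tubeWeight ϑ k d s u ^ 2 * (1 + u * scaledCurvature ϑ k d s) = 1 := by
  have := (h.half_le s hu).1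
  rw [tubeWeight, inv_pow, Real.sq_sqrt (by linarith), inv_mul_cancel₀ (by linarith)]

lemma tubeWeight_nonneg (s u : ℝ) : 0 ≤ tubeWeight ϑ k d s u := inv_nonneg.2 (Real.sqrt_nonneg _)

lemma IsTubeWidth.tubeWeight_le (h : IsTubeWidth ϑ k d r K) (s : ℝ) {u : ℝ} (hu : |u| ≤ r) :
    tubeWeight ϑ k d s u ≤ 2 := by
  have h1 := h.tubeWeight_sq s hu
  have h2 := (h.half_le s hu).1
  have h3 := tubeWeight_nonneg (ϑ := ϑ) (k := k) (d := d) s u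
  nlinarith [sq_nonneg (tubeWeight ϑ k d s u)]

/-- With b the weight and x = uκ, the relation b²(1 + x) = 1 gives (b - 1)(b + 1) = -b²x, where b² ≤
2. -/
lemma IsTubeWidth.abs_tubeWeight_sub_one_le (h : IsTubeWidth ϑ k d r K) (s : ℝ) {u : ℝ}
    (hu : |u| ≤ r) : |tubeWeight ϑ k d s u - 1| ≤ 2 * |u * scaledCurvature ϑ k d s| := by
  have h1 := h.tubeWeight_sq s hu
  have h2 := (h.half_le s hu).1
  have h3 := tubeWeight_nonneg (ϑ := ϑ) (k := k) (d := d) s u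
  set b := tubeWeight ϑ k d s u
  set x := u * scaledCurvature ϑ k d s
  have h4 : (b - 1) * (b + 1) = -(b ^ 2) * x := by linear_combination h1
  have h5 : b ^ 2 ≤ 2 := by nlinarith [sq_nonneg b]
  calc |b - 1| ≤ |b - 1| * |b + 1| := by
        refine le_mul_of_one_le_right (abs_nonneg _) ?_
        rw [abs_of_nonneg (by linarith)]; linarith
    _ = b ^ 2 * |x| := by rw [← abs_mul, h4, abs_mul, abs_neg, abs_of_nonneg (sq_nonneg b)]
    _ ≤ 2 * |x| := by gcongr

end Weight

/-! ### The quasimode and the action of the Hamiltonian on it. -/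

section QuasimodeFunction

variable {ϑ : ℝ} {k : ℝ → ℝ} {d r K : ℝ}

/-- The quasimode `g(s) (1 + u κ(s))^{-1/2} χ(u) Φ(u)` in tubular coordinates. -/
def quasimode (ϑ : ℝ) (k : ℝ → ℝ) (d r : ℝ) (n : ℕ) (ε : ℝ) (g : ℝ → ℂ) (q : Plane) : ℂ :=
  g (tubularCoord ϑ k d q).1 *
    ((tubeWeight ϑ k d (tubularCoord ϑ k d q).1 (tubularCoord ϑ k d q).2 *
      cutMode n ε r (tubularCoord ϑ k d q).2 : ℝ) : ℂ)

lemma IsTubeWidth.quasimode_tubularMap (h : IsTubeWidth ϑ k d r K) (n : ℕ) (ε : ℝ) (g : ℝ → ℂ)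
    {s u : ℝ} (hu : |u| < r) : quasimode ϑ k d r n ε g (tubularMap ϑ k d (s, u)) =
      g s * ((tubeWeight ϑ k d s u * cutMode n ε r u : ℝ) : ℂ) := by
  rw [quasimode, h.coord (s, u) hu]

lemma IsTubeWidth.quasimode_eq_zero (h : IsTubeWidth ϑ k d r K) (n : ℕ) (ε : ℝ) (g : ℝ → ℂ)
    {q : Plane} (hq : 3 / 4 * r ≤ curveDist ϑ k d q) : quasimode ϑ k d r n ε g q = 0 := by
  have h1 := (tubularCoord_spec h.angle h.smooth h.supp h.int h.d_pos q).2
  rw [quasimode, cutMode_eq_zero n ε h.r_pos (by rw [h1]; exact hq), mul_zero, Complex.ofReal_zero,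
    mul_zero]

lemma IsTubeWidth.contDiffAt_weight (h : IsTubeWidth ϑ k d r K) {p : ℝ × ℝ} (hp : |p.2| ≤ r) :
    ContDiffAt ℝ ∞ (fun p : ℝ × ℝ => tubeWeight ϑ k d p.1 p.2) p := by
  have h1 := (h.half_le p.1 hp).1
  have h2 : ContDiff ℝ ∞ fun p : ℝ × ℝ => 1 + p.2 * scaledCurvature ϑ k d p.1 :=
    contDiff_const.add (contDiff_snd.mul ((contDiff_scaledCurvature h.smooth).comp contDiff_fst))
  have h3 : (0 : ℝ) < 1 + p.2 * scaledCurvature ϑ k d p.1 := by linarith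
  exact (h2.contDiffAt.sqrt h3.ne').inv (Real.sqrt_pos.2 h3).ne'

lemma IsTubeWidth.contDiffAt_tubularCoord' (h : IsTubeWidth ϑ k d r K) {q : Plane}
    (hq : curveDist ϑ k d q < r) : ContDiffAt ℝ ∞ (tubularCoord ϑ k d) q := by
  have h1 := tubularCoord_spec h.angle h.smooth h.supp h.int h.d_pos q
  have h2 : |(tubularCoord ϑ k d q).2| < r := by rw [h1.2]; exact hq
  have h3 := contDiffAt_tubularCoord h.smooth h.coord h2
    (by have := (h.half_le (tubularCoord ϑ k d q).1 h2.le).1; linarith)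
  rwa [h1.1] at h3

/-- The coordinates are smooth at distance less than `r`, and the cutoff makes the function vanish
at distance at least 3r/4, so it is smooth everywhere. Its support lies in the tubular image of a
compact rectangle. -/
lemma IsTubeWidth.isTestFunction_quasimode (h : IsTubeWidth ϑ k d r K) (n : ℕ) (ε : ℝ)
    {g : ℝ → ℂ} (hg : IsTestFunction univ g) :
    IsTestFunction (curveTube ϑ k d) (quasimode ϑ k d r n ε g) := by
  have hr := h.r_pos
  set S : Set Plane := tubularMap ϑ k d '' (tsupport g ×ˢ Icc (-(3 / 4 * r)) (3 / 4 * r)) with hS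
  have hSc : IsCompact S := (hg.compact.prod isCompact_Icc).image
    (contDiff_tubularMap h.smooth).continuous
  have hsupp : Function.support (quasimode ϑ k d r n ε g) ⊆ S := by
    intro q hq
    have h1 := tubularCoord_spec h.angle h.smooth h.supp h.int h.d_pos q
    have h2 : curveDist ϑ k d q < 3 / 4 * r := by
      by_contra hcon
      exact hq (h.quasimode_eq_zero n ε g (not_lt.1 hcon))
    refine ⟨tubularCoord ϑ k d q, ⟨subset_tsupport _ fun h0 => hq ?_, ?_⟩, h1.1⟩
    · rw [quasimode, h0, zero_mul]
    · rw [← h1.2] at h2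
      exact ⟨(abs_lt.1 h2).1.le, (abs_lt.1 h2).2.le⟩
  refine ⟨contDiff_iff_contDiffAt.2 fun q => ?_,
    HasCompactSupport.of_support_subset_isCompact hSc hsupp, ?_⟩
  · rcases lt_or_ge (curveDist ϑ k d q) r with hq | hq
    · have h1 := tubularCoord_spec h.angle h.smooth h.supp h.int h.d_pos q
      have hc := h.contDiffAt_tubularCoord' hq
      have h2 : |(tubularCoord ϑ k d q).2| ≤ r := by rw [h1.2]; exact hq.le
      have h3 : ContDiffAt ℝ ∞ (fun p : ℝ × ℝ => tubeWeight ϑ k d p.1 p.2 * cutMode n ε r p.2)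
          (tubularCoord ϑ k d q) :=
        (h.contDiffAt_weight h2).mul ((contDiff_cutMode n ε r).comp contDiff_snd).contDiffAt
      exact ((hg.smooth.comp contDiff_fst).contDiffAt.comp q hc).mul
        (Complex.ofRealCLM.contDiff.contDiffAt.comp q (h3.comp q hc))
    · have h0 : quasimode ϑ k d r n ε g =ᶠ[𝓝 q] fun _ => 0 := by
        filter_upwards [(isOpen_lt continuous_const (continuous_curveDist (ϑ := ϑ) (k := k)
          (d := d))).mem_nhds (show 3 / 4 * r < curveDist ϑ k d q by linarith)] with x hx
        exact h.quasimode_eq_zero n ε g (le_of_lt hx)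
      exact contDiffAt_const.congr_of_eventuallyEq h0
  · refine (closure_minimal hsupp hSc.isClosed).trans ?_
    rintro _ ⟨p, hp, rfl⟩
    have : |p.2| ≤ 3 / 4 * r := abs_le.2 ⟨hp.2.1, hp.2.2⟩
    exact ((curveDist_tubularMap_le p).trans this).trans_lt (by linarith [h.r_le])

/-- The error made by the quasimode, in tubular coordinates. -/
def quasimodeError (ϑ : ℝ) (k : ℝ → ℝ) (d r : ℝ) (n : ℕ) (ε : ℝ) (g : ℝ → ℂ) (s u : ℝ) : ℂ :=
  ((-(1 / 2) * tubeWeight ϑ k d s u * cutModeError n ε r u +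
    cutMode n ε r u * (scaledCurvature ϑ k d s ^ 2 / 8 * (tubeWeight ϑ k d s u ^ 5 *
      (u * scaledCurvature ϑ k d s * (2 + u * scaledCurvature ϑ k d s))) +
      1 / 4 * tubeWeight ϑ k d s u ^ 7 * (u * deriv (deriv (scaledCurvature ϑ k d)) s) -
      5 / 8 * tubeWeight ϑ k d s u ^ 9 * (u * deriv (scaledCurvature ϑ k d) s) ^ 2) : ℝ) : ℂ) * g s +
  ((cutMode n ε r u * (tubeWeight ϑ k d s u ^ 7 * (u * deriv (scaledCurvature ϑ k d) s)) : ℝ) : ℂ) *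
    deriv g s +
  ((1 / 2 * cutMode n ε r u * (tubeWeight ϑ k d s u ^ 5 *
      (u * scaledCurvature ϑ k d s * (2 + u * scaledCurvature ϑ k d s))) : ℝ) : ℂ) *
    deriv (deriv g) s

/-- The quasimode intertwines the Hamiltonians up to the error. -/
theorem IsTubeWidth.schrodinger_quasimode (h : IsTubeWidth ϑ k d r K) (n : ℕ) {ε : ℝ} (hε : 0 < ε)
    {g : ℝ → ℂ} (hg : IsTestFunction univ g) {s u : ℝ} (hu : |u| < r) :
    -(1 / 2 : ℂ) * Laplacian.laplacian (quasimode ϑ k d r n ε g) (tubularMap ϑ k d (s, u)) +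
        ((1 / ε ^ 2 * (1 / 2 * u ^ 2) : ℝ) : ℂ) *
          quasimode ϑ k d r n ε g (tubularMap ϑ k d (s, u)) =
      quasimode ϑ k d r n ε (fun s => -(1 / 2 : ℂ) * deriv (deriv g) s +
          ((-(scaledCurvature ϑ k d s ^ 2 / 8) : ℝ) : ℂ) * g s) (tubularMap ϑ k d (s, u)) +
        (((n + 1 / 2) / ε : ℝ) : ℂ) * quasimode ϑ k d r n ε g (tubularMap ϑ k d (s, u)) +
        quasimodeError ϑ k d r n ε g s u := by
  set κ := scaledCurvature ϑ k d with hκ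
  set b := tubeWeight ϑ k d with hb
  set m := cutMode n ε r with hm
  have hκs : ContDiff ℝ ∞ κ := contDiff_scaledCurvature h.smooth
  have hκ1 : ∀ x, HasDerivAt κ (deriv κ x) x := fun x =>
    (hκs.differentiable (by simp) x).hasDerivAt
  have hκ2 : ∀ x, HasDerivAt (deriv κ) (deriv (deriv κ) x) x := fun x =>
    ((contDiff_infty_iff_deriv.mp hκs).2.differentiable (by simp) x).hasDerivAt
  have hg1 : ∀ x, HasDerivAt g (deriv g x) x := fun x =>
    (hg.smooth.differentiable (by simp) x).hasDerivAt
  have hg2 : ∀ x, HasDerivAt (deriv g) (deriv (deriv g) x) x := fun x =>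
    ((contDiff_infty_iff_deriv.mp hg.smooth).2.differentiable (by simp) x).hasDerivAt
  have hpos : ∀ s' u', |u'| ≤ r → 0 < 1 + u' * κ s' := fun s' u' hu' => by
    have := (h.half_le s' hu').1; linarith
  have bs : ∀ x, HasDerivAt (fun x => b x u) (-(1 / 2) * (u * deriv κ x) * b x u ^ 3) x := fun x =>
    (((hκ1 x).const_mul u).const_add 1).inv_sqrt (hpos x u hu.le)
  have bu : ∀ x, |x| ≤ r → HasDerivAt (fun x => b s x) (-(1 / 2) * κ s * b s x ^ 3) x :=
    fun x hx => by
      have := (((hasDerivAt_id x).mul_const (κ s)).const_add 1).inv_sqrt (hpos s x hx)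
      rw [one_mul] at this
      exact this
  have bss : HasDerivAt (fun x => -(1 / 2) * (u * deriv κ x) * b x u ^ 3)
      (-(1 / 2) * (u * deriv (deriv κ) s) * b s u ^ 3 +
        3 / 4 * (u * deriv κ s) ^ 2 * b s u ^ 5) s := by
    refine ((((hκ2 s).const_mul u).const_mul (-(1 / 2))).mul ((bs s).pow 3)).congr_deriv ?_
    simp only [Nat.cast_ofNat, Pi.pow_apply]
    ring
  have buu : HasDerivAt (fun x => -(1 / 2) * κ s * b s x ^ 3) (3 / 4 * κ s ^ 2 * b s u ^ 5) u := by
    refine (((bu u hu.le).pow 3).const_mul (-(1 / 2) * κ s)).congr_deriv ?_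
    simp only [Nat.cast_ofNat]
    ring
  have hm1 := hasDerivAt_cutMode n hε r
  have hm2 := hasDerivAt_cutModeDeriv n hε r u
  have hb2 := h.tubeWeight_sq s hu.le
  set Gs : ℝ → ℂ := fun x => deriv g x * ((b x u * m u : ℝ) : ℂ) +
    g x * ((-(1 / 2) * (u * deriv κ x) * b x u ^ 3 * m u : ℝ) : ℂ) with hGs
  set Gu : ℝ → ℂ := fun x => g s * ((-(1 / 2) * κ s * b s x ^ 3 * m x +
    b s x * cutModeDeriv n ε r x : ℝ) : ℂ) with hGu
  have hnear : ∀ᶠ x in 𝓝 u, |x| < r :=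
    (isOpen_lt continuous_abs continuous_const).mem_nhds hu
  have h1 : ∀ᶠ x in 𝓝 s, HasDerivAt
      (fun x => quasimode ϑ k d r n ε g (tubularMap ϑ k d (x, u))) (Gs x) x := by
    refine .of_forall fun x => ?_
    have e : (fun x => quasimode ϑ k d r n ε g (tubularMap ϑ k d (x, u))) =
        fun x => g x * ((b x u * m u : ℝ) : ℂ) := funext fun x => h.quasimode_tubularMap n ε g hu
    rw [e]
    exact (hg1 x).mul ((bs x).mul_const (m u)).ofReal_comp
  have h1' : HasDerivAt Gs (deriv (deriv g) s * ((b s u * m u : ℝ) : ℂ) +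
      2 * (deriv g s * ((-(1 / 2) * (u * deriv κ s) * b s u ^ 3 * m u : ℝ) : ℂ)) +
      g s * (((-(1 / 2) * (u * deriv (deriv κ) s) * b s u ^ 3 +
        3 / 4 * (u * deriv κ s) ^ 2 * b s u ^ 5) * m u : ℝ) : ℂ)) s := by
    refine (((hg2 s).mul ((bs s).mul_const (m u)).ofReal_comp).add
      ((hg1 s).mul (bss.mul_const (m u)).ofReal_comp)).congr_deriv ?_
    ring
  have h2 : ∀ᶠ x in 𝓝 u, HasDerivAt
      (fun x => quasimode ϑ k d r n ε g (tubularMap ϑ k d (s, x))) (Gu x) x := by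
    filter_upwards [hnear.eventually_nhds, hnear] with x hx hx'
    have e : (fun x => quasimode ϑ k d r n ε g (tubularMap ϑ k d (s, x))) =ᶠ[𝓝 x]
        fun x => g s * ((b s x * m x : ℝ) : ℂ) := by
      filter_upwards [hx] with y hy using h.quasimode_tubularMap n ε g hy
    exact ((((bu x hx'.le).mul (hm1 x)).ofReal_comp).const_mul (g s)).congr_of_eventuallyEq e
  have h2' : HasDerivAt Gu (g s * ((3 / 4 * κ s ^ 2 * b s u ^ 5 * m u +
      2 * (-(1 / 2) * κ s * b s u ^ 3 * cutModeDeriv n ε r u) + b s u * (cutModeError n ε r u +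
        (u ^ 2 / ε ^ 2 - 2 * ((n + 1 / 2) / ε)) * m u) : ℝ) : ℂ)) u := by
    refine ((((buu.mul (hm1 u)).add ((bu u hu.le).mul hm2)).ofReal_comp).const_mul
      (g s)).congr_deriv ?_
    congr 2
    ring
  have hlap := laplacian_tubularMap h.smooth
    (h.isTestFunction_quasimode n ε hg).contDiff_two (hκ1 s) (hpos s u hu.le).ne' h1 h1' h2 h2'
  have hinv : ((1 + u * scaledCurvature ϑ k d s : ℝ) : ℂ)⁻¹ = ((b s u ^ 2 : ℝ) : ℂ) := by
    rw [← Complex.ofReal_inv, ← eq_inv_of_mul_eq_one_left hb2]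
  rw [hlap, hinv, h.quasimode_tubularMap n ε g hu, h.quasimode_tubularMap n ε _ hu, quasimodeError]
  simp only [hGs, hGu]
  -- Modulo this relation the claim is polynomial. The terms with the derivative of the mode cancel,
  -- as 2·(-½κb³) + κb²·b = 0. The second normal derivative and the first-order term leave (3/4 -
  -- 1/2)κ²b⁵, which after the factor -½ is -κ²/8 times b⁵; the difference between b⁵ and b is of
  -- order `u`.
  have hb2c : (b s u : ℂ) ^ 2 * (1 + u * κ s) = 1 := by exact_mod_cast hb2
  rw [← hκ, ← hb, ← hm]
  push_cast
  linear_combination (-(1 / 2) * κ s * b s u ^ 2 * (g s * (-(1 / 2) * κ s * b s u ^ 3 * m u +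
      b s u * cutModeDeriv n ε r u)) - κ s ^ 2 / 8 * m u * g s * b s u *
      (b s u ^ 2 * (1 + u * κ s) + 1) - 1 / 2 * m u * deriv (deriv g) s * b s u *
      (b s u ^ 2 * (1 + u * κ s) + 1)) * hb2c

end QuasimodeFunction

/-! ### Pointwise bound on the quasimode error. -/

section QuasimodeEstimate

variable {ϑ : ℝ} {k : ℝ → ℝ} {d r K : ℝ}

/-- The weight that controls the error of the quasimode across the curve. -/
def errorMode (n : ℕ) (ε u : ℝ) : ℝ := |u * oscillatorMode n ε u| + |u ^ 2 * oscillatorDeriv n ε u|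

lemma measurable_errorMode (n : ℕ) (ε : ℝ) : Measurable (errorMode n ε) := by
  have h1 := (contDiff_oscillatorMode n ε).continuous
  have h2 := continuous_oscillatorDeriv n ε
  unfold errorMode
  exact Continuous.measurable (by fun_prop)

/-- Every curvature term contains a factor `u`, absorbed by `errorMode`, and its coefficient is at
most of order r^(-3), the size of κ'' and κ³. The localization term is covered by
`exists_cutModeError_bound`. -/
theorem exists_quasimodeError_bound (K : ℝ) : ∃ C : ℝ, 1 ≤ C ∧ ∀ (ϑ : ℝ) (k : ℝ → ℝ) (d r : ℝ),
    IsTubeWidth ϑ k d r K → ∀ (n : ℕ) (ε : ℝ) (g : ℝ → ℂ) (s u : ℝ), |u| < r →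
      ‖quasimodeError ϑ k d r n ε g s u‖ ≤
        C / r ^ 3 * (‖g s‖ + ‖deriv g s‖ + ‖deriv (deriv g) s‖) * errorMode n ε u := by
  obtain ⟨C₀, hC₀, hE⟩ := exists_cutModeError_bound
  refine ⟨C₀ + 1000 * |K| ^ 3, by linarith [pow_nonneg (abs_nonneg K) 3], fun ϑ k d r h n ε g s u hu => ?_⟩
  have hr := h.r_pos
  have hr1 : r ≤ 1 := h.r_le.trans h.d_le
  have hK := h.one_le
  rw [abs_of_nonneg (by linarith : 0 ≤ K)]
  set κ := scaledCurvature ϑ k d with hκdef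
  set b := tubeWeight ϑ k d s u with hb
  set m := cutMode n ε r u with hm
  set w := errorMode n ε u with hw
  set Q := K / r with hQ
  have hQ1 : 1 ≤ Q := by rw [hQ, le_div_iff₀ hr]; linarith
  have hw0 : 0 ≤ w := add_nonneg (abs_nonneg _) (abs_nonneg _)
  have hb0 : |b| ≤ 2 := by
    rw [abs_of_nonneg (tubeWeight_nonneg s u)]; exact h.tubeWeight_le s hu.le
  have hmu : |m * u| ≤ w := by
    rw [abs_mul, mul_comm]
    refine (mul_le_mul_of_nonneg_left (abs_cutMode_le n ε r u) (abs_nonneg u)).trans ?_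
    rw [← abs_mul]
    exact le_add_of_nonneg_right (abs_nonneg _)
  have hκ : |κ s| ≤ Q := h.curv s
  have hκ' : |deriv κ s| ≤ Q ^ 2 := (h.curv_deriv s).trans (by
    rw [hQ, div_pow]; gcongr; exact le_self_pow₀ hK (by norm_num))
  have hκ'' : |deriv (deriv κ) s| ≤ Q ^ 3 := (h.curv_deriv2 s).trans (by
    rw [hQ, div_pow]; gcongr; exact le_self_pow₀ hK (by norm_num))
  -- The square of uκ' alone would cost r^(-4); its second factor |u| ≤ r recovers one power.
  have hκ2 : |u| * |deriv κ s| ^ 2 ≤ Q ^ 3 := by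
    have h1 := h.curv_deriv s
    calc |u| * |deriv κ s| ^ 2 ≤ r * (K / r ^ 2) ^ 2 := by gcongr
      _ = K ^ 2 / r ^ 3 := by field_simp
      _ ≤ K ^ 3 / r ^ 3 := by gcongr; norm_num
      _ = Q ^ 3 := by rw [hQ, div_pow]
  have hp : |2 + u * κ s| ≤ 5 / 2 := by
    have := (h.half_le s hu.le)
    rw [abs_of_nonneg] <;> linarith [this.1, this.2]
  have hQ12 : Q ≤ Q ^ 3 := le_self_pow₀ hQ1 (by norm_num)
  have hQ23 : Q ^ 2 ≤ Q ^ 3 := pow_le_pow_right₀ hQ1 (by norm_num)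
  -- The number 1000 is a generous bound for the numerical factors below: 40, 128 and 10 + 32 + 320.
  have hfin : ∀ c : ℝ, c ≤ 1000 → w * (c * Q ^ 3) ≤ (C₀ + 1000 * K ^ 3) / r ^ 3 * w := by
    intro c hc
    have : c * Q ^ 3 ≤ (C₀ + 1000 * K ^ 3) / r ^ 3 := by
      rw [hQ, div_pow, ← mul_div_assoc]
      gcongr
      nlinarith [pow_pos (by linarith : 0 < K) 3]
    calc w * (c * Q ^ 3) ≤ w * ((C₀ + 1000 * K ^ 3) / r ^ 3) := by gcongr
      _ = _ := mul_comm _ _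
  have a2 : |1 / 2 * m * (b ^ 5 * (u * κ s * (2 + u * κ s)))| ≤
      (C₀ + 1000 * K ^ 3) / r ^ 3 * w := by
    rw [show 1 / 2 * m * (b ^ 5 * (u * κ s * (2 + u * κ s))) =
      m * u * (b ^ 5 * κ s * (2 + u * κ s) * (1 / 2)) by ring]
    refine le_trans ?_ (hfin 40 (by norm_num))
    rw [abs_mul (m * u), abs_mul _ (1 / 2 : ℝ), abs_mul _ (2 + _), abs_mul (b ^ 5), abs_pow]
    calc |m * u| * (|b| ^ 5 * |κ s| * |2 + u * κ s| * |(1 / 2 : ℝ)|)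
        ≤ w * (2 ^ 5 * Q ^ 3 * (5 / 2) * |(1 / 2 : ℝ)|) := by
          gcongr; exact hκ.trans hQ12
      _ = w * (40 * Q ^ 3) := by rw [abs_of_pos (by norm_num : (0 : ℝ) < 1 / 2)]; ring
  have a1 : |m * (b ^ 7 * (u * deriv κ s))| ≤ (C₀ + 1000 * K ^ 3) / r ^ 3 * w := by
    rw [show m * (b ^ 7 * (u * deriv κ s)) = m * u * (b ^ 7 * deriv κ s) by ring]
    refine le_trans ?_ (hfin 128 (by norm_num))
    rw [abs_mul (m * u), abs_mul (b ^ 7), abs_pow]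
    calc |m * u| * (|b| ^ 7 * |deriv κ s|) ≤ w * (2 ^ 7 * Q ^ 3) := by
          gcongr; exact hκ'.trans hQ23
      _ = _ := by norm_num
  have a0 : |-(1 / 2) * b * cutModeError n ε r u + m * (κ s ^ 2 / 8 * (b ^ 5 *
      (u * κ s * (2 + u * κ s))) + 1 / 4 * b ^ 7 * (u * deriv (deriv κ) s) -
      5 / 8 * b ^ 9 * (u * deriv κ s) ^ 2)| ≤ (C₀ + 1000 * K ^ 3) / r ^ 3 * w := by
    have t1 : |-(1 / 2) * b * cutModeError n ε r u| ≤ C₀ / r ^ 3 * w := by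
      have h1 := hE n ε r u hr hr1
      rw [abs_mul]
      calc |-(1 / 2) * b| * |cutModeError n ε r u| ≤ 1 * (C₀ / r ^ 3 * w) := by
            gcongr
            · rw [abs_mul, abs_neg, abs_of_pos (by norm_num : (0 : ℝ) < 1 / 2)]; linarith
            · exact h1
        _ = _ := one_mul _
    have t2 : |m * (κ s ^ 2 / 8 * (b ^ 5 * (u * κ s * (2 + u * κ s))))| ≤ w * (10 * Q ^ 3) := by
      rw [show m * (κ s ^ 2 / 8 * (b ^ 5 * (u * κ s * (2 + u * κ s)))) =
        m * u * (κ s ^ 3 * b ^ 5 * (2 + u * κ s) * (1 / 8)) by ring]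
      rw [abs_mul (m * u), abs_mul _ (1 / 8 : ℝ), abs_mul _ (2 + _), abs_mul (κ s ^ 3), abs_pow,
        abs_pow]
      calc |m * u| * (|κ s| ^ 3 * |b| ^ 5 * |2 + u * κ s| * |(1 / 8 : ℝ)|)
          ≤ w * (Q ^ 3 * 2 ^ 5 * (5 / 2) * |(1 / 8 : ℝ)|) := by gcongr
        _ = w * (10 * Q ^ 3) := by rw [abs_of_pos (by norm_num : (0 : ℝ) < 1 / 8)]; ring
    have t3 : |m * (1 / 4 * b ^ 7 * (u * deriv (deriv κ) s))| ≤ w * (32 * Q ^ 3) := by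
      rw [show m * (1 / 4 * b ^ 7 * (u * deriv (deriv κ) s)) =
        m * u * (b ^ 7 * deriv (deriv κ) s * (1 / 4)) by ring]
      rw [abs_mul (m * u), abs_mul _ (1 / 4 : ℝ), abs_mul (b ^ 7), abs_pow]
      calc |m * u| * (|b| ^ 7 * |deriv (deriv κ) s| * |(1 / 4 : ℝ)|)
          ≤ w * (2 ^ 7 * Q ^ 3 * |(1 / 4 : ℝ)|) := by gcongr
        _ = w * (32 * Q ^ 3) := by rw [abs_of_pos (by norm_num : (0 : ℝ) < 1 / 4)]; ring
    have t4 : |m * (5 / 8 * b ^ 9 * (u * deriv κ s) ^ 2)| ≤ w * (320 * Q ^ 3) := by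
      rw [show m * (5 / 8 * b ^ 9 * (u * deriv κ s) ^ 2) =
        m * u * (b ^ 9 * (u * deriv κ s ^ 2) * (5 / 8)) by ring]
      rw [abs_mul (m * u), abs_mul _ (5 / 8 : ℝ), abs_mul (b ^ 9), abs_pow, abs_mul u, abs_pow]
      calc |m * u| * (|b| ^ 9 * (|u| * |deriv κ s| ^ 2) * |(5 / 8 : ℝ)|)
          ≤ w * (2 ^ 9 * Q ^ 3 * |(5 / 8 : ℝ)|) := by gcongr
        _ = w * (320 * Q ^ 3) := by rw [abs_of_pos (by norm_num : (0 : ℝ) < 5 / 8)]; ring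
    rw [mul_sub, mul_add]
    calc _ ≤ C₀ / r ^ 3 * w + ((w * (10 * Q ^ 3) + w * (32 * Q ^ 3)) + w * (320 * Q ^ 3)) :=
          (abs_add_le _ _).trans (add_le_add t1 ((abs_sub _ _).trans (add_le_add
            ((abs_add_le _ _).trans (add_le_add t2 t3)) t4)))
      _ ≤ C₀ / r ^ 3 * w + w * (1000 * Q ^ 3) := by
          nlinarith [mul_nonneg hw0 (pow_nonneg (by linarith : 0 ≤ Q) 3)]
      _ = _ := by rw [hQ, div_pow]; ring
  rw [quasimodeError]
  refine (norm_add₃_le).trans ?_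
  rw [norm_mul, norm_mul, norm_mul, Complex.norm_real, Complex.norm_real, Complex.norm_real,
    Real.norm_eq_abs, Real.norm_eq_abs, Real.norm_eq_abs]
  calc _ ≤ (C₀ + 1000 * K ^ 3) / r ^ 3 * w * ‖g s‖ + (C₀ + 1000 * K ^ 3) / r ^ 3 * w * ‖deriv g s‖ +
        (C₀ + 1000 * K ^ 3) / r ^ 3 * w * ‖deriv (deriv g) s‖ := by gcongr
    _ = _ := by ring

end QuasimodeEstimate

/-! ### Interpolation of the first derivative. -/

section DerivativeNorms

lemma ofReal_norm_toL2 {X : Type*} [MeasureSpace X] {Ω : Set X} {g : X → ℂ}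
    (hg : MemLp g 2 ((volume : Measure X).restrict Ω)) :
    ENNReal.ofReal ‖toL2 Ω g‖ = eLpNorm g 2 ((volume : Measure X).restrict Ω) := by
  rw [toL2_of_memLp hg, Lp.norm_toLp, ENNReal.ofReal_toReal hg.eLpNorm_ne_top]

lemma IsTestFunction.deriv {Ω : Set ℝ} {φ : ℝ → ℂ} (hφ : IsTestFunction Ω φ) :
    IsTestFunction Ω (deriv φ) :=
  hφ.fderiv_apply 1

/-- Integration by parts and the Cauchy–Schwarz inequality give ‖φ'‖² ≤ ‖φ‖ ‖φ''‖. -/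
lemma norm_toL2_deriv_le {φ : ℝ → ℂ} (hφ : IsTestFunction univ φ) :
    ‖toL2 univ (deriv φ)‖ ≤ ‖toL2 univ φ‖ + ‖toL2 univ (deriv (deriv φ))‖ := by
  have h1 : inner ℂ (toL2 univ (deriv φ)) (toL2 univ (deriv φ)) =
      -inner ℂ (toL2 univ φ) (toL2 univ (deriv (deriv φ))) := by
    have e1 := inner_toL2_conj (χ := fun x => star (deriv φ x)) hφ.deriv.star.memLp
      (toL2 univ (deriv φ))
    have e2 := inner_toL2_conj (χ := fun x => star (φ x)) hφ.star.memLp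
      (toL2 univ (deriv (deriv φ)))
    simp only [star_star] at e1 e2
    have e3 := hφ.star.integral_fderiv_mul hφ.deriv 1
    have i1 : ∫ x in univ, star (deriv φ x) * toL2 univ (deriv φ) x =
        ∫ x in univ, star (deriv φ x) * deriv φ x := by
      refine integral_congr_ae ?_
      filter_upwards [coeFn_toL2 hφ.deriv.memLp] with x hx
      rw [hx]
    have i2 : ∫ x in univ, star (φ x) * toL2 univ (deriv (deriv φ)) x =
        ∫ x in univ, star (φ x) * deriv (deriv φ) x := by
      refine integral_congr_ae ?_
      filter_upwards [coeFn_toL2 hφ.deriv.deriv.memLp] with x hx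
      rw [hx]
    refine e1.trans (i1.trans ?_)
    refine Eq.trans ?_ (congrArg Neg.neg (e2.trans i2)).symm
    refine Eq.trans ?_ (congrArg Neg.neg e3).symm
    rw [neg_neg]
    refine integral_congr_ae (.of_forall fun x => ?_)
    simp only
    rw [hφ.fderiv_star]
    rfl
  have h2 : ‖toL2 univ (deriv φ)‖ ^ 2 ≤
      ‖toL2 univ φ‖ * ‖toL2 univ (deriv (deriv φ))‖ := by
    have := norm_inner_le_norm (𝕜 := ℂ) (toL2 univ φ) (toL2 univ (deriv (deriv φ)))
    rwa [← norm_neg, ← h1, inner_self_eq_norm_sq_to_K, norm_pow, RCLike.norm_ofReal, abs_norm]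
      at this
  refine abs_le_of_sq_le_sq' ?_ (by positivity) |>.2
  nlinarith [norm_nonneg (toL2 univ φ), norm_nonneg (toL2 univ (deriv (deriv φ)))]

end DerivativeNorms

/-! ### The quasimode as a bounded operator between L² spaces. -/

section QuasimodeMap

variable {ϑ : ℝ} {k : ℝ → ℝ} {d r K : ℝ}

lemma IsTubeWidth.eLpNorm_le (h : IsTubeWidth ϑ k d r K) {Z : Plane → ℂ} {P m : ℝ → ℝ}
    (hP : Measurable P) (hm : Measurable m) (hZ : ∀ q ∈ curveTube ϑ k d,
      ‖Z q‖ ≤ P (tubularCoord ϑ k d q).1 * m (tubularCoord ϑ k d q).2) :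
    eLpNorm Z 2 ((volume : Measure Plane).restrict (curveTube ϑ k d)) ≤
      ENNReal.ofReal (1 + K) * (eLpNorm P 2 volume * eLpNorm m 2 volume) :=
  eLpNorm_tube_le h.angle h.smooth h.supp h.int h.d_pos (by linarith [h.one_le]) h.area hP hm hZ

/-- The chosen coordinates are regular only at distance less than `r`. Elsewhere they are replaced
by the constant `(0, r)`, at which the cutoff vanishes, without changing the quasimode. -/
lemma IsTubeWidth.measurable_quasimode (h : IsTubeWidth ϑ k d r K) (n : ℕ) (ε : ℝ) {g : ℝ → ℂ}
    (hg : Measurable g) : Measurable (quasimode ϑ k d r n ε g) := by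
  classical
  have hO : IsOpen {q | curveDist ϑ k d q < r} := isOpen_lt continuous_curveDist continuous_const
  set c : Plane → ℝ × ℝ := {q | curveDist ϑ k d q < r}.piecewise (tubularCoord ϑ k d)
    fun _ => (0, r) with hc
  have hcm : Measurable c := ContinuousOn.measurable_piecewise
    (fun q hq => (h.contDiffAt_tubularCoord' hq).continuousAt.continuousWithinAt)
    continuousOn_const hO.measurableSet
  have hκ : Measurable (scaledCurvature ϑ k d) :=
    (contDiff_scaledCurvature h.smooth).continuous.measurable
  have hG : Measurable fun p : ℝ × ℝ =>
      g p.1 * ((tubeWeight ϑ k d p.1 p.2 * cutMode n ε r p.2 : ℝ) : ℂ) := by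
    have h1 : Measurable (cutMode n ε r) := (contDiff_cutMode n ε r).continuous.measurable
    unfold tubeWeight
    fun_prop
  have e : quasimode ϑ k d r n ε g = (fun p : ℝ × ℝ =>
      g p.1 * ((tubeWeight ϑ k d p.1 p.2 * cutMode n ε r p.2 : ℝ) : ℂ)) ∘ c := by
    ext q
    by_cases hq : curveDist ϑ k d q < r
    · have : c q = tubularCoord ϑ k d q := piecewise_eq_of_mem _ _ _ hq
      rw [Function.comp_apply, this, quasimode]
    · have : c q = (0, r) := piecewise_eq_of_notMem _ _ _ hq
      rw [Function.comp_apply, this, h.quasimode_eq_zero n ε g (by linarith [h.r_pos])]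
      simp only
      rw [cutMode_eq_zero n ε h.r_pos (by rw [abs_of_pos h.r_pos]; linarith [h.r_pos])]
      simp
  rw [e]
  exact hG.comp hcm

lemma IsTubeWidth.norm_quasimode_le (h : IsTubeWidth ϑ k d r K) (n : ℕ) (ε : ℝ) (g : ℝ → ℂ)
    (q : Plane) : ‖quasimode ϑ k d r n ε g q‖ ≤
      ‖g (tubularCoord ϑ k d q).1‖ * (2 * |oscillatorMode n ε (tubularCoord ϑ k d q).2|) := by
  rcases le_or_gt |(tubularCoord ϑ k d q).2| r with hu | hu
  · rw [quasimode, norm_mul, Complex.norm_real, Real.norm_eq_abs, abs_mul,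
      abs_of_nonneg (tubeWeight_nonneg _ _)]
    exact mul_le_mul_of_nonneg_left (mul_le_mul (h.tubeWeight_le _ hu) (abs_cutMode_le _ _ _ _)
      (abs_nonneg _) zero_le_two) (norm_nonneg _)
  · rw [quasimode, cutMode_eq_zero n ε h.r_pos (by linarith [h.r_pos])]
    simp only [mul_zero, Complex.ofReal_zero, norm_zero]
    positivity

lemma IsTubeWidth.eLpNorm_quasimode_le (h : IsTubeWidth ϑ k d r K) {n : ℕ} {ε C : ℝ}
    (hC : eLpNorm (oscillatorMode n ε) 2 volume ≤ ENNReal.ofReal C) {g : ℝ → ℂ}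
    (hg : Measurable g) :
    eLpNorm (quasimode ϑ k d r n ε g) 2 ((volume : Measure Plane).restrict (curveTube ϑ k d)) ≤
      ENNReal.ofReal ((1 + K) * (2 * C)) * eLpNorm g 2 volume := by
  have hK := h.one_le
  have h1 := (contDiff_oscillatorMode n ε).continuous.measurable
  refine (h.eLpNorm_le (P := fun s => ‖g s‖) (m := fun u => 2 * |oscillatorMode n ε u|)
    hg.norm (by fun_prop) fun q _ => h.norm_quasimode_le n ε g q).trans ?_
  rw [eLpNorm_norm]
  have h2 : eLpNorm (fun u => 2 * |oscillatorMode n ε u|) 2 volume ≤ ENNReal.ofReal (2 * C) := by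
    have e : (fun u => 2 * |oscillatorMode n ε u|) = (2 : ℝ) • fun u => ‖oscillatorMode n ε u‖ := rfl
    rw [e, eLpNorm_const_smul, eLpNorm_norm, Real.enorm_eq_ofReal (by norm_num),
      ENNReal.ofReal_mul (by norm_num)]
    gcongr
  calc ENNReal.ofReal (1 + K) * (eLpNorm g 2 volume *
        eLpNorm (fun u => 2 * |oscillatorMode n ε u|) 2 volume)
      ≤ ENNReal.ofReal (1 + K) * (eLpNorm g 2 volume * ENNReal.ofReal (2 * C)) := by gcongr
    _ = _ := by rw [ENNReal.ofReal_mul (by linarith : (0 : ℝ) ≤ 1 + K)]; ring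

lemma IsTubeWidth.memLp_quasimode (h : IsTubeWidth ϑ k d r K) (n : ℕ) {ε : ℝ} (hε : 0 < ε)
    {g : ℝ → ℂ} (hg : Measurable g) (hg2 : MemLp g 2 volume) :
    MemLp (quasimode ϑ k d r n ε g) 2 ((volume : Measure Plane).restrict (curveTube ϑ k d)) := by
  obtain ⟨C, hC, H⟩ := exists_oscillator_bound n
  refine ⟨(h.measurable_quasimode n ε hg).aestronglyMeasurable,
    (h.eLpNorm_quasimode_le (H ε hε).1 hg).trans_lt ?_⟩
  exact ENNReal.mul_lt_top ENNReal.ofReal_lt_top hg2.eLpNorm_lt_top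

lemma quasimode_add (n : ℕ) (ε : ℝ) (g g' : ℝ → ℂ) : quasimode ϑ k d r n ε (g + g') =
    quasimode ϑ k d r n ε g + quasimode ϑ k d r n ε g' := by
  ext q; simp only [quasimode, Pi.add_apply]; ring

lemma quasimode_smul (n : ℕ) (ε : ℝ) (c : ℂ) (g : ℝ → ℂ) : quasimode ϑ k d r n ε (c • g) =
    c • quasimode ϑ k d r n ε g := by
  ext q; simp only [quasimode, Pi.smul_apply, smul_eq_mul]; ring

/-- The L² bound applied to the difference makes its norm zero, so no separate discussion of
preimages of null sets is needed. -/
lemma IsTubeWidth.quasimode_congr_ae (h : IsTubeWidth ϑ k d r K) (n : ℕ) {ε : ℝ} (hε : 0 < ε)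
    {g g' : ℝ → ℂ} (hg : Measurable g) (hg' : Measurable g') (hgg : g =ᵐ[volume] g') :
    quasimode ϑ k d r n ε g =ᵐ[(volume : Measure Plane).restrict (curveTube ϑ k d)]
      quasimode ϑ k d r n ε g' := by
  obtain ⟨C, hC, H⟩ := exists_oscillator_bound n
  have h1 := h.eLpNorm_quasimode_le (H ε hε).1 (g := g + (-1 : ℂ) • g') (hg.add (hg'.const_smul _))
  have h2 : eLpNorm (g + (-1 : ℂ) • g') 2 volume = 0 := by
    rw [eLpNorm_eq_zero_iff (hg.add (hg'.const_smul _)).aestronglyMeasurable (by norm_num)]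
    filter_upwards [hgg] with x hx
    simp [hx]
  rw [h2, mul_zero, nonpos_iff_eq_zero, eLpNorm_eq_zero_iff
    (h.measurable_quasimode n ε (hg.add (hg'.const_smul _))).aestronglyMeasurable (by norm_num),
    quasimode_add, quasimode_smul] at h1
  filter_upwards [h1] with q hq
  have : quasimode ϑ k d r n ε g q + -1 * quasimode ϑ k d r n ε g' q = 0 := hq
  linear_combination this

/-- The quasimode as a bounded map from `L²(ℝ)` to `L²` of the tube. -/
def quasimodeMap (h : IsTubeWidth ϑ k d r K) (n : ℕ) {ε : ℝ} (hε : 0 < ε) :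
    Lp ℂ 2 ((volume : Measure ℝ).restrict univ) →L[ℂ]
      Lp ℂ 2 ((volume : Measure Plane).restrict (curveTube ϑ k d)) :=
  have hm : ∀ g : Lp ℂ 2 ((volume : Measure ℝ).restrict univ), Measurable g := fun g =>
    (Lp.stronglyMeasurable g).measurable
  have hL : ∀ g : Lp ℂ 2 ((volume : Measure ℝ).restrict univ), MemLp g 2 volume := fun g => by
    simpa using Lp.memLp g
  LinearMap.mkContinuous
    { toFun := fun g => toL2 (curveTube ϑ k d) (quasimode ϑ k d r n ε g)
      map_add' := fun g g' => by
        rw [← toL2_add (h.memLp_quasimode n hε (hm g) (hL g))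
          (h.memLp_quasimode n hε (hm g') (hL g')), ← quasimode_add]
        refine toL2_congr (h.memLp_quasimode n hε (hm _) (hL _)) (h.quasimode_congr_ae n hε (hm _)
          ((hm g).add (hm g')) ?_)
        simpa using Lp.coeFn_add g g'
      map_smul' := fun c g => by
        rw [RingHom.id_apply, ← toL2_smul c (h.memLp_quasimode n hε (hm g) (hL g)),
          ← quasimode_smul]
        refine toL2_congr (h.memLp_quasimode n hε (hm _) (hL _)) (h.quasimode_congr_ae n hε (hm _)
          ((hm g).const_smul c) ?_)
        simpa using Lp.coeFn_smul c g }
    ((1 + K) * (2 * (exists_oscillator_bound n).choose)) fun g => by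
      have hC := (exists_oscillator_bound n).choose_spec
      have hK := h.one_le
      have hC0 : 0 ≤ (1 + K) * (2 * (exists_oscillator_bound n).choose) :=
        mul_nonneg (by linarith) (by linarith [hC.1])
      refine norm_toL2_le_of_eLpNorm_le (mul_nonneg hC0 (norm_nonneg _)) ?_
      refine (h.eLpNorm_quasimode_le (hC.2 ε hε).1 (hm g)).trans ?_
      rw [ENNReal.ofReal_mul hC0]
      gcongr
      have := ofReal_norm_toL2 (Lp.memLp g)
      rw [toL2_coeFn] at this
      rw [this]
      exact (congrArg (fun μ => eLpNorm (⇑g) 2 μ) Measure.restrict_univ.symm).le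

lemma quasimodeMap_apply (h : IsTubeWidth ϑ k d r K) (n : ℕ) {ε : ℝ} (hε : 0 < ε)
    (g : Lp ℂ 2 ((volume : Measure ℝ).restrict univ)) :
    quasimodeMap h n hε g = toL2 (curveTube ϑ k d) (quasimode ϑ k d r n ε g) := rfl

lemma quasimodeMap_toL2 (h : IsTubeWidth ϑ k d r K) (n : ℕ) {ε : ℝ} (hε : 0 < ε) {g : ℝ → ℂ}
    (hg : Measurable g) (hg2 : MemLp g 2 ((volume : Measure ℝ).restrict univ)) :
    quasimodeMap h n hε (toL2 univ g) = toL2 (curveTube ϑ k d) (quasimode ϑ k d r n ε g) := by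
  have h1 := coeFn_toL2 hg2
  rw [Measure.restrict_univ] at hg2
  rw [quasimodeMap_apply]
  refine (toL2_congr (h.memLp_quasimode n hε hg hg2) (h.quasimode_congr_ae n hε hg
    (Lp.stronglyMeasurable _).measurable ?_)).symm
  exact (h1.filter_mono (ae_mono (by rw [Measure.restrict_univ]))).symm

end QuasimodeMap

/-! ### Approximate intertwining of the two Hamiltonians. -/

section Intertwining

variable {ϑ : ℝ} {k : ℝ → ℝ} {d r K : ℝ}

/-- The effective Hamiltonian on test functions. -/
def effectiveOp (ϑ : ℝ) (k : ℝ → ℝ) (d : ℝ) (φ : ℝ → ℂ) (x : ℝ) : ℂ :=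
  -(1 / 2 : ℂ) * Laplacian.laplacian φ x + ((-(scaledCurvature ϑ k d x ^ 2 / 8) : ℝ) : ℂ) * φ x

lemma IsTubeWidth.continuous_potential (h : IsTubeWidth ϑ k d r K) :
    Continuous fun s => -(scaledCurvature ϑ k d s ^ 2 / 8) :=
  (((contDiff_scaledCurvature h.smooth).continuous.pow 2).div_const 8).neg

lemma continuous_tubePotential (ε : ℝ) :
    Continuous fun q => 1 / ε ^ 2 * (1 / 2 * curveDist ϑ k d q ^ 2) :=
  continuous_const.mul (continuous_const.mul (continuous_curveDist.pow 2))

lemma IsTubeWidth.continuous_effectiveOp (h : IsTubeWidth ϑ k d r K) {φ : ℝ → ℂ}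
    (hφ : IsTestFunction univ φ) : Continuous (effectiveOp ϑ k d φ) :=
  (continuous_const.mul hφ.laplacian.smooth.continuous).add
    ((Complex.continuous_ofReal.comp h.continuous_potential).mul hφ.smooth.continuous)

lemma IsTubeWidth.memLp_effectiveOp (h : IsTubeWidth ϑ k d r K) {φ : ℝ → ℂ}
    (hφ : IsTestFunction univ φ) :
    MemLp (effectiveOp ϑ k d φ) 2 ((volume : Measure ℝ).restrict univ) :=
  hφ.memLp_schrodinger h.continuous_potential

/-- The error of the quasimode, as a function on the plane. -/
def quasimodeDefect (ϑ : ℝ) (k : ℝ → ℝ) (d r : ℝ) (n : ℕ) (ε : ℝ) (φ : ℝ → ℂ) (q : Plane) : ℂ :=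
  -(1 / 2 : ℂ) * Laplacian.laplacian (quasimode ϑ k d r n ε φ) q +
    ((1 / ε ^ 2 * (1 / 2 * curveDist ϑ k d q ^ 2) : ℝ) : ℂ) * quasimode ϑ k d r n ε φ q -
    quasimode ϑ k d r n ε (effectiveOp ϑ k d φ) q -
    (((n + 1 / 2) / ε : ℝ) : ℂ) * quasimode ϑ k d r n ε φ q

lemma IsTubeWidth.quasimodeDefect_eq (h : IsTubeWidth ϑ k d r K) (n : ℕ) {ε : ℝ} (hε : 0 < ε)
    {φ : ℝ → ℂ} (hφ : IsTestFunction univ φ) {q : Plane} (hq : curveDist ϑ k d q < r) :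
    quasimodeDefect ϑ k d r n ε φ q = quasimodeError ϑ k d r n ε φ (tubularCoord ϑ k d q).1
      (tubularCoord ϑ k d q).2 := by
  have h1 := tubularCoord_spec h.angle h.smooth h.supp h.int h.d_pos q
  have hu : |(tubularCoord ϑ k d q).2| < r := by rw [h1.2]; exact hq
  have h2 := h.schrodinger_quasimode n hε hφ (s := (tubularCoord ϑ k d q).1) hu
  rw [Prod.mk.eta, h1.1, ← sq_abs (tubularCoord ϑ k d q).2, h1.2] at h2
  have e : effectiveOp ϑ k d φ = fun s => -(1 / 2 : ℂ) * deriv (deriv φ) s +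
      ((-(scaledCurvature ϑ k d s ^ 2 / 8) : ℝ) : ℂ) * φ s := by
    ext s
    rw [effectiveOp, laplacian_eq_deriv_deriv]
  rw [quasimodeDefect, e, h2]
  ring

lemma IsTubeWidth.quasimodeDefect_eq_zero (h : IsTubeWidth ϑ k d r K) (n : ℕ) (ε : ℝ)
    (φ : ℝ → ℂ) {q : Plane} (hq : r ≤ curveDist ϑ k d q) :
    quasimodeDefect ϑ k d r n ε φ q = 0 := by
  have hr := h.r_pos
  have h0 : quasimode ϑ k d r n ε φ =ᶠ[𝓝 q] fun _ => 0 := by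
    filter_upwards [(isOpen_lt continuous_const (continuous_curveDist (ϑ := ϑ) (k := k)
      (d := d))).mem_nhds (show 3 / 4 * r < curveDist ϑ k d q by linarith)] with x hx
    exact h.quasimode_eq_zero n ε φ (le_of_lt hx)
  have h1 : Laplacian.laplacian (quasimode ϑ k d r n ε φ) q = 0 := by
    rw [(InnerProductSpace.laplacian_congr_nhds h0).self_of_nhds,
      laplacian_eq_sum_fderiv (stdOrthonormalBasis ℝ Plane) contDiff_const]
    simp
  rw [quasimodeDefect, h1, h.quasimode_eq_zero n ε _ (by linarith),
    h.quasimode_eq_zero n ε _ (by linarith)]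
  simp

/-- The `L²` norms of the derivatives are controlled by the graph norm. -/
lemma IsTubeWidth.norm_derivatives_le (h : IsTubeWidth ϑ k d r K) {φ : ℝ → ℂ}
    (hφ : IsTestFunction univ φ) :
    ‖toL2 univ φ‖ + ‖toL2 univ (deriv φ)‖ + ‖toL2 univ (deriv (deriv φ))‖ ≤
      5 * K ^ 2 / r ^ 2 * (‖toL2 univ φ‖ + ‖toL2 univ (effectiveOp ϑ k d φ)‖) := by
  have hr := h.r_pos
  have hr1 : r ≤ 1 := h.r_le.trans h.d_le
  have hK := h.one_le
  have hw : Continuous fun s => -(scaledCurvature ϑ k d s ^ 2 / 4) :=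
    (((contDiff_scaledCurvature h.smooth).continuous.pow 2).div_const 4).neg
  have e : toL2 univ (deriv (deriv φ)) = (-2 : ℂ) • toL2 univ (effectiveOp ϑ k d φ) +
      toL2 univ (fun s => ((-(scaledCurvature ϑ k d s ^ 2 / 4) : ℝ) : ℂ) * φ s) := by
    rw [← toL2_smul _ (h.memLp_effectiveOp hφ), ← toL2_add ((h.memLp_effectiveOp hφ).const_smul _)
      (hφ.memLp_mul hw)]
    congr 1
    ext s
    simp only [Pi.add_apply, Pi.smul_apply, effectiveOp, laplacian_eq_deriv_deriv, smul_eq_mul]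
    push_cast
    ring
  have hQ : (K / r) ^ 2 = K ^ 2 / r ^ 2 := div_pow _ _ _
  have h1 : ‖toL2 univ (fun s => ((-(scaledCurvature ϑ k d s ^ 2 / 4) : ℝ) : ℂ) * φ s)‖ ≤
      (K ^ 2 / r ^ 2 / 4) * ‖toL2 univ φ‖ := by
    refine norm_toL2_le_of_eLpNorm_le (by positivity) ?_
    rw [ENNReal.ofReal_mul (by positivity), ofReal_norm_toL2 hφ.memLp]
    refine eLpNorm_le_mul_eLpNorm_of_ae_le_mul (.of_forall fun s => ?_) _
    rw [norm_mul, Complex.norm_real, Real.norm_eq_abs, abs_neg, abs_div, abs_pow,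
      abs_of_pos (by norm_num : (0 : ℝ) < 4), ← hQ]
    have := h.curv s
    gcongr
  have h2 : ‖toL2 univ (deriv (deriv φ))‖ ≤ 2 * ‖toL2 univ (effectiveOp ϑ k d φ)‖ +
      (K ^ 2 / r ^ 2 / 4) * ‖toL2 univ φ‖ := by
    rw [e]
    refine (norm_add_le _ _).trans (add_le_add ?_ h1)
    rw [norm_smul]; simp
  -- By interpolation the sum is at most 2‖φ‖ + 2‖φ''‖, hence at most (2 + Q/2)‖φ‖ + 4‖Kφ‖, where Q
  -- = K²/r² ≥ 1 and Kφ in the last norm denotes the effective operator.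
  have h3 := norm_toL2_deriv_le hφ
  have hQ1 : 1 ≤ K ^ 2 / r ^ 2 := by
    rw [← hQ]
    exact one_le_pow₀ (by rw [le_div_iff₀ hr]; linarith)
  rw [mul_div_assoc]
  nlinarith [norm_nonneg (toL2 univ φ), norm_nonneg (toL2 univ (effectiveOp ϑ k d φ)),
    mul_nonneg (sub_nonneg.2 hQ1) (norm_nonneg (toL2 univ φ)),
    mul_nonneg (sub_nonneg.2 hQ1) (norm_nonneg (toL2 univ (effectiveOp ϑ k d φ)))]

/-- The residual is the quasimode defect. The power of `r` is 3 from the pointwise error plus 2 from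
replacing the derivatives by the graph norm; √ε is the L² norm of the transverse weight. -/
theorem exists_intertwining_bound_test (n : ℕ) (K : ℝ) : ∃ C : ℝ, 0 ≤ C ∧
    ∀ (ϑ : ℝ) (k : ℝ → ℝ) (d r : ℝ) (h : IsTubeWidth ϑ k d r K) (ε : ℝ) (hε : 0 < ε)
      (φ : ℝ → ℂ), IsTestFunction univ φ →
      ∃ ρ, (quasimodeMap h n hε (toL2 univ φ), quasimodeMap h n hε (toL2 univ (effectiveOp ϑ k d φ)) +
          (((n + 1 / 2) / ε : ℝ) : ℂ) • quasimodeMap h n hε (toL2 univ φ) + ρ) ∈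
            tubeHamiltonian ϑ k ε d ∧
        ‖ρ‖ ≤ C * Real.sqrt ε / r ^ 5 * (‖toL2 univ φ‖ + ‖toL2 univ (effectiveOp ϑ k d φ)‖) := by
  obtain ⟨C₁, hC₁, H₁⟩ := exists_quasimodeError_bound K
  obtain ⟨C₂, hC₂, H₂⟩ := exists_oscillator_bound n
  refine ⟨(1 + |K|) * C₁ * (2 * C₂) * (5 * K ^ 2), by positivity, fun ϑ k d r h ε hε φ hφ => ?_⟩
  have hr := h.r_pos
  have hK := h.one_le
  have hKφ := h.memLp_effectiveOp hφ
  have hφm := hφ.smooth.continuous.measurable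
  have hKm := (h.continuous_effectiveOp hφ).measurable
  have hJ := h.isTestFunction_quasimode n ε hφ
  have hV := continuous_tubePotential (ϑ := ϑ) (k := k) (d := d) ε
  have m1 := hJ.memLp_schrodinger hV
  have m2 : MemLp (quasimode ϑ k d r n ε (effectiveOp ϑ k d φ)) 2
      ((volume : Measure Plane).restrict (curveTube ϑ k d)) :=
    h.memLp_quasimode n hε hKm (by simpa using hKφ)
  have m3 : MemLp (quasimodeDefect ϑ k d r n ε φ) 2
      ((volume : Measure Plane).restrict (curveTube ϑ k d)) :=
    (m1.sub m2).sub (hJ.memLp.const_mul _)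
  refine ⟨toL2 (curveTube ϑ k d) (quasimodeDefect ϑ k d r n ε φ), ?_, ?_⟩
  · have h1 := hJ.mem_dirichletSchrodinger hV
    rw [quasimodeMap_toL2 h n hε hφm hφ.memLp, quasimodeMap_toL2 h n hε hKm hKφ,
      ← toL2_smul _ hJ.memLp, ← toL2_add m2 (hJ.memLp.const_smul _),
      ← toL2_add (m2.add (hJ.memLp.const_smul _)) m3]
    have e : quasimode ϑ k d r n ε (effectiveOp ϑ k d φ) +
        (((n + 1 / 2) / ε : ℝ) : ℂ) • quasimode ϑ k d r n ε φ + quasimodeDefect ϑ k d r n ε φ =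
        fun q => -(1 / 2 : ℂ) * Laplacian.laplacian (quasimode ϑ k d r n ε φ) q +
          ((1 / ε ^ 2 * (1 / 2 * curveDist ϑ k d q ^ 2) : ℝ) : ℂ) *
            quasimode ϑ k d r n ε φ q := by
      ext q
      simp only [Pi.add_apply, Pi.smul_apply, smul_eq_mul, quasimodeDefect]
      ring
    rw [e]
    exact h1
  · set P : ℝ → ℝ := (C₁ / r ^ 3) • ((fun s => ‖φ s‖) + (fun s => ‖deriv φ s‖) +
      fun s => ‖deriv (deriv φ) s‖) with hP
    have c0 : Continuous fun s => ‖φ s‖ := hφ.smooth.continuous.norm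
    have c1 : Continuous fun s => ‖deriv φ s‖ := hφ.deriv.smooth.continuous.norm
    have c2 : Continuous fun s => ‖deriv (deriv φ) s‖ := hφ.deriv.deriv.smooth.continuous.norm
    have hPm : Measurable P := (((c0.add c1).add c2).const_smul (C₁ / r ^ 3)).measurable
    have hPn : eLpNorm P 2 volume ≤ ENNReal.ofReal (C₁ / r ^ 3 * (5 * K ^ 2 / r ^ 2 *
        (‖toL2 univ φ‖ + ‖toL2 univ (effectiveOp ϑ k d φ)‖))) := by
      rw [hP, eLpNorm_const_smul, Real.enorm_eq_ofReal (by positivity),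
        ENNReal.ofReal_mul (by positivity)]
      refine mul_le_mul_right ?_ _
      refine le_trans ?_ (ENNReal.ofReal_le_ofReal (h.norm_derivatives_le hφ))
      rw [ENNReal.ofReal_add (by positivity) (by positivity),
        ENNReal.ofReal_add (by positivity) (by positivity), ofReal_norm_toL2 hφ.memLp,
        ofReal_norm_toL2 hφ.deriv.memLp, ofReal_norm_toL2 hφ.deriv.deriv.memLp,
        Measure.restrict_univ]
      refine (eLpNorm_add_le (c0.add c1).aestronglyMeasurable c2.aestronglyMeasurable
        (by norm_num)).trans (add_le_add ((eLpNorm_add_le c0.aestronglyMeasurable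
          c1.aestronglyMeasurable (by norm_num)).trans_eq ?_) (eLpNorm_norm _).le)
      rw [eLpNorm_norm, eLpNorm_norm]
    have hmn : eLpNorm (errorMode n ε) 2 volume ≤ ENNReal.ofReal (2 * C₂ * Real.sqrt ε) := by
      have o1 := (contDiff_oscillatorMode n ε).continuous
      have o2 := continuous_oscillatorDeriv n ε
      refine (eLpNorm_add_le (f := fun u => ‖u * oscillatorMode n ε u‖)
        (g := fun u => ‖u ^ 2 * oscillatorDeriv n ε u‖)
        (Continuous.aestronglyMeasurable (by fun_prop))
        (Continuous.aestronglyMeasurable (by fun_prop)) (by norm_num)).trans ?_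
      rw [eLpNorm_norm, eLpNorm_norm, show 2 * C₂ * Real.sqrt ε =
        C₂ * Real.sqrt ε + C₂ * Real.sqrt ε by ring, ENNReal.ofReal_add (by positivity)
        (by positivity)]
      exact add_le_add (H₂ ε hε).2.1 (H₂ ε hε).2.2
    refine norm_toL2_le_of_eLpNorm_le (by positivity) ((h.eLpNorm_le hPm
      (measurable_errorMode n ε) fun q _ => ?_).trans ?_)
    · rcases lt_or_ge (curveDist ϑ k d q) r with hq | hq
      · rw [h.quasimodeDefect_eq n hε hφ hq]
        refine H₁ ϑ k d r h n ε φ _ _ ?_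
        rw [(tubularCoord_spec h.angle h.smooth h.supp h.int h.d_pos q).2]
        exact hq
      · rw [h.quasimodeDefect_eq_zero n ε φ hq, norm_zero]
        have : 0 ≤ errorMode n ε (tubularCoord ϑ k d q).2 :=
          add_nonneg (abs_nonneg _) (abs_nonneg _)
        simp only [hP, Pi.smul_apply, Pi.add_apply, smul_eq_mul]
        positivity
    · refine (mul_le_mul_right (mul_le_mul' hPn hmn) _).trans ?_
      rw [← ENNReal.ofReal_mul (by positivity), ← ENNReal.ofReal_mul (by positivity)]
      refine ENNReal.ofReal_le_ofReal (le_of_eq ?_)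
      rw [abs_of_pos (by linarith)]
      field_simp

/-- A bound on a core extends to the whole operator. -/
theorem exists_residual_of_dense {E F : Type*} [NormedAddCommGroup E] [InnerProductSpace ℂ E]
    [NormedAddCommGroup F] [InnerProductSpace ℂ F] [CompleteSpace F] {B : Set (F × F)}
    {W : ℝ → (F ≃ₗᵢ[ℂ] F)} (hW : IsUnitaryGroup B W) (hB : IsClosed B) (J : E →L[ℂ] F) {l : ℂ}
    {η : ℝ} (x : ℕ → E × E) (R : E × E → F)
    (hR : ∀ i j, (J (x i - x j).1, J (x i - x j).2 + l • J (x i - x j).1 + R (x i - x j)) ∈ B ∧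
      ‖R (x i - x j)‖ ≤ η * (‖(x i - x j).1‖ + ‖(x i - x j).2‖))
    (hx : ∀ i, (J (x i).1, J (x i).2 + l • J (x i).1 + R (x i)) ∈ B ∧
      ‖R (x i)‖ ≤ η * (‖(x i).1‖ + ‖(x i).2‖)) {p : E × E} (hp : Tendsto x atTop (𝓝 p)) :
    ∃ ρ : F, (J p.1, J p.2 + l • J p.1 + ρ) ∈ B ∧ ‖ρ‖ ≤ η * (‖p.1‖ + ‖p.2‖) := by
  -- Although `R` is an arbitrary choice of residuals, the generator is single-valued, which forces
  -- additivity. Hence the residuals along the sequence form a Cauchy sequence.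
  have hsub : ∀ i j, R (x i - x j) = R (x i) - R (x j) := by
    intro i j
    have h1 := (hW.generator _ _).2 (hR i j).1
    have h2 := ((hW.generator _ _).2 (hx i).1).sub ((hW.generator _ _).2 (hx j).1)
    have e : (fun t => W t (J (x i).1)) - (fun t => W t (J (x j).1)) =
        fun t => W t (J (x i - x j).1) := by
      ext t
      simp [map_sub]
    rw [e] at h2
    have h3 := h1.unique h2
    have h4 : Complex.I • (J (x i - x j).2 + l • J (x i - x j).1 + R (x i - x j)) =
        Complex.I • (J (x i).2 + l • J (x i).1 + R (x i) -
          (J (x j).2 + l • J (x j).1 + R (x j))) := by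
      rw [smul_sub, ← neg_inj, h3]; abel
    have h5 := smul_right_injective F Complex.I_ne_zero h4
    simp only [Prod.fst_sub, Prod.snd_sub, map_sub, smul_sub] at h5
    have : R (x i - x j) = (J (x i).2 - J (x j).2 + (l • J (x i).1 - l • J (x j).1) +
      R (x i - x j)) - (J (x i).2 - J (x j).2) - (l • J (x i).1 - l • J (x j).1) := by abel
    rw [this, h5]
    abel
  have hpair : CauchySeq x := hp.cauchySeq
  have hRc : CauchySeq fun i => R (x i) := by
    rw [Metric.cauchySeq_iff'] at hpair ⊢
    intro e he
    obtain ⟨N, hN⟩ := hpair (e / (2 * (|η| + 1))) (by positivity)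
    refine ⟨N, fun m hm => ?_⟩
    rw [dist_eq_norm, ← hsub]
    have h1 := hN m hm
    rw [dist_eq_norm] at h1
    have h2 := norm_fst_le (x m - x N)
    have h3 := norm_snd_le (x m - x N)
    refine (hR m N).2.trans_lt ?_
    calc η * (‖(x m - x N).1‖ + ‖(x m - x N).2‖)
        ≤ (|η| + 1) * (‖x m - x N‖ + ‖x m - x N‖) := by
          refine mul_le_mul (by linarith [le_abs_self η]) (add_le_add h2 h3) (by positivity)
            (by positivity)
      _ < (|η| + 1) * (e / (2 * (|η| + 1)) + e / (2 * (|η| + 1))) := by gcongr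
      _ = e := by field_simp; ring
  obtain ⟨ρ, hρ⟩ := cauchySeq_tendsto_of_complete hRc
  have t1 : Tendsto (fun i => (x i).1) atTop (𝓝 p.1) := (continuous_fst.tendsto p).comp hp
  have t2 : Tendsto (fun i => (x i).2) atTop (𝓝 p.2) := (continuous_snd.tendsto p).comp hp
  have j1 := (J.continuous.tendsto p.1).comp t1
  have j2 := (J.continuous.tendsto p.2).comp t2
  refine ⟨ρ, ?_, ?_⟩
  · refine hB.mem_of_tendsto (j1.prodMk_nhds ((j2.add (j1.const_smul l)).add hρ))
      (.of_forall fun i => (hx i).1)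
  · exact le_of_tendsto_of_tendsto' hρ.norm ((t1.norm.add t2.norm).const_mul η) fun i => (hx i).2

end Intertwining

/-! ### Comparison of the two evolutions. -/

section Evolution

variable {ϑ : ℝ} {k : ℝ → ℝ} {d r K : ℝ}

lemma IsTubeWidth.abs_potential_le (h : IsTubeWidth ϑ k d r K) (s : ℝ) :
    |-(scaledCurvature ϑ k d s ^ 2 / 8)| ≤ (K / r) ^ 2 / 8 := by
  rw [abs_neg, abs_div, abs_pow, abs_of_pos (by norm_num : (0 : ℝ) < 8)]
  have := h.curv s
  gcongr

lemma abs_tubePotential_le (ε : ℝ) {q : Plane} (hq : q ∈ curveTube ϑ k d) :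
    |1 / ε ^ 2 * (1 / 2 * curveDist ϑ k d q ^ 2)| ≤ 1 / ε ^ 2 * (1 / 2 * d ^ 2) := by
  have h0 : 0 ≤ curveDist ϑ k d q := Metric.infDist_nonneg
  have h1 : curveDist ϑ k d q < d := hq
  rw [abs_of_nonneg (by positivity)]
  gcongr

lemma isUnitaryGroup_tubeHamiltonian (ε : ℝ) :
    IsUnitaryGroup (tubeHamiltonian ϑ k ε d) (unitaryGroup (tubeHamiltonian ϑ k ε d)) :=
  isUnitaryGroup_dirichletSchrodinger isOpen_curveTube (continuous_tubePotential ε)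
    fun _ hq => abs_tubePotential_le ε hq

lemma IsTubeWidth.isUnitaryGroup_effectiveHamiltonian (h : IsTubeWidth ϑ k d r K) :
    IsUnitaryGroup (effectiveHamiltonian ϑ k d) (unitaryGroup (effectiveHamiltonian ϑ k d)) :=
  isUnitaryGroup_dirichletSchrodinger isOpen_univ h.continuous_potential
    fun s _ => h.abs_potential_le s

lemma IsTubeWidth.effectivePair_sub (h : IsTubeWidth ϑ k d r K) {φ χ : ℝ → ℂ}
    (hφ : IsTestFunction univ φ) (hχ : IsTestFunction univ χ) :
    (toL2 univ φ, toL2 univ (effectiveOp ϑ k d φ)) -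
        (toL2 univ χ, toL2 univ (effectiveOp ϑ k d χ)) =
      (toL2 univ (φ + (-1 : ℂ) • χ), toL2 univ (effectiveOp ϑ k d (φ + (-1 : ℂ) • χ))) := by
  have e : effectiveOp ϑ k d (φ + (-1 : ℂ) • χ) =
      effectiveOp ϑ k d φ + (-1 : ℂ) • effectiveOp ϑ k d χ := by
    ext s
    have c1 := hφ.contDiff_two.contDiffAt (x := s)
    have c2 := (hχ.const_smul (-1)).contDiff_two.contDiffAt (x := s)
    simp only [effectiveOp, Pi.add_apply, Pi.smul_apply, smul_eq_mul]
    rw [c1.laplacian_add c2, InnerProductSpace.laplacian_smul _ hχ.contDiff_two.contDiffAt,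
      smul_eq_mul]
    ring
  rw [e, toL2_add hφ.memLp (hχ.memLp.const_smul _), toL2_smul _ hχ.memLp,
    toL2_add (h.memLp_effectiveOp hφ) ((h.memLp_effectiveOp hχ).const_smul _),
    toL2_smul _ (h.memLp_effectiveOp hχ), Prod.mk_sub_mk]
  simp only [neg_smul, one_smul, sub_eq_add_neg]

/-- Test functions form a core of the effective Hamiltonian and the tube Hamiltonian is closed, so
the estimate on test functions passes to the whole domain. -/
theorem exists_intertwining_bound (n : ℕ) (K : ℝ) : ∃ C : ℝ, 0 ≤ C ∧
    ∀ (ϑ : ℝ) (k : ℝ → ℝ) (d r : ℝ) (h : IsTubeWidth ϑ k d r K) (ε : ℝ) (hε : 0 < ε)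
      (g g' : Lp ℂ 2 ((volume : Measure ℝ).restrict univ)), (g, g') ∈ effectiveHamiltonian ϑ k d →
      ∃ ρ, (quasimodeMap h n hε g, quasimodeMap h n hε g' +
          (((n + 1 / 2) / ε : ℝ) : ℂ) • quasimodeMap h n hε g + ρ) ∈ tubeHamiltonian ϑ k ε d ∧
        ‖ρ‖ ≤ C * Real.sqrt ε / r ^ 5 * (‖g‖ + ‖g'‖) := by
  obtain ⟨C, hC, H⟩ := exists_intertwining_bound_test n K
  refine ⟨C, hC, fun ϑ k d r h ε hε g g' hg => ?_⟩
  obtain ⟨φ, hφ, t1, t2⟩ := exists_testFunction_core h.continuous_potential h.abs_potential_le hg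
  -- The residual is made a total function of the pair, with the irrelevant value 0 for pairs that
  -- do not come from a test function.
  have hR : ∀ p : Lp ℂ 2 ((volume : Measure ℝ).restrict univ) ×
      Lp ℂ 2 ((volume : Measure ℝ).restrict univ), ∃ ρ, (∃ χ : ℝ → ℂ, IsTestFunction univ χ ∧
        p = (toL2 univ χ, toL2 univ (effectiveOp ϑ k d χ))) →
      (quasimodeMap h n hε p.1, quasimodeMap h n hε p.2 +
          (((n + 1 / 2) / ε : ℝ) : ℂ) • quasimodeMap h n hε p.1 + ρ) ∈ tubeHamiltonian ϑ k ε d ∧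
        ‖ρ‖ ≤ C * Real.sqrt ε / r ^ 5 * (‖p.1‖ + ‖p.2‖) := by
    intro p
    by_cases hp : ∃ χ : ℝ → ℂ, IsTestFunction univ χ ∧
        p = (toL2 univ χ, toL2 univ (effectiveOp ϑ k d χ))
    · obtain ⟨χ, hχ, rfl⟩ := hp
      obtain ⟨ρ, hρ⟩ := H ϑ k d r h ε hε χ hχ
      exact ⟨ρ, fun _ => hρ⟩
    · exact ⟨0, fun h => (hp h).elim⟩
  choose R hR using hR
  set x : ℕ → Lp ℂ 2 ((volume : Measure ℝ).restrict univ) ×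
    Lp ℂ 2 ((volume : Measure ℝ).restrict univ) := fun i =>
    (toL2 univ (φ i), toL2 univ (effectiveOp ϑ k d (φ i))) with hx
  have hsub : ∀ i j, x i - x j = (toL2 univ (φ i + (-1 : ℂ) • φ j),
      toL2 univ (effectiveOp ϑ k d (φ i + (-1 : ℂ) • φ j))) := fun i j =>
    h.effectivePair_sub (hφ i) (hφ j)
  have hcl : IsClosed (tubeHamiltonian ϑ k ε d) :=
    isClosed_dirichletSchrodinger isOpen_curveTube (continuous_tubePotential ε)
      fun _ hq => abs_tubePotential_le ε hq
  have hlim : Tendsto x atTop (𝓝 (g, g')) := t1.prodMk_nhds t2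
  have hR1 := fun i j => hR (x i - x j) ⟨_, (hφ i).add ((hφ j).const_smul (-1)), hsub i j⟩
  have hR2 := fun i => hR (x i) ⟨φ i, hφ i, rfl⟩
  obtain ⟨ρ, h1, h2⟩ := exists_residual_of_dense (isUnitaryGroup_tubeHamiltonian ε) hcl
    (quasimodeMap h n hε) x R hR1 hR2 hlim
  exact ⟨ρ, h1, h2⟩

/-- The evolution in the tube of a quasimode follows the effective evolution. -/
theorem exists_evolution_bound (n : ℕ) (K : ℝ) : ∃ C : ℝ, 0 ≤ C ∧
    ∀ (ϑ : ℝ) (k : ℝ → ℝ) (d r : ℝ) (h : IsTubeWidth ϑ k d r K) (ε : ℝ) (hε : 0 < ε)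
      (f : ℝ → ℂ), IsTestFunction univ f → ∀ t : ℝ, 0 ≤ t →
      ‖unitaryGroup (tubeHamiltonian ϑ k ε d) t (quasimodeMap h n hε (toL2 univ f)) -
          Complex.exp (-(Complex.I * t * (((n + 1 / 2) / ε : ℝ) : ℂ))) •
            quasimodeMap h n hε (unitaryGroup (effectiveHamiltonian ϑ k d) t (toL2 univ f))‖ ≤
        C * Real.sqrt ε / r ^ 5 * (‖toL2 univ f‖ + ‖toL2 univ (effectiveOp ϑ k d f)‖) * t := by
  obtain ⟨C, hC, H⟩ := exists_intertwining_bound n K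
  refine ⟨C, hC, fun ϑ k d r h ε hε f hf t ht => ?_⟩
  exact norm_unitaryGroup_sub_le (isUnitaryGroup_tubeHamiltonian ε)
    h.isUnitaryGroup_effectiveHamiltonian (quasimodeMap h n hε)
    (fun g g' hg => H ϑ k d r h ε hε g g' hg) (hf.mem_dirichletSchrodinger h.continuous_potential) ht

/-- A triangle inequality for the `L²` seminorm in which only one function is measurable. -/
lemma eLpNorm_two_add_le {α E : Type*} [MeasurableSpace α] {μ : Measure α}
    [NormedAddCommGroup E] {f : α → E} (hf : AEStronglyMeasurable f μ) (g : α → E) :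
    eLpNorm (f + g) 2 μ ≤ 2 * (eLpNorm f 2 μ + eLpNorm g 2 μ) := by
  refine (ENNReal.pow_le_pow_left_iff (n := 2) (by norm_num)).mp ?_
  have h2 : ∀ a b : ENNReal, (a + b) ^ 2 ≤ 2 * (a ^ 2 + b ^ 2) := fun a b => by
    have := ENNReal.rpow_add_le_mul_rpow_add_rpow a b (p := 2) (by norm_num)
    norm_num at this
    exact_mod_cast this
  calc eLpNorm (f + g) 2 μ ^ 2 = ∫⁻ x, ‖f x + g x‖ₑ ^ 2 ∂μ := eLpNorm_two_sq _
    _ ≤ ∫⁻ x, (2 * ‖f x‖ₑ ^ 2 + 2 * ‖g x‖ₑ ^ 2) ∂μ := by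
        refine lintegral_mono fun x => ?_
        simp only
        rw [← mul_add]
        exact (pow_le_pow_left' (enorm_add_le _ _) 2).trans (h2 _ _)
    _ = 2 * eLpNorm f 2 μ ^ 2 + 2 * eLpNorm g 2 μ ^ 2 := by
        rw [lintegral_add_left' ((hf.enorm.pow_const 2).const_mul 2),
          lintegral_const_mul' _ _ (by norm_num), lintegral_const_mul' _ _ (by norm_num),
          eLpNorm_two_sq, eLpNorm_two_sq]
    _ ≤ 4 * (eLpNorm f 2 μ ^ 2 + eLpNorm g 2 μ ^ 2) := by
        rw [← mul_add]; gcongr; norm_num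
    _ ≤ 4 * (eLpNorm f 2 μ + eLpNorm g 2 μ) ^ 2 := by
        gcongr
        rw [add_sq]
        exact add_le_add_left le_self_add _
    _ = (2 * (eLpNorm f 2 μ + eLpNorm g 2 μ)) ^ 2 := by rw [mul_pow]; norm_num

/-- The effective state is close to the quasimode. -/
theorem exists_effectiveState_bound (n : ℕ) (K : ℝ) : ∃ C : ℝ, 0 ≤ C ∧
    ∀ (ϑ : ℝ) (k : ℝ → ℝ) (d r : ℝ), IsTubeWidth ϑ k d r K → ∀ (ε : ℝ), 0 < ε →
      ∀ (g : Lp ℂ 2 ((volume : Measure ℝ).restrict univ)),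
      eLpNorm (fun q => quasimode ϑ k d r n ε g q - g (tubularCoord ϑ k d q).1 *
          (oscillatorMode n ε (tubularCoord ϑ k d q).2 : ℂ)) 2
        ((volume : Measure Plane).restrict (curveTube ϑ k d)) ≤
      ENNReal.ofReal (C * Real.sqrt ε / r * ‖g‖) := by
  obtain ⟨C₂, hC₂, H₂⟩ := exists_oscillator_bound n
  refine ⟨(1 + |K|) * (4 * |K|) * C₂, by positivity, fun ϑ k d r h ε hε g => ?_⟩
  have hr := h.r_pos
  have hK := h.one_le
  rw [abs_of_nonneg (by linarith : 0 ≤ K)]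
  have hgm : Measurable g := (Lp.stronglyMeasurable g).measurable
  have ho := (contDiff_oscillatorMode n ε).continuous.measurable
  have hmn : eLpNorm (fun u => 4 * K / r * |u * oscillatorMode n ε u|) 2 volume ≤
      ENNReal.ofReal (4 * K / r * (C₂ * Real.sqrt ε)) := by
    have e : (fun u => 4 * K / r * |u * oscillatorMode n ε u|) =
      (4 * K / r) • fun u => ‖u * oscillatorMode n ε u‖ := rfl
    rw [e, eLpNorm_const_smul, eLpNorm_norm, Real.enorm_eq_ofReal (by positivity),
      ENNReal.ofReal_mul (by positivity)]
    exact mul_le_mul_right (H₂ ε hε).2.1 _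
  have hgn : eLpNorm (fun s => ‖g s‖) 2 volume = ENNReal.ofReal ‖g‖ := by
    rw [eLpNorm_norm]
    have := ofReal_norm_toL2 (Lp.memLp g)
    rw [toL2_coeFn] at this
    rw [this]
    exact congrArg (fun μ => eLpNorm (⇑g) 2 μ) Measure.restrict_univ.symm
  refine (h.eLpNorm_le (P := fun s => ‖g s‖)
    (m := fun u => 4 * K / r * |u * oscillatorMode n ε u|) hgm.norm (by fun_prop)
    fun q _ => ?_).trans ?_
  · set s := (tubularCoord ϑ k d q).1 with hs
    set u := (tubularCoord ϑ k d q).2 with hu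
    have e : quasimode ϑ k d r n ε g q - g s * (oscillatorMode n ε u : ℂ) =
        g s * ((tubeWeight ϑ k d s u * cutMode n ε r u - oscillatorMode n ε u : ℝ) : ℂ) := by
      rw [quasimode, Complex.ofReal_sub]; ring
    rw [e, norm_mul, Complex.norm_real, Real.norm_eq_abs]
    refine mul_le_mul_of_nonneg_left ?_ (norm_nonneg _)
    -- For |u| ≤ r both the weight and the cutoff differ from 1 by O(|u|/r). For larger |u| the
    -- quasimode vanishes and the whole mode is bounded by 4K|u|/r times itself.
    rcases le_or_gt |u| r with hur | hur
    · have h1 : |tubeWeight ϑ k d s u * cutoff (u / r) - 1| ≤ 4 * K / r * |u| := by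
        have w1 := h.abs_tubeWeight_sub_one_le s hur
        have w2 := abs_one_sub_cutoff_le (u / r)
        have w3 := h.curv s
        rw [abs_div, abs_of_pos hr] at w2
        rw [abs_mul] at w1
        have e2 : tubeWeight ϑ k d s u * cutoff (u / r) - 1 =
          (tubeWeight ϑ k d s u - 1) * cutoff (u / r) - (1 - cutoff (u / r)) := by ring
        rw [e2]
        calc _ ≤ |tubeWeight ϑ k d s u - 1| * |cutoff (u / r)| + |1 - cutoff (u / r)| := by
              rw [← abs_mul]; exact abs_sub _ _
          _ ≤ 2 * (|u| * (K / r)) * 1 + 2 * (|u| / r) := by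
              gcongr
              · exact w1.trans (by gcongr)
              · rw [abs_of_nonneg (cutoff_nonneg _)]; exact cutoff_le_one _
          _ = (2 * K + 2) / r * |u| := by ring
          _ ≤ 4 * K / r * |u| := by gcongr; linarith
      rw [cutMode, show tubeWeight ϑ k d s u * (cutoff (u / r) * oscillatorMode n ε u) -
        oscillatorMode n ε u = (tubeWeight ϑ k d s u * cutoff (u / r) - 1) * oscillatorMode n ε u
        by ring, abs_mul, abs_mul, ← mul_assoc]
      gcongr
    · rw [cutMode_eq_zero n ε hr (by linarith), mul_zero, zero_sub, abs_neg, abs_mul, ← mul_assoc]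
      refine le_mul_of_one_le_left (abs_nonneg _) ?_
      rw [div_mul_eq_mul_div, one_le_div hr]
      nlinarith
  · rw [hgn]
    refine (mul_le_mul_right (mul_le_mul_right hmn _) _).trans ?_
    rw [← ENNReal.ofReal_mul (norm_nonneg _), ← ENNReal.ofReal_mul (by positivity)]
    refine ENNReal.ofReal_le_ofReal (le_of_eq ?_)
    ring

end Evolution

/-! ### The initial product state on a straight edge. -/

section InitialState

variable {ϑ : ℝ} {k : ℝ → ℝ} {d r K : ℝ}

lemma eLpNorm_frameCoord_mul (θ : ℝ) {P m : ℝ → ℝ} (hP : Measurable P) (hm : Measurable m) :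
    eLpNorm (fun q : Plane => P (inner ℝ (tangentVec θ) q) * m (inner ℝ (normalVec θ) q)) 2 volume =
      eLpNorm P 2 volume * eLpNorm m 2 volume := by
  have e : (fun q : Plane => P (inner ℝ (tangentVec θ) q) * m (inner ℝ (normalVec θ) q)) =
      (fun p : ℝ × ℝ => P p.1 * m p.2) ∘ frameCoord θ := by
    ext q
    rw [Function.comp_apply, frameCoord_apply]
  rw [e, eLpNorm_comp_measurePreserving
    (Measurable.aestronglyMeasurable (by fun_prop)) (measurePreserving_frameCoord θ)]
  have e2 : eLpNorm (fun p : ℝ × ℝ => P p.1 * m p.2) 2 volume ^ 2 =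
      (eLpNorm P 2 volume * eLpNorm m 2 volume) ^ 2 := by
    rw [eLpNorm_two_sq, ← lintegral_prod_sq P m hP hm]
    simp only [enorm_mul, mul_pow]
  exact le_antisymm ((ENNReal.pow_le_pow_left_iff two_ne_zero).mp e2.le)
    ((ENNReal.pow_le_pow_left_iff two_ne_zero).mp e2.ge)

/-- A Lipschitz bound together with a common compact support; the restriction |σ| ≤ 1 keeps all
translates inside one fixed interval. -/
lemma exists_eLpNorm_translate_sub_le {f : ℝ → ℂ} (hf : IsTestFunction univ f) :
    ∃ C : ℝ, 0 ≤ C ∧ ∀ σ : ℝ, |σ| ≤ 1 →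
      eLpNorm (fun x => f x - f (x - σ)) 2 volume ≤ ENNReal.ofReal (C * |σ|) := by
  obtain ⟨L, hL⟩ := hf.deriv.smooth.continuous.bounded_above_of_compact_support hf.deriv.compact
  obtain ⟨B, hB⟩ := hf.compact.isCompact.isBounded.subset_closedBall 0
  have hL0 : 0 ≤ L := (norm_nonneg _).trans (hL 0)
  have hlip : ∀ x y, ‖f x - f y‖ ≤ L * |x - y| := fun x y =>
    Convex.norm_image_sub_le_of_norm_deriv_le (s := univ)
      (fun z _ => hf.smooth.differentiable (by simp) z) (fun z _ => hL z) convex_univ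
      (mem_univ y) (mem_univ x)
  set g : ℝ → ℝ := (Icc (-(B + 1)) (B + 1)).indicator fun _ => L with hg
  have hgm : MemLp g 2 volume := memLp_indicator_const 2 measurableSet_Icc _
    (Or.inr (by simp))
  refine ⟨(eLpNorm g 2 volume).toReal, ENNReal.toReal_nonneg, fun σ hσ => ?_⟩
  rw [mul_comm, ENNReal.ofReal_mul (abs_nonneg _), ENNReal.ofReal_toReal hgm.eLpNorm_ne_top]
  refine eLpNorm_le_mul_eLpNorm_of_ae_le_mul (.of_forall fun x => ?_) _
  have hsupp : ∀ y, f y ≠ 0 → |y| ≤ B := fun y hy => by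
    simpa using hB (subset_tsupport _ hy)
  by_cases hx : x ∈ Icc (-(B + 1)) (B + 1)
  · rw [hg, indicator_of_mem hx, Real.norm_eq_abs, abs_of_nonneg hL0, mul_comm]
    simpa using hlip x (x - σ)
  · have h1 : f x = 0 := by
      by_contra h0
      have := abs_le.1 (hsupp x h0)
      exact hx ⟨by linarith, by linarith⟩
    have h2 : f (x - σ) = 0 := by
      by_contra h0
      have h3 := abs_le.1 (hsupp _ h0)
      have h4 := abs_le.1 hσ
      exact hx ⟨by linarith, by linarith⟩
    rw [h1, h2, sub_zero, norm_zero]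
    positivity

lemma continuous_productState {θ : ℝ} {f : ℝ → ℂ} (hf : Continuous f) (n : ℕ) (ε : ℝ) :
    Continuous (productState θ f n ε) := by
  have := (contDiff_oscillatorMode n ε).continuous
  unfold productState
  fun_prop

/-- Along a straight part of the curve the quasimode is the product state up to a translation. -/
lemma IsTubeWidth.norm_productState_sub_quasimode_le (h : IsTubeWidth ϑ k d r K) (n : ℕ) (ε : ℝ)
    {f : ℝ → ℂ} {S : Set ℝ} {θ σ : ℝ}
    (hS : ∀ s ∈ S, scaledCurvature ϑ k d s = 0 ∧
      ∀ u, tubularMap ϑ k d (s, u) = (s + σ) • tangentVec θ + u • normalVec θ)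
    (hfS : ∀ s, f s ≠ 0 → s ∈ S) (hfS' : ∀ x, f x ≠ 0 → x - σ ∈ S) (q : Plane) :
    ‖productState θ f n ε q - quasimode ϑ k d r n ε f q‖ ≤
      ‖f (inner ℝ (tangentVec θ) q) - f (inner ℝ (tangentVec θ) q - σ)‖ *
          |oscillatorMode n ε (inner ℝ (normalVec θ) q)| +
        ‖f (inner ℝ (tangentVec θ) q - σ)‖ * (2 / r * |inner ℝ (normalVec θ) q *
          oscillatorMode n ε (inner ℝ (normalVec θ) q)|) := by
  have hr := h.r_pos
  set x := inner ℝ (tangentVec θ) q with hx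
  set y := inner ℝ (normalVec θ) q with hy
  have hq : q = x • tangentVec θ + y • normalVec θ := eq_tangentVec_add_normalVec θ q
  set Φ := oscillatorMode n ε y
  -- In the first case `q` has tubular coordinates (x - σ, y) and weight 1, leaving the translation
  -- and the cutoff as errors. Otherwise the quasimode vanishes, and the product state either
  -- vanishes too or has |y| ≥ r, where 2|y|/r ≥ 1 pays for it.
  by_cases hA : x - σ ∈ S ∧ |y| < r
  · have hT : tubularMap ϑ k d (x - σ, y) = q := by
      rw [(hS _ hA.1).2, sub_add_cancel]; exact hq.symm
    have hb : tubeWeight ϑ k d (x - σ) y = 1 := by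
      rw [tubeWeight, (hS _ hA.1).1, mul_zero, add_zero, Real.sqrt_one, inv_one]
    have e1 := h.quasimode_tubularMap n ε f (s := x - σ) hA.2
    rw [hT, hb, one_mul] at e1
    have e2 : productState θ f n ε q - quasimode ϑ k d r n ε f q =
        (f x - f (x - σ)) * (Φ : ℂ) + f (x - σ) * (((1 - cutoff (y / r)) * Φ : ℝ) : ℂ) := by
      rw [e1, productState, cutMode]
      push_cast
      ring
    rw [e2]
    refine (norm_add_le _ _).trans ?_
    rw [norm_mul, norm_mul, Complex.norm_real, Complex.norm_real, Real.norm_eq_abs,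
      Real.norm_eq_abs]
    gcongr
    have h2 := abs_one_sub_cutoff_le (y / r)
    rw [abs_mul, abs_mul y, ← mul_assoc]
    gcongr
    rw [abs_div, abs_of_pos hr] at h2
    exact h2.trans_eq (by ring)
  · have e1 : quasimode ϑ k d r n ε f q = 0 := by
      by_contra h0
      have hspec := tubularCoord_spec h.angle h.smooth h.supp h.int h.d_pos q
      have hu : |(tubularCoord ϑ k d q).2| < r := by
        by_contra hcon
        rw [hspec.2] at hcon
        exact h0 (h.quasimode_eq_zero n ε f (by linarith [not_lt.1 hcon]))
      have hs : f (tubularCoord ϑ k d q).1 ≠ 0 := fun h1 => h0 (by rw [quasimode, h1, zero_mul])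
      have hT := (hS _ (hfS _ hs)).2 (tubularCoord ϑ k d q).2
      rw [Prod.mk.eta, hspec.1] at hT
      have hx' : x = (tubularCoord ϑ k d q).1 + σ := by
        refine (congrArg (inner ℝ (tangentVec θ)) hT).trans ?_
        rw [inner_add_right, inner_smul_right, inner_smul_right, inner_tangentVec_normalVec,
          inner_tangentVec_tangentVec]
        simp
      have hy' : y = (tubularCoord ϑ k d q).2 := by
        refine (congrArg (inner ℝ (normalVec θ)) hT).trans ?_
        rw [inner_add_right, inner_smul_right, inner_smul_right, inner_normalVec_normalVec,
          inner_normalVec_tangentVec]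
        simp
      refine hA ⟨?_, by rw [hy']; exact hu⟩
      rw [hx', add_sub_cancel_right]
      exact hfS _ hs
    rw [e1, sub_zero, productState, norm_mul, Complex.norm_real, Real.norm_eq_abs]
    by_cases hxS : x - σ ∈ S
    · have hyr : r ≤ |y| := not_lt.1 fun hlt => hA ⟨hxS, hlt⟩
      have h1 : ‖f x‖ ≤ ‖f x - f (x - σ)‖ + ‖f (x - σ)‖ := by
        simpa using norm_add_le (f x - f (x - σ)) (f (x - σ))
      have h2 : (1 : ℝ) ≤ 2 / r * |y| := by
        rw [div_mul_eq_mul_div, one_le_div hr]; linarith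
      rw [abs_mul, ← mul_assoc (2 / r), ← mul_assoc, ← add_mul]
      refine mul_le_mul_of_nonneg_right (h1.trans ?_) (abs_nonneg _)
      gcongr
      exact le_mul_of_one_le_right (norm_nonneg _) h2
    · have : f x = 0 := by
        by_contra h0
        exact hxS (hfS' _ h0)
      rw [show f (inner ℝ (tangentVec θ) q) = 0 from this, norm_zero, zero_mul]
      positivity

end InitialState

/-! ### Assembly of the estimates. -/

section Conclusion

lemma memLp_productState {θ : ℝ} {f : ℝ → ℂ} (hf : IsTestFunction univ f) (n : ℕ) {ε : ℝ}
    (hε : 0 < ε) (Ω : Set Plane) :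
    MemLp (productState θ f n ε) 2 ((volume : Measure Plane).restrict Ω) := by
  obtain ⟨C, hC, H⟩ := exists_oscillator_bound n
  refine MemLp.restrict _ ⟨(continuous_productState hf.smooth.continuous n ε).aestronglyMeasurable,
    ?_⟩
  have hfm := hf.memLp.eLpNorm_lt_top
  rw [Measure.restrict_univ] at hfm
  have e := eLpNorm_frameCoord_mul θ (P := fun x => ‖f x‖) (m := fun y => ‖oscillatorMode n ε y‖)
    hf.smooth.continuous.norm.measurable (contDiff_oscillatorMode n ε).continuous.norm.measurable
  rw [← eLpNorm_norm]
  have e2 : (fun q => ‖productState θ f n ε q‖) = fun q : Plane =>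
      ‖f (inner ℝ (tangentVec θ) q)‖ * ‖oscillatorMode n ε (inner ℝ (normalVec θ) q)‖ := by
    ext q
    rw [productState, norm_mul, Complex.norm_real]
  rw [e2, e, eLpNorm_norm, eLpNorm_norm]
  exact ENNReal.mul_lt_top hfm ((H ε hε).1.trans_lt ENNReal.ofReal_lt_top)

/-- The product state is close to the quasimode of its longitudinal factor, which lives on the
straight part of the curve. -/
theorem exists_initialState_bound {ϑ : ℝ} (hϑ : ϑ ∈ Ioo 0 Real.pi) {k : ℝ → ℝ}
    (hk : ContDiff ℝ ∞ k) (hs : tsupport k ⊆ Ioo (-1) 1) (hi : ∫ s, k s = 1) (n : ℕ) {θ : ℝ}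
    {f : ℝ → ℂ} (hf : IsTestFunction univ f)
    (hedge : (θ = 0 ∧ tsupport f ⊆ Iio 0) ∨ (θ = ϑ ∧ tsupport f ⊆ Ioi 0)) :
    ∃ C a : ℝ, 0 ≤ C ∧ 0 < a ∧ ∀ d r K ε : ℝ, IsTubeWidth ϑ k d r K → d ≤ a → 0 < ε →
      (∀ s, f s ≠ 0 → scaledCurvature ϑ k d s = 0) ∧
      ‖toL2 (curveTube ϑ k d) (productState θ f n ε) -
        toL2 (curveTube ϑ k d) (quasimode ϑ k d r n ε f)‖ ≤ C * (d + Real.sqrt ε / r) := by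
  obtain ⟨Cs, hCs, hshift⟩ := exists_shift (k := k) hϑ hk hs hi
  obtain ⟨Cf, hCf, Hf⟩ := exists_eLpNorm_translate_sub_le hf
  obtain ⟨Co, hCo, Ho⟩ := exists_oscillator_bound n
  have h0 : (0 : ℝ) ∉ tsupport f := fun h => by
    rcases hedge with h' | h' <;> exact lt_irrefl (0 : ℝ) (h'.2 h)
  obtain ⟨a₀, ha₀, hball⟩ := Metric.isOpen_iff.1 (isClosed_tsupport f).isOpen_compl 0 h0
  have habs : ∀ s, f s ≠ 0 → a₀ ≤ |s| := fun s hs0 => by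
    by_contra hlt
    exact hball (show s ∈ Metric.ball 0 a₀ by simpa using hlt) (subset_tsupport _ hs0)
  -- The threshold ensures d + Cs·d ≤ a₀, so that the support of `f` stays on the straight part even
  -- after the shift, and Cs·d ≤ 1, as the translation estimate requires.
  refine ⟨Cf * Cs * Co + 2 * ‖toL2 univ f‖ * Co, min a₀ 1 / (1 + Cs), by positivity, by positivity,
    fun d r K ε h hda hε => ?_⟩
  have hd := h.d_pos
  have hr := h.r_pos
  have hd1 : d * (1 + Cs) ≤ min a₀ 1 := (le_div_iff₀ (by positivity)).1 hda
  have hd2 : d + Cs * d ≤ a₀ := by linarith [min_le_left a₀ 1]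
  have hd3 : d + Cs * d ≤ 1 := by linarith [min_le_right a₀ 1]
  have hCd : 0 ≤ Cs * d := by positivity
  have hκ0 : ∀ s, f s ≠ 0 → scaledCurvature ϑ k d s = 0 := fun s hs0 =>
    scaledCurvature_eq_zero hs hd (by linarith [habs s hs0])
  refine ⟨hκ0, ?_⟩
  obtain ⟨S, σ, hσ, hS, hfS, hfS'⟩ : ∃ (S : Set ℝ) (σ : ℝ), |σ| ≤ Cs * d ∧
      (∀ s ∈ S, scaledCurvature ϑ k d s = 0 ∧
        ∀ u, tubularMap ϑ k d (s, u) = (s + σ) • tangentVec θ + u • normalVec θ) ∧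
      (∀ s, f s ≠ 0 → s ∈ S) ∧ ∀ x, f x ≠ 0 → x - σ ∈ S := by
    obtain ⟨σ₁, σ₂, h1, h2, hL, hR⟩ := hshift d hd
    rcases hedge with ⟨rfl, hsupp⟩ | ⟨rfl, hsupp⟩
    · have hneg : ∀ s, f s ≠ 0 → s ≤ -a₀ := fun s hs0 => by
        have h3 : s < 0 := hsupp (subset_tsupport _ hs0)
        have := habs s hs0
        rw [abs_of_neg h3] at this
        linarith
      refine ⟨Iic (-d), σ₁, h1, fun s hsS => ⟨scaledCurvature_eq_zero hs hd ?_, fun u => ?_⟩,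
        fun s hs0 => ?_, fun x hx0 => ?_⟩
      · have : s ≤ -d := hsS
        rw [abs_of_neg (by linarith)]; linarith
      · rw [tubularMap, hL s hsS, turningAngle_eq_zero hs hd hsS]
      · exact (hneg s hs0).trans (by linarith)
      · have := hneg x hx0
        have := (abs_le.1 h1).1
        exact show x - σ₁ ≤ -d by linarith
    · have hpos : ∀ s, f s ≠ 0 → a₀ ≤ s := fun s hs0 => by
        have h3 : 0 < s := hsupp (subset_tsupport _ hs0)
        have := habs s hs0
        rwa [abs_of_pos h3] at this
      refine ⟨Ici d, σ₂, h2, fun s hsS => ⟨scaledCurvature_eq_zero hs hd ?_, fun u => ?_⟩,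
        fun s hs0 => ?_, fun x hx0 => ?_⟩
      · exact le_trans hsS (le_abs_self s)
      · rw [tubularMap, hR s hsS, turningAngle_eq hs hi hd hsS]
      · exact le_trans (by linarith) (hpos s hs0)
      · have := hpos x hx0
        have := (abs_le.1 h2).2
        exact show d ≤ x - σ₂ by linarith
  have hfc := hf.smooth.continuous
  have hoc := (contDiff_oscillatorMode n ε).continuous
  have mq : MemLp (quasimode ϑ k d r n ε f) 2
      ((volume : Measure Plane).restrict (curveTube ϑ k d)) :=
    (h.isTestFunction_quasimode n ε hf).memLp
  have mp := memLp_productState (θ := θ) hf n hε (curveTube ϑ k d)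
  have e1 : toL2 (curveTube ϑ k d) (productState θ f n ε) -
      toL2 (curveTube ϑ k d) (quasimode ϑ k d r n ε f) =
      toL2 (curveTube ϑ k d) (productState θ f n ε + (-1 : ℂ) • quasimode ϑ k d r n ε f) := by
    rw [toL2_add mp (mq.const_smul _), toL2_smul _ mq, neg_smul, one_smul, sub_eq_add_neg]
  rw [e1]
  refine norm_toL2_le_of_eLpNorm_le (by positivity) ?_
  set P₁ : ℝ → ℝ := fun x => ‖f x - f (x - σ)‖ with hP₁
  set m₁ : ℝ → ℝ := fun y => ‖oscillatorMode n ε y‖ with hm₁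
  set P₂ : ℝ → ℝ := fun x => ‖f (x - σ)‖ with hP₂
  set m₂ : ℝ → ℝ := (2 / r) • fun y => ‖y * oscillatorMode n ε y‖ with hm₂
  have cP₁ : Continuous P₁ := by fun_prop
  have cm₁ : Continuous m₁ := by fun_prop
  have cP₂ : Continuous P₂ := by fun_prop
  have cm₂ : Continuous m₂ := by
    refine Continuous.const_smul ?_ _
    fun_prop
  have hb : eLpNorm (productState θ f n ε + (-1 : ℂ) • quasimode ϑ k d r n ε f) 2
      ((volume : Measure Plane).restrict (curveTube ϑ k d)) ≤
      eLpNorm P₁ 2 volume * eLpNorm m₁ 2 volume + eLpNorm P₂ 2 volume * eLpNorm m₂ 2 volume := by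
    rw [← eLpNorm_frameCoord_mul θ cP₁.measurable cm₁.measurable,
      ← eLpNorm_frameCoord_mul θ cP₂.measurable cm₂.measurable]
    refine le_trans ?_ (eLpNorm_add_le (Continuous.aestronglyMeasurable (by fun_prop))
      (Continuous.aestronglyMeasurable (by fun_prop)) (by norm_num))
    refine (eLpNorm_mono_real fun q => ?_).trans (eLpNorm_mono_measure _ Measure.restrict_le_self)
    have := h.norm_productState_sub_quasimode_le n ε hS hfS hfS' q
    simpa [sub_eq_add_neg, hP₁, hP₂, hm₁, hm₂] using this
  refine hb.trans ?_
  have b1 : eLpNorm P₁ 2 volume ≤ ENNReal.ofReal (Cf * (Cs * d)) := by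
    rw [hP₁, eLpNorm_norm]
    exact (Hf σ (hσ.trans (by linarith))).trans (ENNReal.ofReal_le_ofReal (by gcongr))
  have b2 : eLpNorm m₁ 2 volume ≤ ENNReal.ofReal Co := by
    rw [hm₁, eLpNorm_norm]; exact (Ho ε hε).1
  have b3 : eLpNorm P₂ 2 volume ≤ ENNReal.ofReal ‖toL2 univ f‖ := by
    rw [hP₂, eLpNorm_norm, ofReal_norm_toL2 hf.memLp, Measure.restrict_univ]
    exact (eLpNorm_comp_measurePreserving (g := f) hfc.aestronglyMeasurable
      (measurePreserving_sub_right volume σ)).le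
  have b4 : eLpNorm m₂ 2 volume ≤ ENNReal.ofReal (2 / r * (Co * Real.sqrt ε)) := by
    rw [hm₂, eLpNorm_const_smul, eLpNorm_norm, Real.enorm_eq_ofReal (by positivity),
      ENNReal.ofReal_mul (by positivity)]
    exact mul_le_mul_right (Ho ε hε).2.1 _
  refine (add_le_add (mul_le_mul' b1 b2) (mul_le_mul' b3 b4)).trans ?_
  rw [← ENNReal.ofReal_mul (by positivity), ← ENNReal.ofReal_mul (by positivity),
    ← ENNReal.ofReal_add (by positivity) (by positivity)]
  refine ENNReal.ofReal_le_ofReal ?_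
  have x1 : 0 ≤ Cf * Cs * Co * (Real.sqrt ε / r) := by positivity
  have x2 : 0 ≤ 2 * ‖toL2 univ f‖ * Co * d := by positivity
  calc _ = Cf * Cs * Co * d + 2 * ‖toL2 univ f‖ * Co * (Real.sqrt ε / r) := by ring
    _ ≤ _ := by linarith

/-- The expression is the fifth power of the assumed rate; this is where the exponent 1/10 = (1/2)/5
enters. -/
lemma tendsto_sqrt_div_pow {δ : ℝ → ℝ}
    (hδ_rate : Tendsto (fun ε : ℝ => ε ^ (1 / 10 : ℝ) / δ ε) (𝓝[>] 0) (𝓝 0)) :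
    Tendsto (fun ε : ℝ => Real.sqrt ε / δ ε ^ 5) (𝓝[>] 0) (𝓝 0) := by
  have h := hδ_rate.pow 5
  rw [zero_pow (by norm_num)] at h
  refine h.congr' ?_
  filter_upwards [self_mem_nhdsWithin] with ε hε
  have hε' : (0 : ℝ) < ε := hε
  rw [div_pow, ← Real.rpow_natCast, ← Real.rpow_mul hε'.le, Real.sqrt_eq_rpow]
  norm_num

/-- The state in tubular coordinates is not known to be measurable on the whole tube, so the
triangle inequality is used in the form `eLpNorm_two_add_le`, which costs the factor 2. -/
lemma IsTubeWidth.eLpNorm_sub_le {ϑ : ℝ} {k : ℝ → ℝ} {d r K : ℝ}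
    (h : IsTubeWidth ϑ k d r K) (n : ℕ) {ε : ℝ} (hε : 0 < ε)
    (Ψ : Lp ℂ 2 ((volume : Measure Plane).restrict (curveTube ϑ k d)))
    (g : Lp ℂ 2 ((volume : Measure ℝ).restrict univ)) {z : ℂ} (hz : ‖z‖ = 1) {E Z : ℝ}
    (hE0 : 0 ≤ E) (hZ0 : 0 ≤ Z) (hE : ‖Ψ - z • quasimodeMap h n hε g‖ ≤ E)
    (hZ : eLpNorm (fun q => quasimode ϑ k d r n ε g q - g (tubularCoord ϑ k d q).1 *
          (oscillatorMode n ε (tubularCoord ϑ k d q).2 : ℂ)) 2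
        ((volume : Measure Plane).restrict (curveTube ϑ k d)) ≤ ENNReal.ofReal Z) :
    eLpNorm (fun q => Ψ q - z * g (tubularCoord ϑ k d q).1 *
        (oscillatorMode n ε (tubularCoord ϑ k d q).2 : ℂ)) 2
        ((volume : Measure Plane).restrict (curveTube ϑ k d)) ≤ ENNReal.ofReal (2 * (E + Z)) := by
  have hmemJ : MemLp (quasimode ϑ k d r n ε g) 2
      ((volume : Measure Plane).restrict (curveTube ϑ k d)) :=
    h.memLp_quasimode n hε (Lp.stronglyMeasurable g).measurable (by simpa using Lp.memLp g)
  have hae : (fun q => Ψ q - z * quasimode ϑ k d r n ε g q)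
      =ᵐ[(volume : Measure Plane).restrict (curveTube ϑ k d)]
        ⇑(Ψ - z • quasimodeMap h n hε g) := by
    have h3 : quasimodeMap h n hε g =ᵐ[(volume : Measure Plane).restrict (curveTube ϑ k d)]
      quasimode ϑ k d r n ε g := coeFn_toL2 hmemJ
    filter_upwards [Lp.coeFn_sub Ψ (z • quasimodeMap h n hε g),
      Lp.coeFn_smul z (quasimodeMap h n hε g), h3] with q h1 h2 h3
    rw [h1, Pi.sub_apply, h2, Pi.smul_apply, smul_eq_mul, h3]
  have hAn : eLpNorm (fun q => Ψ q - z * quasimode ϑ k d r n ε g q) 2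
      ((volume : Measure Plane).restrict (curveTube ϑ k d)) ≤ ENNReal.ofReal E := by
    rw [eLpNorm_congr_ae hae, ← ofReal_norm_toL2 (Lp.memLp _), toL2_coeFn]
    exact ENNReal.ofReal_le_ofReal hE
  have hsplit : (fun q => Ψ q - z * g (tubularCoord ϑ k d q).1 *
        (oscillatorMode n ε (tubularCoord ϑ k d q).2 : ℂ)) =
      (fun q => Ψ q - z * quasimode ϑ k d r n ε g q) +
      z • fun q => quasimode ϑ k d r n ε g q - g (tubularCoord ϑ k d q).1 *
          (oscillatorMode n ε (tubularCoord ϑ k d q).2 : ℂ) := by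
    ext q
    simp only [Pi.add_apply, Pi.smul_apply, smul_eq_mul]
    ring
  rw [hsplit]
  refine (eLpNorm_two_add_le ((Lp.aestronglyMeasurable _).congr hae.symm) _).trans ?_
  rw [eLpNorm_const_smul, ← ofReal_norm, hz, ENNReal.ofReal_one, one_mul,
    ENNReal.ofReal_mul (by norm_num), ENNReal.ofReal_ofNat, ENNReal.ofReal_add hE0 hZ0]
  exact mul_le_mul_right (add_le_add hAn hZ) _

/-- Unitarity in the tube carries the initial error to time `t` unchanged, where it adds to the
Duhamel error and to the error of replacing the quasimode by the unweighted product. -/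
lemma IsTubeWidth.eLpNorm_evolution_sub_le {ϑ : ℝ} {k : ℝ → ℝ} {d r K : ℝ}
    (h : IsTubeWidth ϑ k d r K) (n : ℕ) {ε : ℝ} (hε : 0 < ε) (f : ℝ → ℂ) (ψ : Plane → ℂ) (t : ℝ)
    {I E Z : ℝ} (hI0 : 0 ≤ I) (hE0 : 0 ≤ E) (hZ0 : 0 ≤ Z)
    (hI : ‖toL2 (curveTube ϑ k d) ψ - quasimodeMap h n hε (toL2 univ f)‖ ≤ I)
    (hE : ‖unitaryGroup (tubeHamiltonian ϑ k ε d) t (quasimodeMap h n hε (toL2 univ f)) -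
          Complex.exp (-(Complex.I * t * (((n + 1 / 2) / ε : ℝ) : ℂ))) •
            quasimodeMap h n hε (unitaryGroup (effectiveHamiltonian ϑ k d) t (toL2 univ f))‖ ≤ E)
    (hZ : eLpNorm (fun q => quasimode ϑ k d r n ε
          (unitaryGroup (effectiveHamiltonian ϑ k d) t (toL2 univ f)) q -
          unitaryGroup (effectiveHamiltonian ϑ k d) t (toL2 univ f) (tubularCoord ϑ k d q).1 *
          (oscillatorMode n ε (tubularCoord ϑ k d q).2 : ℂ)) 2
        ((volume : Measure Plane).restrict (curveTube ϑ k d)) ≤ ENNReal.ofReal Z) :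
    eLpNorm (fun q => tubeEvolution ϑ k ε d t ψ q - effectiveState ϑ k ε d t f n q) 2
        ((volume : Measure Plane).restrict (curveTube ϑ k d)) ≤
      ENNReal.ofReal (2 * (I + E + Z)) := by
  have hz' : Complex.exp (-(Complex.I * t * (((n : ℂ) + 1 / 2) / ε))) =
      Complex.exp (-(Complex.I * t * (((n + 1 / 2) / ε : ℝ) : ℂ))) := by
    push_cast; rfl
  have hzn : ‖Complex.exp (-(Complex.I * t * (((n + 1 / 2) / ε : ℝ) : ℂ)))‖ = 1 := by
    rw [Complex.norm_exp]
    simp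
  simp only [tubeEvolution, effectiveState, effectiveEvolution, hz']
  refine h.eLpNorm_sub_le n hε _ _ hzn (add_nonneg hI0 hE0) hZ0 ?_ hZ
  refine (norm_sub_le_norm_sub_add_norm_sub _ (unitaryGroup (tubeHamiltonian ϑ k ε d) t
    (quasimodeMap h n hε (toL2 univ f))) _).trans (add_le_add ?_ hE)
  rw [← map_sub, LinearIsometryEquiv.norm_map]
  exact hI

end Conclusion

theorem mainTheorem4
    (ϑ : ℝ) (hϑ : ϑ ∈ Ioo 0 Real.pi)
    (k : ℝ → ℝ) (hk : ContDiff ℝ ∞ k) (hk_supp : tsupport k ⊆ Ioo (-1) 1)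
    (hk_int : ∫ s, k s = 1)
    (hcurve : ∀ d : ℝ, 0 < d → Function.Injective (smoothedCurve ϑ k d))
    (δ : ℝ → ℝ) (hδ_pos : ∀ᶠ ε in 𝓝[>] (0 : ℝ), 0 < δ ε)
    (hδ_zero : Tendsto δ (𝓝[>] 0) (𝓝 0))
    (hδ_rate : Tendsto (fun ε : ℝ => ε ^ (1 / 10 : ℝ) / δ ε) (𝓝[>] 0) (𝓝 0))
    (n : ℕ) (θ : ℝ) (f : ℝ → ℂ) (hf : ContDiff ℝ ∞ f) (hf_supp : HasCompactSupport f)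
    (hedge : (θ = 0 ∧ tsupport f ⊆ Iio 0) ∨ (θ = ϑ ∧ tsupport f ⊆ Ioi 0))
    (T : ℝ) :
    ∀ η : ℝ, 0 < η → ∀ᶠ ε in 𝓝[>] (0 : ℝ), ∀ t ∈ Icc 0 T,
      eLpNorm (fun q => tubeEvolution ϑ k ε (δ ε) t (productState θ f n ε) q -
          effectiveState ϑ k ε (δ ε) t f n q) 2
        ((volume : Measure Plane).restrict (curveTube ϑ k (δ ε))) ≤ ENNReal.ofReal η := by
  intro η hη
  have hft : IsTestFunction univ f := ⟨hf, hf_supp, subset_univ _⟩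
  obtain ⟨c, K, hc, hwidth⟩ := exists_isTubeWidth hϑ hk hk_supp hk_int (hcurve 1 one_pos)
  obtain ⟨C₁, hC₁, H₁⟩ := exists_evolution_bound n K
  obtain ⟨C₂, hC₂, H₂⟩ := exists_effectiveState_bound n K
  obtain ⟨C₃, a, hC₃, ha, H₃⟩ := exists_initialState_bound hϑ hk hk_supp hk_int n hft hedge
  set N₁ := ‖toL2 univ f‖ with hN₁
  set N₂ := ‖toL2 univ fun x => -(1 / 2 : ℂ) * Laplacian.laplacian f x‖ with hN₂
  -- The three summands are the errors of the initial state, of the evolution and of the final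
  -- state, with r = cδ.
  set R : ℝ → ℝ := fun ε => 2 * (C₃ * (δ ε + Real.sqrt ε / (c * δ ε)) +
    C₁ * Real.sqrt ε / (c * δ ε) ^ 5 * (N₁ + N₂) * |T| +
    C₂ * Real.sqrt ε / (c * δ ε) * N₁) with hR
  have hlim : Tendsto R (𝓝[>] 0) (𝓝 0) := by
    have h5 := tendsto_sqrt_div_pow hδ_rate
    -- The weaker rate is the product of √ε/δ⁵ and δ⁴, both of which tend to 0.
    have h1 : Tendsto (fun ε : ℝ => Real.sqrt ε / δ ε) (𝓝[>] 0) (𝓝 0) := by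
      have h := h5.mul (hδ_zero.pow 4)
      rw [zero_mul] at h
      refine h.congr' ?_
      filter_upwards [hδ_pos] with ε hε
      field_simp
    have h := ((((hδ_zero.add (h1.const_mul c⁻¹)).const_mul C₃).add
      (h5.const_mul (C₁ * (c ^ 5)⁻¹ * (N₁ + N₂) * |T|))).add
      (h1.const_mul (C₂ * c⁻¹ * N₁))).const_mul 2
    simp only [mul_zero, add_zero] at h
    refine h.congr fun ε => ?_
    simp only [hR, div_eq_mul_inv, mul_inv, mul_pow]
    ring
  filter_upwards [hδ_pos, self_mem_nhdsWithin, hδ_zero.eventually_le_const one_pos,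
    hδ_zero.eventually_le_const ha, hlim.eventually_le_const hη] with ε hd hε hd1 hda hRη t ht
  have hε' : (0 : ℝ) < ε := hε
  set d := δ ε with hdd
  have h := hwidth d hd hd1
  have hr := h.r_pos
  obtain ⟨hκ0, hinit⟩ := H₃ d (c * d) K ε h hda hε'
  have hevol := H₁ ϑ k d (c * d) h ε hε' f hft t ht.1
  -- The potential, of size δ^(-2), vanishes on the support of `f`. The graph norm of `f` is thus
  -- independent of δ.
  have hop : effectiveOp ϑ k d f = fun x => -(1 / 2 : ℂ) * Laplacian.laplacian f x := by
    ext x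
    rw [effectiveOp]
    by_cases hx : f x = 0
    · rw [hx, mul_zero, add_zero]
    · rw [hκ0 x hx]; simp
  rw [hop, ← hN₁, ← hN₂] at hevol
  have hE : C₁ * Real.sqrt ε / (c * d) ^ 5 * (N₁ + N₂) * t ≤
      C₁ * Real.sqrt ε / (c * d) ^ 5 * (N₁ + N₂) * |T| := by
    have : t ≤ |T| := ht.2.trans (le_abs_self T)
    gcongr
  have hZ := H₂ ϑ k d (c * d) h ε hε'
    (unitaryGroup (effectiveHamiltonian ϑ k d) t (toL2 univ f))
  rw [LinearIsometryEquiv.norm_map, ← hN₁] at hZ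
  rw [← quasimodeMap_toL2 h n hε' hf.continuous.measurable hft.memLp] at hinit
  exact (h.eLpNorm_evolution_sub_le n hε' f (productState θ f n ε) t (by positivity)
    (by positivity) (by positivity) hinit (hevol.trans hE) hZ).trans (ENNReal.ofReal_le_ofReal hRη)

end
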